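/- **Setting.** An almost quaternionic structure on a smooth manifold $M$ (Hausdorff, second countable, without boundary) of dimension $4n$ is a rank four subbundle $\mathcal Q\subset T^*M\otimes TM=\operatorname{End}(TM)$ which is locally generated by the identity $E$ and a smooth almost hypercomplex structure, i.e. smooth affinors $I,J,K$ with $I^2=J^2=-E$ and $K=I\circ J=-J\circ I$. For $X\in T_xM$ and $\eta\in T_x^*M$ let $\{X,\eta\}\in\operatorname{End}(T_xM)$ be $$\{X,\eta\}W=\eta(X)W+\eta(W)X-\sum_{A\in\{I,J,K\}}\bigl(\eta(AX)\,AW+\eta(AW)\,AX\bigr),$$ which does not depend on the choice of $I,J,K$ in $\mathcal Q_x$ (it is the bracket $\mathfrak g_{-1}\times\mathfrak g_1\to\mathfrak g_0$ of the graded Lie algebra $\mathfrak{sl}(n+1,\mathbb H)$). A Weyl connection of $(M,\mathcal Q)$ is a smooth linear connection $\nabla$ on $TM$ which preserves $\mathcal Q$ ($\nabla_X F\in\Gamma(\mathcal Q)$ for all $F\in\Gamma(\mathcal Q)$ and all vector fields $X$) and whose torsion $T$ is normalized, i.e. $\sum_i\{T(e_i,X),\eta^i\}=0$ for all $X\in T_xM$,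 $x\in M$, where $(e_i)$ is a basis of $T_xM$ with dual basis $(\eta^i)$. An unparameterized geodesic of $\nabla$ is a smooth curve $c:\mathbb R\to M$ with nowhere vanishing velocity such that $\nabla_{\dot c}\dot c$ is everywhere a multiple of $\dot c$. **Theorem 3.1.** Let $n\ge 2$, let $(M,\mathcal Q)$ and $(M',\mathcal Q')$ be almost quaternionic manifolds of dimension $4n$, and let $f:M\to M'$ be a diffeomorphism. The following are equivalent. 1. $f$ is a morphism of almost quaternionic geometries, i.e. $f^*\mathcal Q'=\mathcal Q$: for each $x\in M$, $\mathcal Q_x$ consists exactly of the endomorphisms $(T_xf)^{-1}\circ G\circ T_xf$ with $G\in\mathcal Q'_{f(x)}$. 2. For every curve $c:\mathbb R\to M$ that is an unparameterized geodesic of some Weyl connection on $M$, $f\circ c$ is an unparameterized geodesic of some Weyl connection on $M'$. 3. A curve $c:\mathbb R\to M$ is an unparameterized geodesic of some Weyl connection on $M$ if and only if $f\circ c$ is an unparameterized geodesic of some Weyl connection on $M'$. -/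

import Mathlib

open scoped Manifold ContDiff Topology
open Bundle

noncomputable section

namespace AlmostQuaternionic

section LinearAlgebra

variable {V : Type*} [AddCommGroup V] [Module ℝ V] [TopologicalSpace V]
  [IsTopologicalAddGroup V] [ContinuousSMul ℝ V]

/-- `(A, B, C)` is a hypercomplex triple of endomorphisms of `V`:
`A² = B² = -1` and `C = A ∘ B = -B ∘ A`. -/
structure IsHypercomplex (A B C : V →L[ℝ] V) : Prop where
  sq_left : A ∘L A = -ContinuousLinearMap.id ℝ V
  sq_right : B ∘L B = -ContinuousLinearMap.id ℝ V
  eq_comp : C = A ∘L B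
  anticomm : A ∘L B = -(B ∘L A)

/-- The algebraic bracket `{X, η}`, an endomorphism of `V`, of a vector `X` and a real covector `η`
with respect to the hypercomplex triple `(A, B, C)`. If `V = ℍⁿ` is the component `𝔤₋₁` and
`V* = (ℍⁿ)*` is the component `𝔤₁` of the graded Lie algebra `𝔰𝔩(n+1, ℍ)`, and a covector `η` is
identified with the quaternionic row `Z` such that `η Y = Re (Z Y)`, then this is the commutator
`[X, Z] ∈ 𝔤₀` acting on `𝔤₋₁ = V`, i.e. `{X, η} W = X (Z W) + W (Z X)`. It depends
only on the span of `A, B, C`. -/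
def bracket (A B C : V →L[ℝ] V) (X : V) (η : Module.Dual ℝ V) (W : V) : V :=
  (η X • W + η W • X)
    - (η (A X) • A W + η (A W) • A X)
    - (η (B X) • B W + η (B W) • B X)
    - (η (C X) • C W + η (C W) • C X)

/-- The (Kostant) codifferential `∂* : Λ²V* ⊗ V → V* ⊗ 𝔤₀`, up to a nonzero constant factor,
`(∂* T)(X) = ∑ᵢ {T (eᵢ, X), ηⁱ}`, where `(eᵢ)` is a basis of `V` with dual basis `(ηⁱ)`
(the choice of the basis does not matter); the endomorphism `(∂* T)(X)` is evaluated at `W`. -/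
def codifferential [FiniteDimensional ℝ V] (A B C : V →L[ℝ] V)
    (T : V →L[ℝ] V →L[ℝ] V) (X W : V) : V :=
  ∑ i, bracket A B C (T (Module.finBasis ℝ V i) X)
    ((Module.finBasis ℝ V).coord i) W

end LinearAlgebra

section Manifold

variable {E : Type*} [NormedAddCommGroup E] [NormedSpace ℝ E]
  {M : Type*} [TopologicalSpace M] [ChartedSpace E M] [IsManifold 𝓘(ℝ, E) ∞ M]

/-- The field of endomorphisms `F` of the tangent spaces (an affinor), as a map to the total space
of the bundle `T*M ⊗ TM = Hom(TM, TM)`. -/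
def affinorSection
    (F : ∀ x : M, TangentSpace 𝓘(ℝ, E) x →L[ℝ] TangentSpace 𝓘(ℝ, E) x) (x : M) :
    TotalSpace (E →L[ℝ] E)
      (fun x : M ↦ TangentSpace 𝓘(ℝ, E) x →L[ℝ] TangentSpace 𝓘(ℝ, E) x) :=
  ⟨x, F x⟩

/-- The vector field `X`, as a map to the total space of the tangent bundle. -/
def fieldSection (X : ∀ x : M, TangentSpace 𝓘(ℝ, E) x) (x : M) :
    TotalSpace E (TangentSpace 𝓘(ℝ, E) : M → Type _) :=
  ⟨x, X x⟩

variable (E M) in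
/-- An almost quaternionic structure on `M`: a subbundle `Q` of `T*M ⊗ TM`, locally
generated by the identity and a smooth almost hypercomplex structure. -/
structure Structure where
  /-- The fibre of the subbundle at `x`. -/
  fibre : ∀ x : M, Submodule ℝ (TangentSpace 𝓘(ℝ, E) x →L[ℝ] TangentSpace 𝓘(ℝ, E) x)
  locally_generated : ∀ x₀ : M, ∃ U : Set M, IsOpen U ∧ x₀ ∈ U ∧
    ∃ A B C : ∀ x : M, TangentSpace 𝓘(ℝ, E) x →L[ℝ] TangentSpace 𝓘(ℝ, E) x,
      ContMDiffOn 𝓘(ℝ, E) (𝓘(ℝ, E).prod 𝓘(ℝ, E →L[ℝ] E)) ∞ (affinorSection A) U ∧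
      ContMDiffOn 𝓘(ℝ, E) (𝓘(ℝ, E).prod 𝓘(ℝ, E →L[ℝ] E)) ∞ (affinorSection B) U ∧
      ContMDiffOn 𝓘(ℝ, E) (𝓘(ℝ, E).prod 𝓘(ℝ, E →L[ℝ] E)) ∞ (affinorSection C) U ∧
      ∀ x ∈ U, IsHypercomplex (A x) (B x) (C x) ∧
        fibre x = Submodule.span ℝ
          {ContinuousLinearMap.id ℝ (TangentSpace 𝓘(ℝ, E) x), A x, B x, C x}

/-- The connection `cov` on `TM` is compatible with `Q`: for every (local) smooth section `F` of `Q`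
and tangent vector `v` at `x`, the endomorphism `∇_v F = [Y ↦ ∇_v (F Y) - F (∇_v Y)]` of `T_x M`
lies in `Q_x`. (`cov Y x v` is `∇_v Y`.) -/
def Structure.IsCompatible (Q : Structure E M)
    (cov : CovariantDerivative 𝓘(ℝ, E) E (TangentSpace 𝓘(ℝ, E) : M → Type _)) : Prop :=
  ∀ (x : M) (F : ∀ y : M, TangentSpace 𝓘(ℝ, E) y →L[ℝ] TangentSpace 𝓘(ℝ, E) y),
    ContMDiffAt 𝓘(ℝ, E) (𝓘(ℝ, E).prod 𝓘(ℝ, E →L[ℝ] E)) ∞ (affinorSection F) x →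
    (∀ᶠ y in 𝓝 x, F y ∈ Q.fibre y) →
    ∀ v : TangentSpace 𝓘(ℝ, E) x, ∃ G ∈ Q.fibre x,
      ∀ Y : ∀ y : M, TangentSpace 𝓘(ℝ, E) y,
        ContMDiffAt 𝓘(ℝ, E) (𝓘(ℝ, E).prod 𝓘(ℝ, E)) ∞ (fieldSection Y) x →
        cov (fun y ↦ F y (Y y)) x v - F x (cov Y x v) = G (Y x)

/-- A Weyl connection of `Q`: a smooth connection on `TM` compatible with `Q`, whose torsion is
normalized in the sense of parabolic geometry, i.e. annihilated by the codifferential `∂*`. -/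
structure Structure.IsWeyl [FiniteDimensional ℝ E] [CompleteSpace E] (Q : Structure E M)
    (cov : CovariantDerivative 𝓘(ℝ, E) E (TangentSpace 𝓘(ℝ, E) : M → Type _)) : Prop where
  smooth : cov.ContMDiffCovariantDerivative ∞
  compatible : Q.IsCompatible cov
  normalized : ∀ (x : M) (A B C : TangentSpace 𝓘(ℝ, E) x →L[ℝ] TangentSpace 𝓘(ℝ, E) x),
    A ∈ Q.fibre x → B ∈ Q.fibre x → C ∈ Q.fibre x → IsHypercomplex A B C →
    letI : FiniteDimensional ℝ (TangentSpace 𝓘(ℝ, E) x) := inferInstanceAs (FiniteDimensional ℝ E)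
    ∀ X W : TangentSpace 𝓘(ℝ, E) x, codifferential A B C (cov.torsion x) X W = 0

/-- The velocity of a curve. -/
def velocity (c : ℝ → M) (t : ℝ) : TangentSpace 𝓘(ℝ, E) (c t) :=
  mfderiv 𝓘(ℝ, ℝ) 𝓘(ℝ, E) c t (1 : ℝ)

/-- `c` is an unparameterized geodesic of the connection `cov`: a smooth regular curve such that
`∇_ċ ċ` is everywhere a multiple of `ċ`. Since `c` is regular, `∇_ċ ċ` at time `t` is `∇_ċ X`
for a vector field `X` that extends `ċ` near `t` (it exists, and the choice does not matter). -/
structure IsUnparameterizedGeodesic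
    (cov : CovariantDerivative 𝓘(ℝ, E) E (TangentSpace 𝓘(ℝ, E) : M → Type _))
    (c : ℝ → M) : Prop where
  smooth : ContMDiff 𝓘(ℝ, ℝ) 𝓘(ℝ, E) ∞ c
  regular : ∀ t, velocity (E := E) c t ≠ 0
  acceleration : ∀ t, ∃ X : ∀ y : M, TangentSpace 𝓘(ℝ, E) y,
    ContMDiff 𝓘(ℝ, E) (𝓘(ℝ, E).prod 𝓘(ℝ, E)) ∞ (fieldSection X) ∧
    (∀ᶠ s in 𝓝 t, X (c s) = velocity c s) ∧
    ∃ a : ℝ, cov X (c t) (velocity c t) = a • velocity (E := E) c t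

/-- `c` is an unparameterized geodesic of some Weyl connection of `Q`. -/
def Structure.IsWeylGeodesic [FiniteDimensional ℝ E] [CompleteSpace E] (Q : Structure E M)
    (c : ℝ → M) : Prop :=
  ∃ cov : CovariantDerivative 𝓘(ℝ, E) E (TangentSpace 𝓘(ℝ, E) : M → Type _),
    Q.IsWeyl cov ∧ IsUnparameterizedGeodesic cov c

variable {E' : Type*} [NormedAddCommGroup E'] [NormedSpace ℝ E']
  {M' : Type*} [TopologicalSpace M'] [ChartedSpace E' M'] [IsManifold 𝓘(ℝ, E') ∞ M']

/-- `f` is a morphism of almost quaternionic geometries: `Q = f^* Q'`, where the pullback consists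
of the endomorphisms `F = (df)⁻¹ ∘ G ∘ df` with `G` in `Q'`. -/
def IsMorphism (Q : Structure E M) (Q' : Structure E' M')
    (f : M ≃ₘ⟮𝓘(ℝ, E), 𝓘(ℝ, E')⟯ M') : Prop :=
  ∀ (x : M) (F : TangentSpace 𝓘(ℝ, E) x →L[ℝ] TangentSpace 𝓘(ℝ, E) x),
    F ∈ Q.fibre x ↔ ∃ G ∈ Q'.fibre (f x),
      mfderiv 𝓘(ℝ, E) 𝓘(ℝ, E') f x ∘L F = G ∘L mfderiv 𝓘(ℝ, E) 𝓘(ℝ, E') f x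

end Manifold

end AlmostQuaternionic

end

/-!
A morphism transports everything that enters the definition of Weyl connections and of their
geodesics: the pullback of a Weyl connection is a Weyl connection
(`Structure.IsWeylOn.pullbackConnection`), and a curve is one of its unparameterized geodesics as
soon as the image of the curve is a geodesic of the original connection
(`IsUnparameterizedGeodesic.pullback`). Applied to the diffeomorphism and to its inverse, this shows
that a morphism preserves and reflects Weyl geodesics (`IsMorphism.isWeylGeodesic`).

Conversely, suppose that `f` maps Weyl geodesics to Weyl geodesics. Weyl connections exist
(`Structure.exists_isWeyl`). Locally, a flat connection is averaged so that a hypercomplex frame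
becomes parallel, its torsion is brought into normal form by adding one-forms with values in the
quaternionic linear maps and in the imaginary quaternions (`linearCorrection`, `traceCorrection`),
and the local connections are glued by a partition of unity. At a given point a Weyl connection may
be modified by the bracket `{X, η}` with an arbitrary covector `η`
(`Structure.IsWeylOn.exists_bracket`), and every smooth connection has a geodesic, defined on all of
`ℝ` as an unparameterized curve, in each direction `v` (`exists_isUnparameterizedGeodesic`).

Now take two Weyl connections of `Q` which differ by `{X, η}` at `x`, and compare each of them with
the pullback of a Weyl connection of `Q'` that has the image of its geodesic in the direction `v` as
a geodesic. Connections that share a geodesic differ, along its velocity and applied to its velocity,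
by a multiple of the velocity (`IsUnparameterizedGeodesic.exists_sub_eq`). Two Weyl connections of
`Q'` differ in the same sense by a quaternionic multiple of the velocity
(`Structure.IsWeylOn.exists_sub_eq`); this is the algebraic fact `quaternion_of_torsion` about
connections which preserve the quaternions and whose torsions have the same quaternionic linear part.
So `df ({v, η} v)` is a `Q'`-multiple of `df v` (`exists_mem_fibre_tangentEquiv_bracket`).

For suitable `η` the vector `{v, η} v` is `A v`, `B v` or `C v`, where `A, B, C` is a hypercomplex
basis of `Q` at `x`. Hence `df ∘ A ∘ df⁻¹` maps every vector to a quaternionic multiple of itself. In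
real dimension greater than four there is more than one quaternionic line, and then such a map is a
quaternion (`HypercomplexRel.isQuaternion_of_forall_exists`). Therefore `df` conjugates `Q` into
`Q'`, and the two have the same dimension.
-/

noncomputable section

namespace AlmostQuaternionic

/-! ### Quaternionic linear algebra -/

section QuaternionicAlgebra

variable {V : Type*} [AddCommGroup V] [Module ℝ V]

/-- The relations of a hypercomplex triple, for linear maps and evaluated at vectors. -/
structure HypercomplexRel (a b c : V →ₗ[ℝ] V) : Prop where
  aa : ∀ v, a (a v) = -v
  bb : ∀ v, b (b v) = -v
  ab : ∀ v, a (b v) = c v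
  ba : ∀ v, b (a v) = -c v

/-- `F` is the action of a quaternion, i.e. a combination of the identity and `a, b, c`. -/
def IsQuaternion (a b c : V →ₗ[ℝ] V) (F : V → V) : Prop :=
  ∃ p q r s : ℝ, ∀ v, F v = p • v + q • a v + r • b v + s • c v

/-- Four times the projection of an endomorphism to the endomorphisms that commute with the
hypercomplex triple. -/
def linearPart (a b c L : V →ₗ[ℝ] V) : V →ₗ[ℝ] V :=
  L - a ∘ₗ L ∘ₗ a - b ∘ₗ L ∘ₗ b - c ∘ₗ L ∘ₗ c

lemma linearPart_apply (a b c L : V →ₗ[ℝ] V) (v : V) :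
    linearPart a b c L v = L v - a (L (a v)) - b (L (b v)) - c (L (c v)) := rfl

lemma linearPart_sub (a b c L L' : V →ₗ[ℝ] V) :
    linearPart a b c (L - L') = linearPart a b c L - linearPart a b c L' := by
  ext v; simp only [linearPart_apply, LinearMap.sub_apply, map_sub]; module

namespace HypercomplexRel

variable {a b c : V →ₗ[ℝ] V} (h : HypercomplexRel a b c)
include h

lemma bc (v : V) : b (c v) = a v := by
  have := congrArg b (h.ba v); rw [h.bb, map_neg] at this; exact (neg_injective this).symm

lemma cc (v : V) : c (c v) = -v := by rw [← h.ab (c v), h.bc, h.aa]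

lemma cb (v : V) : c (b v) = -a v := by rw [← h.ab, h.bb, map_neg]

lemma ac (v : V) : a (c v) = -b v := by rw [← h.ab, h.aa]

lemma ca (v : V) : c (a v) = b v := by
  rw [← neg_eq_iff_eq_neg.mpr (h.ba (a v)), h.aa, map_neg, neg_neg]

lemma linearPart_comm (L : V →ₗ[ℝ] V) (v : V) :
    linearPart a b c L (a v) = a (linearPart a b c L v) ∧
    linearPart a b c L (b v) = b (linearPart a b c L v) ∧
    linearPart a b c L (c v) = c (linearPart a b c L v) := by
  refine ⟨?_, ?_, ?_⟩ <;>
  simp only [linearPart_apply, map_sub, map_neg, h.aa, h.bb, h.ab, h.ba, h.bc, h.cb, h.ac, h.ca,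
    h.cc] <;> module

end HypercomplexRel

namespace IsQuaternion
variable {a b c : V →ₗ[ℝ] V}

lemma add {F G : V → V} (hF : IsQuaternion a b c F) (hG : IsQuaternion a b c G) :
    IsQuaternion a b c (fun v ↦ F v + G v) := by
  obtain ⟨p, q, r, s, hF⟩ := hF
  obtain ⟨p', q', r', s', hG⟩ := hG
  exact ⟨p + p', q + q', r + r', s + s', fun v ↦ by simp only [hF, hG]; module⟩

lemma smul {F : V → V} (hF : IsQuaternion a b c F) (t : ℝ) :
    IsQuaternion a b c (fun v ↦ t • F v) := by
  obtain ⟨p, q, r, s, hF⟩ := hF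
  exact ⟨t * p, t * q, t * r, t * s, fun v ↦ by simp only [hF]; module⟩

lemma sub {F G : V → V} (hF : IsQuaternion a b c F) (hG : IsQuaternion a b c G) :
    IsQuaternion a b c (fun v ↦ F v - G v) := by
  simpa [sub_eq_add_neg] using hF.add (hG.smul (-1))

lemma comp (h : HypercomplexRel a b c) {F G : V → V} (hF : IsQuaternion a b c F)
    (hG : IsQuaternion a b c G) : IsQuaternion a b c (fun v ↦ F (G v)) := by
  obtain ⟨p, q, r, s, hF⟩ := hF
  obtain ⟨p', q', r', s', hG⟩ := hG
  refine ⟨p * p' - q * q' - r * r' - s * s', p * q' + q * p' + r * s' - s * r',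
    p * r' + r * p' + s * q' - q * s', p * s' + s * p' + q * r' - r * q', fun v ↦ ?_⟩
  simp only [hF, hG, map_add, map_smul, h.aa, h.bb, h.ab, h.ba, h.bc, h.cb, h.ac, h.ca, h.cc]
  module

lemma left : IsQuaternion a b c a := ⟨0, 1, 0, 0, fun v ↦ by module⟩
lemma middle : IsQuaternion a b c b := ⟨0, 0, 1, 0, fun v ↦ by module⟩
lemma right : IsQuaternion a b c c := ⟨0, 0, 0, 1, fun v ↦ by module⟩
lemma id : IsQuaternion a b c (fun v ↦ v) := ⟨1, 0, 0, 0, fun v ↦ by module⟩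

end IsQuaternion

/-- An endomorphism that normalizes the quaternions is, modulo a quaternion, quaternion-linear. -/
lemma HypercomplexRel.isQuaternion_sub_linearPart {a b c : V →ₗ[ℝ] V} (h : HypercomplexRel a b c)
    (S : V →ₗ[ℝ] V)
    (ha : IsQuaternion a b c (fun w ↦ S (a w) - a (S w)))
    (hb : IsQuaternion a b c (fun w ↦ S (b w) - b (S w)))
    (hc : IsQuaternion a b c (fun w ↦ S (c w) - c (S w))) :
    IsQuaternion a b c (fun w ↦ S w - (1 / 4 : ℝ) • linearPart a b c S w) := by
  have := (((IsQuaternion.left.comp h ha).add (IsQuaternion.middle.comp h hb)).add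
    (IsQuaternion.right.comp h hc)).smul (1 / 4)
  convert this using 2 with w
  simp only [linearPart_apply, map_sub, h.aa, h.bb, h.cc]
  module

/-- Let `S` be the difference of two connections that preserve the quaternions, so that all `S v`
normalize them, and let the difference of the torsions have no quaternionic linear part. Then
`S X X` is a quaternionic multiple of `X`. -/
lemma quaternion_of_torsion {a b c : V →ₗ[ℝ] V} (h : HypercomplexRel a b c)
    (S : V →ₗ[ℝ] V →ₗ[ℝ] V)
    (ha : ∀ v, IsQuaternion a b c (fun w ↦ S v (a w) - a (S v w)))
    (hb : ∀ v, IsQuaternion a b c (fun w ↦ S v (b w) - b (S v w)))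
    (hc : ∀ v, IsQuaternion a b c (fun w ↦ S v (c w) - c (S v w)))
    (hS : ∀ X, linearPart a b c (S.flip X - S X) = 0) (X : V) :
    ∃ F : V → V, IsQuaternion a b c F ∧ S X X = F X := by
  choose s₀ s₁ s₂ s₃ hs using
    fun v ↦ h.isQuaternion_sub_linearPart (S v) (ha v) (hb v) (hc v)
  set G : V → V → V := fun v ↦ linearPart a b c (S v) with hG
  have hS1 : ∀ v w, S v w =
      (1 / 4 : ℝ) • G v w + s₀ v • w + s₁ v • a w + s₂ v • b w + s₃ v • c w := by
    intro v w
    have := hs v w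
    rw [sub_eq_iff_eq_add] at this
    rw [this]; simp only [hG]; module
  have hGa : ∀ v w, G v (a w) = a (G v w) := fun v w ↦ (h.linearPart_comm (S v) w).1
  have hGb : ∀ v w, G v (b w) = b (G v w) := fun v w ↦ (h.linearPart_comm (S v) w).2.1
  have hGc : ∀ v w, G v (c w) = c (G v w) := fun v w ↦ (h.linearPart_comm (S v) w).2.2
  -- `K w x = G x w` is the assumption on the torsion
  set K : V → V → V := fun w x ↦ S w x - a (S (a w) x) - b (S (b w) x) - c (S (c w) x) with hK
  have hKG : ∀ w x, K w x = G x w := by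
    intro w x
    have := congrArg (fun L ↦ L w) (hS x)
    rw [linearPart_sub] at this
    rw [← sub_eq_zero]
    exact this
  -- the corresponding sum for `G`; it is computed in two ways, from `hKq` and from `hgK`, and
  -- the comparison at `w = x = X` determines `G X X`
  set g : V → V → V := fun x w ↦ G x w - a (G (a x) w) - b (G (b x) w) - c (G (c x) w) with hg
  set r : V → ℝ := fun w ↦ s₀ w + s₁ (a w) + s₂ (b w) + s₃ (c w) with hr
  set q : V → V → V := fun w x ↦ r w • x + (s₁ w - s₀ (a w) + s₂ (c w) - s₃ (b w)) • a x
    + (s₂ w - s₀ (b w) + s₃ (a w) - s₁ (c w)) • b x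
    + (s₃ w - s₀ (c w) + s₁ (b w) - s₂ (a w)) • c x with hq
  have hKq : ∀ w x, K w x = (1 / 4 : ℝ) • g w x + q w x := by
    intro w x
    simp only [hK, hg, hq, hr, hS1, map_add, map_smul, h.aa, h.bb, h.ab, h.ba, h.bc, h.cb, h.ac,
      h.ca, h.cc]
    module
  have hgK : ∀ x w, g x w = K w x - a (K w (a x)) - b (K w (b x)) - c (K w (c x)) := by
    intro x w
    simp only [hKG, hg]
  have hgG : ∀ x w, g x w = G w x + (4 * r w) • x := by
    intro x w
    rw [hgK]
    simp only [hKq, hg, hq, hGa, hGb, hGc, map_sub, map_add, map_smul, map_neg, h.aa, h.bb, h.ab,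
      h.ba, h.bc, h.cb, h.ac, h.ca, h.cc]
    module
  have key : (3 / 4 : ℝ) • G X X = r X • X + q X X := by
    have := hKq X X
    rw [hKG, hgG] at this
    have e : r X • X + q X X = G X X - (1 / 4 : ℝ) • G X X := by
      nth_rewrite 1 [this]; module
    rw [e]; module
  have key' : (1 / 4 : ℝ) • G X X = (1 / 3 : ℝ) • (r X • X + q X X) := by rw [← key]; module
  refine ⟨fun v ↦ (1 / 3 : ℝ) • (r X • v + q X v) + s₀ X • v + s₁ X • a v + s₂ X • b v + s₃ X • c v,
    ?_, by rw [hS1 X X, key']⟩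
  refine ((((IsQuaternion.smul ?_ _).add (IsQuaternion.id.smul _)).add
    (IsQuaternion.left.smul _)).add (IsQuaternion.middle.smul _)).add (IsQuaternion.right.smul _)
  exact (IsQuaternion.id.smul _).add ⟨_, _, _, _, fun v ↦ rfl⟩

lemma linearPart_linear (a b c : V →ₗ[ℝ] V) (T : V →ₗ[ℝ] V →ₗ[ℝ] V) (t : ℝ) (X Y : V) :
    linearPart a b c (T (X + Y)) = linearPart a b c (T X) + linearPart a b c (T Y) ∧
    linearPart a b c (T (t • X)) = t • linearPart a b c (T X) := by
  constructor <;> ext v <;>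
  simp only [linearPart_apply, map_add, map_smul, LinearMap.add_apply, LinearMap.smul_apply] <;>
  module

/-- The linear parts (see `linearPart`) of the endomorphisms `W ↦ T W X`, as a bilinear map of `X`
and `W`. -/
def torsionLinearPart (a b c : V →ₗ[ℝ] V) (T : V →ₗ[ℝ] V →ₗ[ℝ] V) : V →ₗ[ℝ] V →ₗ[ℝ] V where
  toFun X := linearPart a b c (T.flip X)
  map_add' X Y := (linearPart_linear a b c T.flip 0 X Y).1
  map_smul' t X := (linearPart_linear a b c T.flip t X X).2

/-- The bilinear map `G`, quaternionic linear in the second argument, such that adding `G` to a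
connection with torsion `T` removes the linear part of the torsion. With `τ = torsionLinearPart`
this amounts to the equation `4 G - τ G = τ T`, which is solved by means of the identity
`τ (τ U) = 4 U`, valid for all `U` that are quaternionic linear in the second argument. -/
def linearCorrection (a b c : V →ₗ[ℝ] V) (T : V →ₗ[ℝ] V →ₗ[ℝ] V) : V →ₗ[ℝ] V →ₗ[ℝ] V :=
  (1 / 12 : ℝ) • (torsionLinearPart a b c (torsionLinearPart a b c T)
    + (4 : ℝ) • torsionLinearPart a b c T)

lemma torsionLinearPart_apply (a b c : V →ₗ[ℝ] V) (T : V →ₗ[ℝ] V →ₗ[ℝ] V) (X W : V) :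
    torsionLinearPart a b c T X W
      = T W X - a (T (a W) X) - b (T (b W) X) - c (T (c W) X) := rfl

lemma torsionLinearPart_comm {a b c : V →ₗ[ℝ] V} (h : HypercomplexRel a b c)
    (T : V →ₗ[ℝ] V →ₗ[ℝ] V) (X W : V) :
    torsionLinearPart a b c T X (a W) = a (torsionLinearPart a b c T X W) ∧
    torsionLinearPart a b c T X (b W) = b (torsionLinearPart a b c T X W) ∧
    torsionLinearPart a b c T X (c W) = c (torsionLinearPart a b c T X W) :=
  h.linearPart_comm _ _

lemma linearCorrection_comm {a b c : V →ₗ[ℝ] V} (h : HypercomplexRel a b c)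
    (T : V →ₗ[ℝ] V →ₗ[ℝ] V) (X W : V) :
    linearCorrection a b c T X (a W) = a (linearCorrection a b c T X W) ∧
    linearCorrection a b c T X (b W) = b (linearCorrection a b c T X W) ∧
    linearCorrection a b c T X (c W) = c (linearCorrection a b c T X W) := by
  have h1 := torsionLinearPart_comm h
  refine ⟨?_, ?_, ?_⟩ <;>
  simp only [linearCorrection, LinearMap.smul_apply, LinearMap.add_apply, map_smul, map_add,
    (h1 _ _ _).1, (h1 _ _ _).2.1, (h1 _ _ _).2.2]

/-- Adding the form `G` to a connection changes its torsion by `G - G.flip`; for `linearCorrection`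
the new torsion has no quaternionic linear part. -/
lemma torsionLinearPart_linearCorrection {a b c : V →ₗ[ℝ] V} (h : HypercomplexRel a b c)
    (T : V →ₗ[ℝ] V →ₗ[ℝ] V) :
    torsionLinearPart a b c (T + linearCorrection a b c T - (linearCorrection a b c T).flip)
      = 0 := by
  set U := torsionLinearPart a b c T with hU
  have hUc := torsionLinearPart_comm h T
  rw [← hU] at hUc
  have hG : ∀ X W, linearCorrection a b c T X W = (1 / 12 : ℝ) •
      ((U W X - a (U (a W) X) - b (U (b W) X) - c (U (c W) X)) + (4 : ℝ) • U X W) := fun _ _ ↦ rfl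
  ext X W
  have hT : T W X - a (T (a W) X) - b (T (b W) X) - c (T (c W) X) = U X W := rfl
  simp only [torsionLinearPart_apply, LinearMap.add_apply, LinearMap.sub_apply,
    LinearMap.flip_apply, LinearMap.zero_apply, map_add, map_sub, hG]
  rw [show ∀ x1 x2 x3 x4 y1 y2 y3 y4 z1 z2 z3 z4 : V, x1 + y1 - z1 - (x2 + y2 - z2)
    - (x3 + y3 - z3) - (x4 + y4 - z4) = (x1 - x2 - x3 - x4)
    + (y1 - z1 - (y2 - z2) - (y3 - z3) - (y4 - z4)) by intros; abel, hT]
  simp only [(hUc _ _).1, (hUc _ _).2.1, (hUc _ _).2.2, map_add, map_sub, map_smul, map_neg,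
    h.aa, h.bb, h.ab, h.ba, h.bc, h.cb, h.ac, h.ca, h.cc]
  simp only [LinearMap.neg_apply, map_neg]
  module

/-- The endomorphism `L` is orthogonal, for the trace form, to the endomorphisms that commute with
the hypercomplex triple (`linearPart_eq`) and to the triple itself, hence to the whole Lie algebra
`𝔤₀` of endomorphisms that normalize the quaternions. This is the form in which the vanishing of
the codifferential is used, see `IsHypercomplex.codifferential_eq_zero_iff`. -/
structure IsNormal (a b c L : V →ₗ[ℝ] V) : Prop where
  linearPart_eq : linearPart a b c L = 0
  trace_left : LinearMap.trace ℝ V (a ∘ₗ L) = 0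
  trace_middle : LinearMap.trace ℝ V (b ∘ₗ L) = 0
  trace_right : LinearMap.trace ℝ V (c ∘ₗ L) = 0

section
variable {a b c : V →ₗ[ℝ] V} (h : HypercomplexRel a b c)
include h

lemma HypercomplexRel.trace_comp_comp (L : V →ₗ[ℝ] V) :
    LinearMap.trace ℝ V (a ∘ₗ L ∘ₗ a) = -LinearMap.trace ℝ V L ∧
      LinearMap.trace ℝ V (b ∘ₗ L ∘ₗ b) = -LinearMap.trace ℝ V L ∧
      LinearMap.trace ℝ V (c ∘ₗ L ∘ₗ c) = -LinearMap.trace ℝ V L := by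
  have key : ∀ d : V →ₗ[ℝ] V, (∀ v, d (d v) = -v) →
      LinearMap.trace ℝ V (d ∘ₗ L ∘ₗ d) = -LinearMap.trace ℝ V L := by
    intro d hd
    have := LinearMap.trace_mul_comm ℝ (d) (L ∘ₗ d)
    rw [Module.End.mul_eq_comp, Module.End.mul_eq_comp] at this
    rw [this, ← map_neg]
    congr 1; ext v; simp [hd]
  exact ⟨key a h.aa, key b h.bb, key c h.cc⟩

lemma HypercomplexRel.trace_linearPart (L : V →ₗ[ℝ] V) :
    LinearMap.trace ℝ V (linearPart a b c L) = 4 * LinearMap.trace ℝ V L := by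
  obtain ⟨h1, h2, h3⟩ := h.trace_comp_comp L
  rw [linearPart, map_sub, map_sub, map_sub, h1, h2, h3]; ring

lemma HypercomplexRel.trace_eq_zero :
    LinearMap.trace ℝ V a = 0 ∧ LinearMap.trace ℝ V b = 0 ∧ LinearMap.trace ℝ V c = 0 := by
  have key : ∀ d e : V →ₗ[ℝ] V, (∀ v, d (d v) = -v) → (∀ v, d (e (d v)) = e v) →
      LinearMap.trace ℝ V e = 0 := by
    intro d e hd he
    have := LinearMap.trace_mul_comm ℝ d (e ∘ₗ d)
    rw [Module.End.mul_eq_comp, Module.End.mul_eq_comp] at this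
    have h1 : d ∘ₗ e ∘ₗ d = e := by ext v; simp [he]
    have h2 : (e ∘ₗ d) ∘ₗ d = -e := by ext v; simp [hd]
    rw [h1, h2, map_neg] at this
    linarith
  exact ⟨key b a h.bb (fun v ↦ by rw [h.ab, h.bc]),
    key a b h.aa (fun v ↦ by rw [h.ba, map_neg, h.ac, neg_neg]),
    key a c h.aa (fun v ↦ by rw [h.ca, h.ab])⟩
end

/-- A bilinear map with values in the span of `a, b, c`. Adding it to a connection whose torsion `T`
has no quaternionic linear part makes the torsion orthogonal to `a, b, c` as well. The trace of
`a ∘ₗ a` is `-dim V`, and the endomorphisms `W ↦ σ W X` for the correction `σ` contribute the `2`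
in the factor `-(dim V - 2)⁻¹`. -/
def traceCorrection (a b c : V →ₗ[ℝ] V) (T : V →ₗ[ℝ] V →ₗ[ℝ] V) : V →ₗ[ℝ] V →ₗ[ℝ] V :=
  (-((Module.finrank ℝ V : ℝ) - 2)⁻¹) •
    ((LinearMap.trace ℝ V ∘ₗ (LinearMap.compRight ℝ a) ∘ₗ T.flip).smulRight a
    + (LinearMap.trace ℝ V ∘ₗ (LinearMap.compRight ℝ b) ∘ₗ T.flip).smulRight b
    + (LinearMap.trace ℝ V ∘ₗ (LinearMap.compRight ℝ c) ∘ₗ T.flip).smulRight c)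

lemma traceCorrection_apply (a b c : V →ₗ[ℝ] V) (T : V →ₗ[ℝ] V →ₗ[ℝ] V) (X : V) :
    traceCorrection a b c T X = (-((Module.finrank ℝ V : ℝ) - 2)⁻¹) •
     (LinearMap.trace ℝ V (a ∘ₗ T.flip X) • a + LinearMap.trace ℝ V (b ∘ₗ T.flip X) • b
      + LinearMap.trace ℝ V (c ∘ₗ T.flip X) • c) := rfl

section
variable {a b c : V →ₗ[ℝ] V} (h : HypercomplexRel a b c)
include h

/-- If the skew map `T` has no quaternionic linear part, then the three covectors
`X ↦ trace (a ∘ T (·, X))`, and likewise for `b`, `c`, satisfy the linear relation that keeps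
`traceCorrection` from creating a linear part again. -/
lemma trace_sum_eq_zero (T : V →ₗ[ℝ] V →ₗ[ℝ] V) (hT : T.flip = -T)
    (hP : torsionLinearPart a b c T = 0) (X : V) :
    LinearMap.trace ℝ V (a ∘ₗ T.flip (a X)) + LinearMap.trace ℝ V (b ∘ₗ T.flip (b X))
      + LinearMap.trace ℝ V (c ∘ₗ T.flip (c X)) = 0 := by
  have h1 : LinearMap.trace ℝ V (T.flip X) = 0 := by
    have := h.trace_linearPart (T.flip X)
    rw [show linearPart a b c (T.flip X) = 0 from congrArg (fun f ↦ f X) hP] at this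
    simpa using this.symm
  have h2 : T.flip X = a ∘ₗ T.flip (a X) + b ∘ₗ T.flip (b X) + c ∘ₗ T.flip (c X) := by
    ext Y
    have := congrArg (fun f ↦ f Y X) hP
    simp only [torsionLinearPart_apply, LinearMap.zero_apply] at this
    have h3 : ∀ u v, T u v = - T v u := fun u v ↦ by
      simpa using congrArg (fun f ↦ f v u) hT
    simp only [LinearMap.add_apply, LinearMap.comp_apply, LinearMap.flip_apply]
    rw [h3 Y X, h3 Y (a X), h3 Y (b X), h3 Y (c X)]
    simp only [map_neg]
    rw [← sub_eq_zero]
    rw [← neg_eq_zero.mpr this]; abel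
  rw [h2] at h1
  simpa using h1

/-- After the correction by `traceCorrection`, a torsion without linear part is normal. -/
lemma isNormal_traceCorrection [FiniteDimensional ℝ V] (hd : 2 < Module.finrank ℝ V)
    (T : V →ₗ[ℝ] V →ₗ[ℝ] V) (hT : T.flip = -T)
    (hP : torsionLinearPart a b c T = 0) (X : V) :
    IsNormal a b c ((T + traceCorrection a b c T - (traceCorrection a b c T).flip).flip X) := by
  obtain ⟨N, hN⟩ : ∃ N : ℝ, N = (Module.finrank ℝ V : ℝ) := ⟨_, rfl⟩
  have hN2 : N - 2 ≠ 0 := by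
    have : (2 : ℝ) < N := by rw [hN]; exact_mod_cast hd
    linarith
  -- the correction is `t₁ ⊗ a + t₂ ⊗ b + t₃ ⊗ c`
  set t₁ : V →ₗ[ℝ] ℝ := (-(N - 2)⁻¹) •
    (LinearMap.trace ℝ V ∘ₗ (LinearMap.compRight ℝ a) ∘ₗ T.flip) with ht₁
  set t₂ : V →ₗ[ℝ] ℝ := (-(N - 2)⁻¹) •
    (LinearMap.trace ℝ V ∘ₗ (LinearMap.compRight ℝ b) ∘ₗ T.flip) with ht₂
  set t₃ : V →ₗ[ℝ] ℝ := (-(N - 2)⁻¹) •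
    (LinearMap.trace ℝ V ∘ₗ (LinearMap.compRight ℝ c) ∘ₗ T.flip) with ht₃
  have e₁ : ∀ X, LinearMap.trace ℝ V (a ∘ₗ T.flip X) = -(N - 2) * t₁ X := fun X ↦ by
    simp only [ht₁, LinearMap.smul_apply, LinearMap.comp_apply, LinearMap.compRight_apply,
      smul_eq_mul]
    field_simp
  have e₂ : ∀ X, LinearMap.trace ℝ V (b ∘ₗ T.flip X) = -(N - 2) * t₂ X := fun X ↦ by
    simp only [ht₂, LinearMap.smul_apply, LinearMap.comp_apply, LinearMap.compRight_apply,
      smul_eq_mul]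
    field_simp
  have e₃ : ∀ X, LinearMap.trace ℝ V (c ∘ₗ T.flip X) = -(N - 2) * t₃ X := fun X ↦ by
    simp only [ht₃, LinearMap.smul_apply, LinearMap.comp_apply, LinearMap.compRight_apply,
      smul_eq_mul]
    field_simp
  have hσ : ∀ X, traceCorrection a b c T X = t₁ X • a + t₂ X • b + t₃ X • c := fun X ↦ by
    rw [traceCorrection_apply, e₁, e₂, e₃]
    have k : ∀ s : ℝ, -(N - 2)⁻¹ * (-(N - 2) * s) = s := fun s ↦ by field_simp
    rw [← hN, smul_add, smul_add, smul_smul, smul_smul, smul_smul, k, k, k]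
  have r₀ : ∀ X, t₁ (a X) + t₂ (b X) + t₃ (c X) = 0 := fun X ↦ by
    have := trace_sum_eq_zero h T hT hP X
    rw [e₁, e₂, e₃] at this
    have h' : -(N - 2) * (t₁ (a X) + t₂ (b X) + t₃ (c X)) = 0 := by linarith
    exact (mul_eq_zero.mp h').resolve_left (neg_ne_zero.mpr hN2)
  have r₁ : ∀ X, t₁ X = t₃ (b X) - t₂ (c X) := fun X ↦ by
    have := r₀ (a X)
    rw [h.aa, h.ba, h.ca, map_neg, map_neg] at this
    linarith
  have r₂ : ∀ X, t₂ X = t₁ (c X) - t₃ (a X) := fun X ↦ by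
    have := r₀ (b X)
    rw [h.bb, h.ab, h.cb, map_neg, map_neg] at this
    linarith
  have r₃ : ∀ X, t₃ X = t₂ (a X) - t₁ (b X) := fun X ↦ by
    have := r₀ (c X)
    rw [h.cc, h.ac, h.bc, map_neg, map_neg] at this
    linarith
  set L := (T + traceCorrection a b c T - (traceCorrection a b c T).flip).flip X with hL
  have hLe : L = T.flip X + (t₁.smulRight (a X) + t₂.smulRight (b X) + t₃.smulRight (c X))
      - (t₁ X • a + t₂ X • b + t₃ X • c) := by
    ext W
    simp only [hL, LinearMap.flip_apply, LinearMap.add_apply, LinearMap.sub_apply, hσ,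
      LinearMap.smulRight_apply, LinearMap.smul_apply]
  obtain ⟨za, zb, zc⟩ := h.trace_eq_zero
  have caa : a ∘ₗ a = -LinearMap.id := LinearMap.ext h.aa
  have cbb : b ∘ₗ b = -LinearMap.id := LinearMap.ext h.bb
  have ccc : c ∘ₗ c = -LinearMap.id := LinearMap.ext h.cc
  have cab : a ∘ₗ b = c := LinearMap.ext h.ab
  have cba : b ∘ₗ a = -c := LinearMap.ext h.ba
  have cbc : b ∘ₗ c = a := LinearMap.ext h.bc
  have ccb : c ∘ₗ b = -a := LinearMap.ext h.cb
  have cca : c ∘ₗ a = b := LinearMap.ext h.ca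
  have cac : a ∘ₗ c = -b := LinearMap.ext h.ac
  have sr : ∀ (d : V →ₗ[ℝ] V) (t : V →ₗ[ℝ] ℝ) (v : V), d ∘ₗ t.smulRight v = t.smulRight (d v) :=
    fun d t v ↦ by ext; simp
  constructor
  · ext W
    have h0 : linearPart a b c (T.flip X) W = 0 := congrArg (fun f ↦ f X W) hP
    have : linearPart a b c L W = linearPart a b c (T.flip X) W
        + (t₁ (a W) + t₂ (b W) + t₃ (c W)) • X
        + (t₁ W - (t₃ (b W) - t₂ (c W))) • a X
        + (t₂ W - (t₁ (c W) - t₃ (a W))) • b X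
        + (t₃ W - (t₂ (a W) - t₁ (b W))) • c X := by
      simp only [hLe, linearPart_apply, LinearMap.add_apply, LinearMap.sub_apply,
        LinearMap.smulRight_apply, LinearMap.smul_apply, map_add, map_sub, map_smul, map_neg,
        h.aa, h.bb, h.ab, h.ba, h.bc, h.cb, h.ac, h.ca, h.cc]
      module
    rw [this, h0, r₀, ← r₁, ← r₂, ← r₃]
    simp
  · rw [hLe]
    simp only [LinearMap.comp_add, LinearMap.comp_sub, LinearMap.comp_smul, sr, map_add,
      map_sub, map_smul, LinearMap.trace_smulRight, h.aa, h.ab, h.ac, caa, cab, cac, map_neg,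
      zb, zc, e₁, LinearMap.trace_id]
    simp only [smul_eq_mul, ← hN]
    linear_combination r₁ X
  · rw [hLe]
    simp only [LinearMap.comp_add, LinearMap.comp_sub, LinearMap.comp_smul, sr, map_add,
      map_sub, map_smul, LinearMap.trace_smulRight, h.bb, h.ba, h.bc, cbb, cba, cbc, map_neg,
      za, zc, e₂, LinearMap.trace_id]
    simp only [smul_eq_mul, ← hN]
    linear_combination r₂ X
  · rw [hLe]
    simp only [LinearMap.comp_add, LinearMap.comp_sub, LinearMap.comp_smul, sr, map_add,
      map_sub, map_smul, LinearMap.trace_smulRight, h.cc, h.ca, h.cb, ccc, cca, ccb, map_neg,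
      za, zb, e₃, LinearMap.trace_id]
    simp only [smul_eq_mul, ← hN]
    linear_combination r₃ X

end

end QuaternionicAlgebra

/-! ### Quaternionic lines and normal endomorphisms -/

section QuaternionicLines
variable {V : Type*} [AddCommGroup V] [Module ℝ V]

/-- `linearPart` is self-adjoint for the trace form. -/
lemma trace_linearPart_comp (a b c L N : V →ₗ[ℝ] V) :
    LinearMap.trace ℝ V (linearPart a b c L ∘ₗ N) =
      LinearMap.trace ℝ V (L ∘ₗ linearPart a b c N) := by
  have key : ∀ d : V →ₗ[ℝ] V, LinearMap.trace ℝ V ((d ∘ₗ L ∘ₗ d) ∘ₗ N) =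
      LinearMap.trace ℝ V (L ∘ₗ (d ∘ₗ N ∘ₗ d)) := fun d ↦
    LinearMap.trace_mul_comm ℝ d (L ∘ₗ d ∘ₗ N)
  simp only [linearPart, LinearMap.sub_comp, LinearMap.comp_sub, map_sub, key]

/-- A quaternionic line has real dimension at most four. -/
lemma exists_notMem_quaternionic_line (a b c : V →ₗ[ℝ] V) [FiniteDimensional ℝ V]
    (hd : 4 < Module.finrank ℝ V) (X : V) :
    ∃ Y : V, ∀ F, IsQuaternion a b c F → Y ≠ F X := by
  classical
  by_contra! hcon
  have : (⊤ : Submodule ℝ V) ≤ Submodule.span ℝ (({X, a X, b X, c X} : Finset V) : Set V) := by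
    intro Y _
    obtain ⟨F, ⟨p, q, r, s, hF⟩, rfl⟩ := hcon Y
    rw [hF]
    refine add_mem (add_mem (add_mem ?_ ?_) ?_) ?_ <;>
    exact Submodule.smul_mem _ _ (Submodule.subset_span (by simp))
  have h1 := Submodule.finrank_mono this
  rw [finrank_top] at h1
  have h2 : Module.finrank ℝ (Submodule.span ℝ (({X, a X, b X, c X} : Finset V) : Set V)) ≤ _ :=
    finrank_span_finset_le_card _
  have h3 : ({X, a X, b X, c X} : Finset V).card ≤ 4 := Finset.card_le_four
  omega

namespace HypercomplexRel
variable {a b c : V →ₗ[ℝ] V} (h : HypercomplexRel a b c)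
include h

/-- The product of a quaternion with its conjugate is its squared norm. -/
lemma conj_mul (p q r s : ℝ) (v : V) :
    p • (p • v + q • a v + r • b v + s • c v) - q • a (p • v + q • a v + r • b v + s • c v)
      - r • b (p • v + q • a v + r • b v + s • c v) - s • c (p • v + q • a v + r • b v + s • c v)
      = (p ^ 2 + q ^ 2 + r ^ 2 + s ^ 2) • v := by
  simp only [map_add, map_smul, h.aa, h.bb, h.ab, h.ba, h.bc, h.cb, h.ac, h.ca, h.cc]
  module

lemma coeff_eq_zero {p q r s : ℝ} {v : V} (hv : v ≠ 0)
    (h0 : p • v + q • a v + r • b v + s • c v = 0) : p = 0 ∧ q = 0 ∧ r = 0 ∧ s = 0 := by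
  have := h.conj_mul p q r s v
  rw [h0] at this
  simp only [map_zero, smul_zero, sub_zero] at this
  have h1 : p ^ 2 + q ^ 2 + r ^ 2 + s ^ 2 = 0 := (smul_eq_zero.mp this.symm).resolve_right hv
  refine ⟨?_, ?_, ?_, ?_⟩ <;> nlinarith [sq_nonneg p, sq_nonneg q, sq_nonneg r, sq_nonneg s]

/-- A quaternion that does not vanish at some vector is invertible. -/
lemma exists_inverse {F : V → V} (hF : IsQuaternion a b c F) {v : V} (hv : F v ≠ 0) :
    ∃ G : V → V, IsQuaternion a b c G ∧ ∀ w, G (F w) = w := by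
  obtain ⟨p, q, r, s, hF⟩ := hF
  have hn : p ^ 2 + q ^ 2 + r ^ 2 + s ^ 2 ≠ 0 := by
    intro h0
    apply hv
    have : p = 0 ∧ q = 0 ∧ r = 0 ∧ s = 0 := by
      refine ⟨?_, ?_, ?_, ?_⟩ <;> nlinarith [sq_nonneg p, sq_nonneg q, sq_nonneg r, sq_nonneg s]
    obtain ⟨rfl, rfl, rfl, rfl⟩ := this
    simp [hF]
  refine ⟨fun w ↦ (p ^ 2 + q ^ 2 + r ^ 2 + s ^ 2)⁻¹ • (p • w - q • a w - r • b w - s • c w),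
    IsQuaternion.smul ⟨p, -q, -r, -s, fun w ↦ by module⟩ _, fun w ↦ ?_⟩
  simp only [hF]
  rw [h.conj_mul, smul_smul, inv_mul_cancel₀ hn, one_smul]

/-- A linear map of a quaternionic vector space of dimension at least two that maps each vector
to a quaternionic multiple of itself is the multiplication by a quaternion. -/
lemma isQuaternion_of_forall_exists (hV : ∀ X : V, ∃ Y : V, ∀ F, IsQuaternion a b c F → Y ≠ F X)
    (L : V →ₗ[ℝ] V) (hL : ∀ X, ∃ F, IsQuaternion a b c F ∧ L X = F X) : IsQuaternion a b c L := by
  obtain ⟨X, hX⟩ := hV 0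
  replace hX : X ≠ 0 := hX _ IsQuaternion.id
  obtain ⟨F, hF, hFX⟩ := hL X
  obtain ⟨Z, hZ⟩ := hV X
  have Fadd : ∀ u v, F (u + v) = F u + F v := by
    obtain ⟨p, q, r, s, hF⟩ := hF
    intro u v; simp only [hF, map_add]; module
  -- a vector outside of the quaternionic line of `X`
  have outside : ∀ Y, (∀ G, IsQuaternion a b c G → Y ≠ G X) → L Y = F Y := by
    intro Y hY
    obtain ⟨F₂, hF₂, h₂⟩ := hL Y
    obtain ⟨F₃, hF₃, h₃⟩ := hL (X + Y)
    have F₃add : F₃ (X + Y) = F₃ X + F₃ Y := by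
      obtain ⟨p, q, r, s, hF₃⟩ := hF₃
      simp only [hF₃, map_add]; module
    rw [map_add, hFX, h₂, F₃add] at h₃
    have e : F₂ Y - F₃ Y = F₃ X - F X := by
      rw [sub_eq_sub_iff_add_eq_add, add_comm, h₃]
    have z : F₂ Y - F₃ Y = 0 := by
      by_contra hne
      obtain ⟨G, hG, hGi⟩ := h.exists_inverse (hF₂.sub hF₃) hne
      refine hY _ (hG.comp h (hF₃.sub hF)) ?_
      rw [← hGi Y]
      exact congrArg G e
    have z' : F₃ X - F X = 0 := e ▸ z
    have : ∀ v, F₃ v - F v = 0 := by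
      obtain ⟨p, q, r, s, hd⟩ := hF₃.sub hF
      have := hd X
      simp only [z'] at this
      obtain ⟨rfl, rfl, rfl, rfl⟩ := h.coeff_eq_zero hX this.symm
      intro v; simpa using hd v
    rw [h₂, sub_eq_zero.mp z, sub_eq_zero.mp (this Y)]
  have : ∀ Y, L Y = F Y := by
    intro Y
    by_cases hY : ∀ G, IsQuaternion a b c G → Y ≠ G X
    · exact outside Y hY
    · push Not at hY
      obtain ⟨G, hG, hGY⟩ := hY
      have := outside (Z + Y) (fun G' hG' he ↦ hZ _ (hG'.sub hG) (by
        rw [← he, hGY]; abel))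
      rwa [map_add, Fadd, outside Z hZ, add_right_inj] at this
  obtain ⟨p, q, r, s, hF⟩ := hF
  exact ⟨p, q, r, s, fun v ↦ by rw [this, hF]⟩

lemma trace_comp_linearPart (L : V →ₗ[ℝ] V) :
    LinearMap.trace ℝ V (a ∘ₗ linearPart a b c L) = 0 ∧
    LinearMap.trace ℝ V (b ∘ₗ linearPart a b c L) = 0 ∧
    LinearMap.trace ℝ V (c ∘ₗ linearPart a b c L) = 0 := by
  have hP := h.linearPart_comm L
  refine ⟨?_, ?_, ?_⟩
  · have := (h.trace_comp_comp (a ∘ₗ linearPart a b c L)).2.1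
    rw [show b ∘ₗ (a ∘ₗ linearPart a b c L) ∘ₗ b = a ∘ₗ linearPart a b c L by
      ext v; simp [(hP _).2.1, h.ab, h.bc]] at this
    linarith
  · have := (h.trace_comp_comp (b ∘ₗ linearPart a b c L)).1
    rw [show a ∘ₗ (b ∘ₗ linearPart a b c L) ∘ₗ a = b ∘ₗ linearPart a b c L by
      ext v; simp [(hP _).1, h.ba, h.ac]] at this
    linarith
  · have := (h.trace_comp_comp (c ∘ₗ linearPart a b c L)).1
    rw [show a ∘ₗ (c ∘ₗ linearPart a b c L) ∘ₗ a = c ∘ₗ linearPart a b c L by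
      ext v; simp [(hP _).1, h.ca, h.ab]] at this
    linarith

/-- The condition `IsNormal` depends only on the quaternions spanned by the triple. -/
lemma isNormal_of_span [FiniteDimensional ℝ V] {a' b' c' : V →ₗ[ℝ] V}
    (h' : HypercomplexRel a' b' c')
    (ha' : IsQuaternion a b c a') (hb' : IsQuaternion a b c b') (hc' : IsQuaternion a b c c')
    (ha : IsQuaternion a' b' c' a) (hb : IsQuaternion a' b' c' b) (hc : IsQuaternion a' b' c' c)
    {L : V →ₗ[ℝ] V} (hL : IsNormal a b c L) : IsNormal a' b' c' L := by
  have hL0 : LinearMap.trace ℝ V L = 0 := by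
    have := h.trace_linearPart L
    rw [hL.linearPart_eq] at this
    simpa using this.symm
  have tr : ∀ d : V →ₗ[ℝ] V, IsQuaternion a b c d → LinearMap.trace ℝ V (d ∘ₗ L) = 0 := by
    rintro d ⟨p, q, r, s, hd⟩
    have : d ∘ₗ L = p • L + q • (a ∘ₗ L) + r • (b ∘ₗ L) + s • (c ∘ₗ L) := by
      ext v; simp [hd]
    rw [this]
    simp [hL0, hL.trace_left, hL.trace_middle, hL.trace_right]
  refine ⟨?_, tr _ ha', tr _ hb', tr _ hc'⟩
  ext v
  rw [LinearMap.zero_apply, ← Module.forall_dual_apply_eq_zero_iff ℝ]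
  intro f
  rw [← LinearMap.trace_smulRight f (linearPart a' b' c' L v),
    show f.smulRight (linearPart a' b' c' L v) = linearPart a' b' c' L ∘ₗ f.smulRight v by
      ext; simp,
    trace_linearPart_comp]
  set N := linearPart a' b' c' (f.smulRight v)
  have hN := h'.linearPart_comm (f.smulRight v)
  have comm : ∀ d : V →ₗ[ℝ] V, IsQuaternion a' b' c' d → ∀ w, N (d w) = d (N w) := by
    rintro d ⟨p, q, r, s, hd⟩ w
    simp only [hd, map_add, map_smul, N, (hN _).1, (hN _).2.1, (hN _).2.2]
  have h4 : linearPart a b c N = (4 : ℝ) • N := by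
    ext w
    simp only [linearPart_apply, comm a ha, comm b hb, comm c hc, h.aa, h.bb, h.cc,
      LinearMap.smul_apply]
    module
  have := trace_linearPart_comp a b c L N
  rw [hL.linearPart_eq, h4, LinearMap.comp_smul, map_smul] at this
  simpa using this.symm

end HypercomplexRel
end QuaternionicLines

/-! ### Hypercomplex triples and the codifferential -/

section Continuous

variable {V : Type*} [AddCommGroup V] [Module ℝ V] [TopologicalSpace V]
  [IsTopologicalAddGroup V] [ContinuousSMul ℝ V]

omit [ContinuousSMul ℝ V] in
lemma IsHypercomplex.rel {A B C : V →L[ℝ] V} (h : IsHypercomplex A B C) :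
    HypercomplexRel (A : V →ₗ[ℝ] V) (B : V →ₗ[ℝ] V) (C : V →ₗ[ℝ] V) where
  aa v := by simpa using congrArg (fun F ↦ F v) h.sq_left
  bb v := by simpa using congrArg (fun F ↦ F v) h.sq_right
  ab v := by simpa using (congrArg (fun F ↦ F v) h.eq_comp).symm
  ba v := by
    have h1 := congrArg (fun F ↦ F v) h.eq_comp
    rw [h.anticomm] at h1
    simpa using congrArg Neg.neg h1.symm

lemma mem_span_iff_isQuaternion {A B C F : V →L[ℝ] V} :
    F ∈ Submodule.span ℝ {ContinuousLinearMap.id ℝ V, A, B, C} ↔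
      IsQuaternion (A : V →ₗ[ℝ] V) (B : V →ₗ[ℝ] V) (C : V →ₗ[ℝ] V) F := by
  simp only [Submodule.mem_span_insert, Submodule.mem_span_singleton]
  constructor
  · rintro ⟨p, _, ⟨q, _, ⟨r, _, ⟨s, rfl⟩, rfl⟩, rfl⟩, rfl⟩
    exact ⟨p, q, r, s, fun v ↦ by simp [add_assoc]⟩
  · rintro ⟨p, q, r, s, hF⟩
    exact ⟨p, _, ⟨q, _, ⟨r, _, ⟨s, rfl⟩, rfl⟩, rfl⟩, by ext v; simp [hF, add_assoc]⟩

lemma IsHypercomplex.linearIndependent [Nontrivial V] {A B C : V →L[ℝ] V}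
    (h : IsHypercomplex A B C) :
    LinearIndependent ℝ ![ContinuousLinearMap.id ℝ V, A, B, C] := by
  obtain ⟨v, hv⟩ := exists_ne (0 : V)
  rw [Fintype.linearIndependent_iff]
  intro g hg
  have := congrArg (fun F ↦ F v) hg
  simp only [Fin.sum_univ_four, Matrix.cons_val_zero, Matrix.cons_val_one, Matrix.cons_val,
    add_apply, smul_apply, zero_apply,
    ContinuousLinearMap.id_apply] at this
  obtain ⟨h0, h1, h2, h3⟩ := h.rel.coeff_eq_zero hv this
  intro i; fin_cases i <;> assumption

/-- The quaternions spanned by a hypercomplex triple have dimension four, so that inclusions are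
equalities. -/
lemma IsHypercomplex.span_eq_of_le {A B C A' B' C' : V →L[ℝ] V} (h : IsHypercomplex A B C)
    (h' : IsHypercomplex A' B' C')
    (hle : Submodule.span ℝ {ContinuousLinearMap.id ℝ V, A, B, C} ≤
      Submodule.span ℝ {ContinuousLinearMap.id ℝ V, A', B', C'}) :
    Submodule.span ℝ {ContinuousLinearMap.id ℝ V, A, B, C} =
      Submodule.span ℝ {ContinuousLinearMap.id ℝ V, A', B', C'} := by
  rcases subsingleton_or_nontrivial V with hV | hV
  · have : Subsingleton (V →L[ℝ] V) := ⟨fun F G ↦ by ext v; exact Subsingleton.elim _ _⟩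
    exact Subsingleton.elim _ _
  · have key : ∀ {A B C : V →L[ℝ] V}, IsHypercomplex A B C →
        Module.finrank ℝ (Submodule.span ℝ {ContinuousLinearMap.id ℝ V, A, B, C}) = 4 := by
      intro A B C h
      have := finrank_span_eq_card h.linearIndependent
      have hr : Set.range ![ContinuousLinearMap.id ℝ V, A, B, C] =
          {ContinuousLinearMap.id ℝ V, A, B, C} := by
        ext F; simp [eq_comm]; tauto
      rwa [hr, Fintype.card_fin] at this
    have : FiniteDimensional ℝ (Submodule.span ℝ {ContinuousLinearMap.id ℝ V, A', B', C'}) :=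
      FiniteDimensional.span_of_finite ℝ (by simp)
    exact Submodule.eq_of_le_of_finrank_eq hle (by rw [key h, key h'])

omit [ContinuousSMul ℝ V] in
/-- Conjugation of a hypercomplex triple. -/
lemma IsHypercomplex.conj {W : Type*} [AddCommGroup W] [Module ℝ W] [TopologicalSpace W]
    [IsTopologicalAddGroup W] {A B C : V →L[ℝ] V}
    (h : IsHypercomplex A B C) (e : V ≃L[ℝ] W) :
    IsHypercomplex (e.toContinuousLinearMap ∘L A ∘L e.symm.toContinuousLinearMap)
      (e.toContinuousLinearMap ∘L B ∘L e.symm.toContinuousLinearMap)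
      (e.toContinuousLinearMap ∘L C ∘L e.symm.toContinuousLinearMap) where
  sq_left := by
    ext w; simpa using congrArg e (DFunLike.congr_fun h.sq_left (e.symm w))
  sq_right := by
    ext w; simpa using congrArg e (DFunLike.congr_fun h.sq_right (e.symm w))
  eq_comp := by
    ext w; simpa using congrArg e (DFunLike.congr_fun h.eq_comp (e.symm w))
  anticomm := by
    ext w; simpa using congrArg e (DFunLike.congr_fun h.anticomm (e.symm w))

/-- The bilinear map underlying a continuous one. -/
def toLinearMap₂ (T : V →L[ℝ] V →L[ℝ] V) : V →ₗ[ℝ] V →ₗ[ℝ] V :=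
  ContinuousLinearMap.coeLM ℝ ∘ₗ (T : V →ₗ[ℝ] V →L[ℝ] V)

lemma sum_coord_eq_trace {V : Type*} [AddCommGroup V] [Module ℝ V] [FiniteDimensional ℝ V]
    (L : V →ₗ[ℝ] V) :
    ∑ i, (Module.finBasis ℝ V).coord i (L (Module.finBasis ℝ V i)) = LinearMap.trace ℝ V L := by
  rw [LinearMap.trace_eq_matrix_trace ℝ (Module.finBasis ℝ V)]
  simp [Matrix.trace, LinearMap.toMatrix_apply]

variable [FiniteDimensional ℝ V]

/-- The codifferential in terms of the linear part and of the traces of `T (·, X)`. -/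
lemma codifferential_eq (A B C : V →L[ℝ] V) (T : V →L[ℝ] V →L[ℝ] V) (X W : V) :
    codifferential A B C T X W = linearPart (A : V →ₗ[ℝ] V) B C ((toLinearMap₂ T).flip X) W
      + LinearMap.trace ℝ V ((toLinearMap₂ T).flip X) • W
      - LinearMap.trace ℝ V ((A : V →ₗ[ℝ] V) ∘ₗ (toLinearMap₂ T).flip X) • A W
      - LinearMap.trace ℝ V ((B : V →ₗ[ℝ] V) ∘ₗ (toLinearMap₂ T).flip X) • B W
      - LinearMap.trace ℝ V ((C : V →ₗ[ℝ] V) ∘ₗ (toLinearMap₂ T).flip X) • C W := by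
  set L := (toLinearMap₂ T).flip X with hL
  have e : ∀ Z, ∑ i, (Module.finBasis ℝ V).coord i Z • L (Module.finBasis ℝ V i) = L Z := by
    intro Z
    simp_rw [← map_smul, ← map_sum]
    exact congrArg L ((Module.finBasis ℝ V).sum_repr Z)
  have e' : ∀ (D : V →ₗ[ℝ] V) Z,
      ∑ i, (Module.finBasis ℝ V).coord i Z • D (L (Module.finBasis ℝ V i)) = D (L Z) := by
    intro D Z
    rw [← e Z]; simp
  have t : ∀ (D : V →ₗ[ℝ] V) (Z : V),
      ∑ i, (Module.finBasis ℝ V).coord i (D (L (Module.finBasis ℝ V i))) • Z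
        = LinearMap.trace ℝ V (D ∘ₗ L) • Z := by
    intro D Z
    rw [← Finset.sum_smul, ← sum_coord_eq_trace]; rfl
  have t0 : ∀ (Z : V), ∑ i, (Module.finBasis ℝ V).coord i (L (Module.finBasis ℝ V i)) • Z
        = LinearMap.trace ℝ V L • Z := by
    intro Z
    rw [← Finset.sum_smul, ← sum_coord_eq_trace]
  have : codifferential A B C T X W = ∑ i, bracket A B C (L (Module.finBasis ℝ V i))
    ((Module.finBasis ℝ V).coord i) W := rfl
  rw [this]
  simp only [bracket, Finset.sum_sub_distrib, Finset.sum_add_distrib]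
  rw [t0, e, linearPart_apply]
  have a1 := t (A : V →ₗ[ℝ] V) (A W)
  have a2 := t (B : V →ₗ[ℝ] V) (B W)
  have a3 := t (C : V →ₗ[ℝ] V) (C W)
  have b1 := e' (A : V →ₗ[ℝ] V) (A W)
  have b2 := e' (B : V →ₗ[ℝ] V) (B W)
  have b3 := e' (C : V →ₗ[ℝ] V) (C W)
  simp only [ContinuousLinearMap.coe_coe] at a1 a2 a3 b1 b2 b3 ⊢
  rw [a1, a2, a3, b1, b2, b3]
  abel

/-- The codifferential of `T` vanishes iff all the endomorphisms `T (·, X)` are normal. -/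
lemma IsHypercomplex.codifferential_eq_zero_iff {A B C : V →L[ℝ] V} (h : IsHypercomplex A B C)
    (T : V →L[ℝ] V →L[ℝ] V) (X : V) :
    (∀ W, codifferential A B C T X W = 0) ↔
      IsNormal (A : V →ₗ[ℝ] V) B C ((toLinearMap₂ T).flip X) := by
  simp only [codifferential_eq]
  set L := (toLinearMap₂ T).flip X with hL
  have hr := h.rel
  set a : V →ₗ[ℝ] V := (A : V →ₗ[ℝ] V)
  set b : V →ₗ[ℝ] V := (B : V →ₗ[ℝ] V)
  set c : V →ₗ[ℝ] V := (C : V →ₗ[ℝ] V)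
  constructor
  · intro h0
    have E : linearPart a b c L + LinearMap.trace ℝ V L • LinearMap.id
        - LinearMap.trace ℝ V (a ∘ₗ L) • a - LinearMap.trace ℝ V (b ∘ₗ L) • b
        - LinearMap.trace ℝ V (c ∘ₗ L) • c = 0 := by
      ext W; exact h0 W
    rcases subsingleton_or_nontrivial V with hV | hV
    · have z : ∀ F : V →ₗ[ℝ] V, F = 0 := fun F ↦ by ext v; exact Subsingleton.elim _ _
      constructor <;> first | exact z _ | (rw [z (_ ∘ₗ L), map_zero])
    have hd : 0 < (Module.finrank ℝ V : ℝ) := by exact_mod_cast Module.finrank_pos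
    obtain ⟨za, zb, zc⟩ := hr.trace_eq_zero
    obtain ⟨pa, pb, pc⟩ := hr.trace_comp_linearPart L
    have caa : a ∘ₗ a = -LinearMap.id := LinearMap.ext hr.aa
    have cbb : b ∘ₗ b = -LinearMap.id := LinearMap.ext hr.bb
    have ccc : c ∘ₗ c = -LinearMap.id := LinearMap.ext hr.cc
    have cab : a ∘ₗ b = c := LinearMap.ext hr.ab
    have cba : b ∘ₗ a = -c := LinearMap.ext hr.ba
    have cbc : b ∘ₗ c = a := LinearMap.ext hr.bc
    have ccb : c ∘ₗ b = -a := LinearMap.ext hr.cb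
    have cca : c ∘ₗ a = b := LinearMap.ext hr.ca
    have cac : a ∘ₗ c = -b := LinearMap.ext hr.ac
    have t0 : LinearMap.trace ℝ V L = 0 := by
      have := congrArg (LinearMap.trace ℝ V) E
      simp only [map_sub, map_add, map_smul, hr.trace_linearPart, za, zb, zc, LinearMap.trace_id,
        map_zero, smul_eq_mul] at this
      have : (4 + (Module.finrank ℝ V : ℝ)) * LinearMap.trace ℝ V L = 0 := by linarith
      exact (mul_eq_zero.mp this).resolve_left (by positivity)
    have t1 : LinearMap.trace ℝ V (a ∘ₗ L) = 0 := by
      have := congrArg (fun F ↦ LinearMap.trace ℝ V (a ∘ₗ F)) E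
      simp only [LinearMap.comp_sub, LinearMap.comp_add, LinearMap.comp_smul, LinearMap.comp_id,
        LinearMap.comp_zero, map_sub, map_add, map_smul, caa, cab, cac, pa, za, zb, zc,
        LinearMap.trace_id, map_neg, map_zero, smul_eq_mul] at this
      have : (Module.finrank ℝ V : ℝ) * LinearMap.trace ℝ V (a ∘ₗ L) = 0 := by linarith
      exact (mul_eq_zero.mp this).resolve_left hd.ne'
    have t2 : LinearMap.trace ℝ V (b ∘ₗ L) = 0 := by
      have := congrArg (fun F ↦ LinearMap.trace ℝ V (b ∘ₗ F)) E
      simp only [LinearMap.comp_sub, LinearMap.comp_add, LinearMap.comp_smul, LinearMap.comp_id,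
        LinearMap.comp_zero, map_sub, map_add, map_smul, cba, cbb, cbc, pb, za, zb, zc,
        LinearMap.trace_id, map_neg, map_zero, smul_eq_mul] at this
      have : (Module.finrank ℝ V : ℝ) * LinearMap.trace ℝ V (b ∘ₗ L) = 0 := by linarith
      exact (mul_eq_zero.mp this).resolve_left hd.ne'
    have t3 : LinearMap.trace ℝ V (c ∘ₗ L) = 0 := by
      have := congrArg (fun F ↦ LinearMap.trace ℝ V (c ∘ₗ F)) E
      simp only [LinearMap.comp_sub, LinearMap.comp_add, LinearMap.comp_smul, LinearMap.comp_id,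
        LinearMap.comp_zero, map_sub, map_add, map_smul, cca, ccb, ccc, pc, za, zb, zc,
        LinearMap.trace_id, map_neg, map_zero, smul_eq_mul] at this
      have : (Module.finrank ℝ V : ℝ) * LinearMap.trace ℝ V (c ∘ₗ L) = 0 := by linarith
      exact (mul_eq_zero.mp this).resolve_left hd.ne'
    refine ⟨?_, t1, t2, t3⟩
    simpa [t0, t1, t2, t3] using E
  · rintro ⟨hP, t1, t2, t3⟩ W
    have t0 : LinearMap.trace ℝ V L = 0 := by
      have := hr.trace_linearPart L
      rw [hP] at this
      simpa using this.symm
    rw [hP, t0, t1, t2, t3]; simp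

end Continuous

/-! ### Smooth vector fields, endomorphism fields and connections -/

section Smooth

variable {E : Type*} [NormedAddCommGroup E] [NormedSpace ℝ E]
  {M : Type*} [TopologicalSpace M] [ChartedSpace E M] [IsManifold 𝓘(ℝ, E) ∞ M]

instance (x : M) [FiniteDimensional ℝ E] : FiniteDimensional ℝ (TangentSpace 𝓘(ℝ, E) x) :=
  inferInstanceAs (FiniteDimensional ℝ E)

/-- `Y` is a vector field that is smooth near `x`. -/
abbrev SmoothAt (Y : ∀ x : M, TangentSpace 𝓘(ℝ, E) x) (x : M) : Prop :=
  ContMDiffAt 𝓘(ℝ, E) (𝓘(ℝ, E).prod 𝓘(ℝ, E)) ∞ (fieldSection Y) x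

lemma SmoothAt.mdifferentiableAt {Y : ∀ x : M, TangentSpace 𝓘(ℝ, E) x} {x : M}
    (h : SmoothAt Y x) : MDiffAt (T% Y) x :=
  ContMDiffAt.mdifferentiableAt (n := ∞) h (by simp)

lemma SmoothAt.eventually_mdifferentiableAt {Y : ∀ x : M, TangentSpace 𝓘(ℝ, E) x} {x : M}
    (h : SmoothAt Y x) : ∀ᶠ y in 𝓝 x, MDiffAt (T% Y) y := by
  have h1 : ContMDiffAt 𝓘(ℝ, E) (𝓘(ℝ, E).prod 𝓘(ℝ, E)) 1 (fieldSection Y) x :=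
    ContMDiffAt.of_le h (by exact_mod_cast le_top)
  filter_upwards [(contMDiffAt_iff_contMDiffAt_nhds (by simp)).1 h1] with y hy
  exact ContMDiffAt.mdifferentiableAt hy one_ne_zero

lemma SmoothAt.congr {Y Z : ∀ x : M, TangentSpace 𝓘(ℝ, E) x} {x : M}
    (h : SmoothAt Y x) (hYZ : ∀ᶠ y in 𝓝 x, Z y = Y y) : SmoothAt Z x :=
  ContMDiffAt.congr_of_eventuallyEq h (hYZ.mono fun y hy ↦ by simp [fieldSection, hy])

lemma SmoothAt.smul {Y : ∀ x : M, TangentSpace 𝓘(ℝ, E) x} {x : M} {g : M → ℝ}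
    (hg : ContMDiffAt 𝓘(ℝ, E) 𝓘(ℝ, ℝ) ∞ g x) (h : SmoothAt Y x) : SmoothAt (g • Y) x :=
  ContMDiffAt.smul_section hg h

lemma SmoothAt.affinor {F : ∀ x : M, TangentSpace 𝓘(ℝ, E) x →L[ℝ] TangentSpace 𝓘(ℝ, E) x}
    {Y : ∀ x : M, TangentSpace 𝓘(ℝ, E) x} {x : M}
    (hF : ContMDiffAt 𝓘(ℝ, E) (𝓘(ℝ, E).prod 𝓘(ℝ, E →L[ℝ] E)) ∞ (affinorSection F) x)
    (hY : SmoothAt Y x) : SmoothAt (fun y ↦ F y (Y y)) x :=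
  ContMDiffAt.clm_bundle_apply (b := id) hF hY

lemma contMDiffAt_mvfderiv_apply {W : Type*} [NormedAddCommGroup W] [NormedSpace ℝ W]
    {f : M → W} {Z : ∀ x : M, TangentSpace 𝓘(ℝ, E) x} {x : M}
    (hf : ContMDiffAt 𝓘(ℝ, E) 𝓘(ℝ, W) ∞ f x) (hZ : SmoothAt Z x) :
    ContMDiffAt 𝓘(ℝ, E) 𝓘(ℝ, W) ∞ (fun y ↦ mvfderiv 𝓘(ℝ, E) f y (Z y)) x := by
  have h1 := hf.mfderiv_const (m := ∞) (by simp)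
  have h2 := ContMDiffAt.clm_apply_of_inCoordinates (IM := 𝓘(ℝ, E)) (IB₂ := 𝓘(ℝ, W))
    (b₁ := id) (b₂ := f)
    (E₂ := fun y : W ↦ TangentSpace 𝓘(ℝ, W) y)
    (ϕ := fun y ↦ mfderiv 𝓘(ℝ, E) 𝓘(ℝ, W) f y) (v := Z) h1 hZ hf
  exact contMDiff_snd_tangentBundle_modelSpace W 𝓘(ℝ, W) |>.contMDiffAt.comp x h2

/-- The vector field that is constant in the trivialization at `x₀`. -/
def constField (x₀ : M) (v : E) (x : M) : TangentSpace 𝓘(ℝ, E) x :=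
  (trivializationAt E (TangentSpace 𝓘(ℝ, E)) x₀).symmL ℝ x v

/-- The coordinates of a tangent vector in the trivialization at `x₀`. -/
def coord (x₀ : M) (x : M) : TangentSpace 𝓘(ℝ, E) x →L[ℝ] E :=
  (trivializationAt E (TangentSpace 𝓘(ℝ, E)) x₀).continuousLinearMapAt ℝ x

variable (E) in
/-- The domain of the trivialization of the tangent bundle at `x₀`. -/
abbrev frameSet (x₀ : M) : Set M :=
  (trivializationAt E (TangentSpace 𝓘(ℝ, E)) x₀).baseSet

variable (E) in
lemma mem_frameSet (x₀ : M) : x₀ ∈ frameSet E x₀ :=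
  FiberBundle.mem_baseSet_trivializationAt' x₀

lemma coord_constField {x₀ x : M}
    (hx : x ∈ frameSet E x₀) (v : E) :
    coord x₀ x (constField x₀ v x) = v :=
  (trivializationAt E (TangentSpace 𝓘(ℝ, E)) x₀).continuousLinearMapAt_symmL hx v

lemma constField_coord {x₀ x : M}
    (hx : x ∈ frameSet E x₀)
    (v : TangentSpace 𝓘(ℝ, E) x) : constField x₀ (coord x₀ x v) x = v :=
  (trivializationAt E (TangentSpace 𝓘(ℝ, E)) x₀).symmL_continuousLinearMapAt hx v

lemma smoothAt_iff_coord {Y : ∀ x : M, TangentSpace 𝓘(ℝ, E) x} {x₀ x : M}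
    (hx : x ∈ frameSet E x₀) :
    SmoothAt Y x ↔ ContMDiffAt 𝓘(ℝ, E) 𝓘(ℝ, E) ∞ (fun y ↦ coord x₀ y (Y y)) x := by
  refine ((trivializationAt E (TangentSpace 𝓘(ℝ, E)) x₀).contMDiffAt_section_iff hx).trans ?_
  refine Filter.EventuallyEq.contMDiffAt_iff ?_
  filter_upwards [(trivializationAt E (TangentSpace 𝓘(ℝ, E)) x₀).open_baseSet.mem_nhds hx]
    with y hy
  simp [coord, Trivialization.continuousLinearMapAt_apply,
    Trivialization.coe_linearMapAt_of_mem _ hy]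

lemma smoothAt_constField {x₀ x : M}
    (hx : x ∈ frameSet E x₀) (v : E) :
    SmoothAt (constField x₀ v) x := by
  rw [smoothAt_iff_coord hx]
  refine (contMDiffAt_const (c := v)).congr_of_eventuallyEq ?_
  filter_upwards [(trivializationAt E (TangentSpace 𝓘(ℝ, E)) x₀).open_baseSet.mem_nhds hx]
    with y hy using coord_constField hy v

lemma eventually_mem_frameSet {x₀ x : M}
    (hx : x ∈ frameSet E x₀) :
    ∀ᶠ y in 𝓝 x, y ∈ frameSet E x₀ :=
  (trivializationAt E (TangentSpace 𝓘(ℝ, E)) x₀).open_baseSet.mem_nhds hx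

lemma exists_smoothAt (x : M) (v : TangentSpace 𝓘(ℝ, E) x) :
    ∃ Y : ∀ y : M, TangentSpace 𝓘(ℝ, E) y, SmoothAt Y x ∧ Y x = v :=
  ⟨constField x (coord x x v), smoothAt_constField (mem_frameSet E x) _,
    constField_coord (mem_frameSet E x) v⟩

variable [FiniteDimensional ℝ E]

omit [IsManifold 𝓘(ℝ, E) ∞ M] in
lemma contMDiffAt_clm_of_apply {W : Type*} [NormedAddCommGroup W] [NormedSpace ℝ W]
    {φ : M → E →L[ℝ] W} {x : M}
    (h : ∀ v, ContMDiffAt 𝓘(ℝ, E) 𝓘(ℝ, W) ∞ (fun y ↦ φ y v) x) :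
    ContMDiffAt 𝓘(ℝ, E) 𝓘(ℝ, E →L[ℝ] W) ∞ φ x := by
  have hφ : φ = fun y ↦ ∑ i, (((Module.finBasis ℝ E).coord i).toContinuousLinearMap).smulRight
      (φ y (Module.finBasis ℝ E i)) := by
    ext y v
    conv_lhs => rw [← (Module.finBasis ℝ E).sum_repr v, map_sum]
    simp
  rw [hφ]
  refine contMDiffAt_finsetSum fun i _ ↦ ?_
  exact ((ContinuousLinearMap.smulRightL ℝ E W
    (((Module.finBasis ℝ E).coord i).toContinuousLinearMap)).contMDiff.contMDiffAt).comp x (h _)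

/-- A field of endomorphisms that maps smooth vector fields to smooth vector fields is smooth. -/
lemma contMDiffAt_affinor {F : ∀ x : M, TangentSpace 𝓘(ℝ, E) x →L[ℝ] TangentSpace 𝓘(ℝ, E) x}
    {x : M} (hF : ∀ Y : ∀ x : M, TangentSpace 𝓘(ℝ, E) x, SmoothAt Y x →
      SmoothAt (fun y ↦ F y (Y y)) x) :
    ContMDiffAt 𝓘(ℝ, E) (𝓘(ℝ, E).prod 𝓘(ℝ, E →L[ℝ] E)) ∞ (affinorSection F) x := by
  rw [contMDiffAt_hom_bundle]
  refine ⟨contMDiffAt_id, contMDiffAt_clm_of_apply fun v ↦ ?_⟩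
  have h := (smoothAt_iff_coord (mem_frameSet E x)).1
    (hF _ (smoothAt_constField (mem_frameSet E x) v))
  refine h.congr_of_eventuallyEq ?_
  filter_upwards [eventually_mem_frameSet (mem_frameSet E x)] with y hy
  change ContinuousLinearMap.inCoordinates E (TangentSpace 𝓘(ℝ, E)) E (TangentSpace 𝓘(ℝ, E))
    x y x y (F y) v = _
  rw [ContinuousLinearMap.inCoordinates_eq hy hy]
  simp [coord, constField, Trivialization.continuousLinearMapAt_apply,
    Trivialization.coe_linearMapAt_of_mem _ hy]
  rw [Trivialization.symmL_apply _ hy]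

/-- The trace of a field of endomorphisms that maps smooth vector fields to smooth vector fields
is a smooth function. -/
lemma contMDiffAt_trace {L : ∀ x : M, TangentSpace 𝓘(ℝ, E) x →ₗ[ℝ] TangentSpace 𝓘(ℝ, E) x}
    {x : M} (hL : ∀ Y : ∀ x : M, TangentSpace 𝓘(ℝ, E) x, SmoothAt Y x →
      SmoothAt (fun y ↦ L y (Y y)) x) :
    ContMDiffAt 𝓘(ℝ, E) 𝓘(ℝ, ℝ) ∞ (fun y ↦ LinearMap.trace ℝ _ (L y)) x := by
  have h : ContMDiffAt 𝓘(ℝ, E) 𝓘(ℝ, ℝ) ∞ (fun y ↦ ∑ i, (Module.finBasis ℝ E).coord i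
      (coord x y (L y (constField x (Module.finBasis ℝ E i) y)))) x := by
    refine contMDiffAt_finsetSum fun i _ ↦ ?_
    have h := (smoothAt_iff_coord (mem_frameSet E x)).1
      (hL _ (smoothAt_constField (mem_frameSet E x) (Module.finBasis ℝ E i)))
    exact ((((Module.finBasis ℝ E).coord i).toContinuousLinearMap).contMDiff.contMDiffAt).comp x h
  refine h.congr_of_eventuallyEq ?_
  filter_upwards [eventually_mem_frameSet (mem_frameSet E x)] with y hy
  let e : E ≃ₗ[ℝ] TangentSpace 𝓘(ℝ, E) y :=
    { toFun v := constField x v y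
      invFun v := coord x y v
      map_add' := by simp [constField]
      map_smul' := by simp [constField]
      left_inv v := coord_constField hy v
      right_inv v := constField_coord hy v }
  rw [← LinearMap.trace_conj' (L y) e.symm, LinearMap.trace_eq_matrix_trace ℝ (Module.finBasis ℝ E),
    Matrix.trace]
  refine Finset.sum_congr rfl fun i _ ↦ ?_
  rw [Matrix.diag_apply, LinearMap.toMatrix_apply]
  rfl

lemma exists_bump [T2Space M] {x : M} {U : Set M} (hU : U ∈ 𝓝 x) :
    ∃ χ : M → ℝ, ContMDiff 𝓘(ℝ, E) 𝓘(ℝ, ℝ) ∞ χ ∧ tsupport χ ⊆ U ∧ ∀ᶠ y in 𝓝 x, χ y = 1 := by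
  obtain ⟨χ, -, hχ⟩ := (SmoothBumpFunction.nhds_basis_tsupport (I := 𝓘(ℝ, E)) x).mem_iff.1 hU
  exact ⟨χ, χ.contMDiff, hχ, χ.eventuallyEq_one⟩

/-- A locally smooth vector field agrees near the point with a globally smooth one. -/
lemma exists_contMDiff_eventuallyEq [T2Space M] {Y : ∀ x : M, TangentSpace 𝓘(ℝ, E) x} {x : M}
    {U : Set M} (hU : IsOpen U) (hx : x ∈ U) (hY : ∀ y ∈ U, SmoothAt Y y) :
    ∃ Z : ∀ x : M, TangentSpace 𝓘(ℝ, E) x,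
      ContMDiff 𝓘(ℝ, E) (𝓘(ℝ, E).prod 𝓘(ℝ, E)) ∞ (fieldSection Z) ∧ ∀ᶠ y in 𝓝 x, Z y = Y y := by
  obtain ⟨χ, hχ, hs, h1⟩ := exists_bump (E := E) (hU.mem_nhds hx)
  refine ⟨χ • Y, ContMDiffOn.smul_section_of_tsupport hχ.contMDiffOn hU hs
    fun y hy ↦ (hY y hy).contMDiffWithinAt, h1.mono fun y hy ↦ by simp [hy]⟩

variable (E M) in
/-- The type of a (possibly only locally meaningful) covariant derivative on the tangent bundle:
`cov Y x v` is `∇_v Y`. -/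
abbrev Operator := (∀ x : M, TangentSpace 𝓘(ℝ, E) x) →
  ∀ x : M, TangentSpace 𝓘(ℝ, E) x →L[ℝ] TangentSpace 𝓘(ℝ, E) x

/-- `cov` is a smooth covariant derivative over `U`. Smoothness is tested on pairs of vector
fields. -/
structure IsSmoothConnectionOn (cov : Operator E M) (U : Set M) : Prop where
  isCov : IsCovariantDerivativeOn E cov U
  smoothAt : ∀ x ∈ U, ∀ Y Z : ∀ x : M, TangentSpace 𝓘(ℝ, E) x, SmoothAt Y x → SmoothAt Z x →
    SmoothAt (fun y ↦ cov Y y (Z y)) x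

/-- The flat connection of the trivialization of the tangent bundle at `x₀`. -/
def flatConnection (x₀ : M) : Operator E M := fun Y x ↦
  (trivializationAt E (TangentSpace 𝓘(ℝ, E)) x₀).symmL ℝ x ∘L
    mvfderiv 𝓘(ℝ, E) (fun y ↦ coord x₀ y (Y y)) x

omit [FiniteDimensional ℝ E] in
lemma flatConnection_apply (x₀ : M) (Y : ∀ x : M, TangentSpace 𝓘(ℝ, E) x) (x : M)
    (v : TangentSpace 𝓘(ℝ, E) x) : flatConnection x₀ Y x v =
      constField x₀ (mvfderiv 𝓘(ℝ, E) (fun y ↦ coord x₀ y (Y y)) x v) x := rfl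

omit [FiniteDimensional ℝ E] in
lemma mdifferentiableAt_coord {Y : ∀ x : M, TangentSpace 𝓘(ℝ, E) x} {x₀ x : M}
    (hx : x ∈ frameSet E x₀) (hY : MDiffAt (T% Y) x) :
    MDifferentiableAt 𝓘(ℝ, E) 𝓘(ℝ, E) (fun y ↦ coord x₀ y (Y y)) x := by
  have h := ((trivializationAt E (TangentSpace 𝓘(ℝ, E)) x₀).mdifferentiableAt_section_iff
    𝓘(ℝ, E) Y hx).1 hY
  refine h.congr_of_eventuallyEq ?_
  filter_upwards [eventually_mem_frameSet hx] with y hy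
  simp [coord, Trivialization.continuousLinearMapAt_apply,
    Trivialization.coe_linearMapAt_of_mem _ hy]

omit [FiniteDimensional ℝ E] in
lemma flatConnection_constField {x₀ x : M} (hx : x ∈ frameSet E x₀) (v : E) :
    flatConnection x₀ (constField x₀ v) x = 0 := by
  have h : (fun y ↦ coord x₀ y (constField x₀ v y)) =ᶠ[𝓝 x] fun _ ↦ v := by
    filter_upwards [eventually_mem_frameSet hx] with y hy using coord_constField hy v
  have h' : mvfderiv 𝓘(ℝ, E) (fun y ↦ coord x₀ y (constField x₀ v y)) x = 0 := by
    ext w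
    rw [mvfderiv, h.mfderiv_eq, mfderiv_const]
    rfl
  rw [flatConnection, h', ContinuousLinearMap.comp_zero]

omit [FiniteDimensional ℝ E] in
lemma isSmoothConnectionOn_flatConnection (x₀ : M) :
    IsSmoothConnectionOn (flatConnection (E := E) x₀) (frameSet E x₀) where
  isCov :=
    { add := by
        intro Y Y' x hY hY' hx
        ext v
        have h : (fun y ↦ coord x₀ y ((Y + Y') y)) =
          (fun y ↦ coord x₀ y (Y y)) + fun y ↦ coord x₀ y (Y' y) := by ext; simp
        rw [flatConnection_apply, h, mvfderiv_add (mdifferentiableAt_coord hx hY)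
          (mdifferentiableAt_coord hx hY')]
        simp [flatConnection, constField]
      leibniz := by
        intro Y g x hY hg hx
        ext v
        have h : (fun y ↦ coord x₀ y ((g • Y) y)) = g • (fun y ↦ coord x₀ y (Y y)) := by ext; simp
        rw [flatConnection_apply, h, mvfderiv_smul hg (mdifferentiableAt_coord hx hY)]
        have := constField_coord hx (Y x)
        simp only [constField] at this
        simp [flatConnection, constField, this] }
  smoothAt := by
    intro x hx Y Z hY hZ
    rw [smoothAt_iff_coord hx]
    refine (contMDiffAt_mvfderiv_apply ((smoothAt_iff_coord hx).1 hY) hZ).congr_of_eventuallyEq ?_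
    filter_upwards [eventually_mem_frameSet hx] with y hy
    rw [flatConnection_apply, coord_constField hy]

/-- A connection in a trivialization: the flat connection plus the Christoffel symbols. -/
lemma _root_.IsCovariantDerivativeOn.eq_flatConnection_add {cov : Operator E M} {U : Set M}
    (h : IsCovariantDerivativeOn E cov U) {x₀ x : M} (hx : x ∈ frameSet E x₀) (hxU : x ∈ U)
    {Y : ∀ x : M, TangentSpace 𝓘(ℝ, E) x} (hY : MDiffAt (T% Y) x) :
    cov Y x = flatConnection x₀ Y x + cov (constField x₀ (coord x₀ x (Y x))) x := by
  have hf := (isSmoothConnectionOn_flatConnection (E := E) x₀).isCov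
  have h1 := (h.mono (Set.inter_subset_left (t := frameSet E x₀))).difference_apply
    (hf.mono (Set.inter_subset_right (s := U))) ⟨hxU, hx⟩ hY
  have h2 := (h.mono (Set.inter_subset_left (t := frameSet E x₀))).difference_apply
    (hf.mono (Set.inter_subset_right (s := U))) ⟨hxU, hx⟩
    (smoothAt_constField hx (coord x₀ x (Y x))).mdifferentiableAt
  rw [constField_coord hx, h1, flatConnection_constField hx, sub_zero] at h2
  rw [← h2]
  abel

omit [FiniteDimensional ℝ E] in
lemma _root_.IsCovariantDerivativeOn.constField_add {cov : Operator E M} {U : Set M}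
    (h : IsCovariantDerivativeOn E cov U) {x₀ x : M} (hx : x ∈ frameSet E x₀) (hxU : x ∈ U)
    (u v : E) : cov (constField x₀ (u + v)) x = cov (constField x₀ u) x
      + cov (constField x₀ v) x := by
  rw [← h.add (smoothAt_constField hx u).mdifferentiableAt
    (smoothAt_constField hx v).mdifferentiableAt hxU]
  congr
  ext y
  simp [constField]

omit [FiniteDimensional ℝ E] in
lemma _root_.IsCovariantDerivativeOn.constField_smul {cov : Operator E M} {U : Set M}
    (h : IsCovariantDerivativeOn E cov U) {x₀ x : M} (hx : x ∈ frameSet E x₀) (hxU : x ∈ U)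
    (r : ℝ) (v : E) : cov (constField x₀ (r • v)) x = r • cov (constField x₀ v) x := by
  rw [← h.smul_const r (smoothAt_constField hx v).mdifferentiableAt hxU]
  congr
  ext y
  simp [constField]

/-- The Christoffel symbols of `cov` at `x` with respect to the trivialization at `x₀`. -/
def christoffel (cov : Operator E M) {U : Set M}
    (h : IsCovariantDerivativeOn E cov U) {x₀ x : M} (hx : x ∈ frameSet E x₀) (hxU : x ∈ U) :
    E →ₗ[ℝ] TangentSpace 𝓘(ℝ, E) x →L[ℝ] TangentSpace 𝓘(ℝ, E) x where
  toFun u := cov (constField x₀ u) x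
  map_add' := h.constField_add hx hxU
  map_smul' := h.constField_smul hx hxU

lemma _root_.IsCovariantDerivativeOn.constField_eq_sum {cov : Operator E M} {U : Set M}
    (h : IsCovariantDerivativeOn E cov U) {x₀ x : M} (hx : x ∈ frameSet E x₀) (hxU : x ∈ U)
    (u : E) : cov (constField x₀ u) x = ∑ i, (Module.finBasis ℝ E).coord i u •
      cov (constField x₀ (Module.finBasis ℝ E i)) x := by
  change christoffel cov h hx hxU u = ∑ i, _ • christoffel cov h hx hxU _
  conv_lhs => rw [← (Module.finBasis ℝ E).sum_repr u, map_sum]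
  simp

/-- It suffices to test the smoothness of a connection on the vector fields of a frame. -/
lemma isSmoothConnectionOn_of_constField {cov : Operator E M} {U : Set M} (hU : IsOpen U)
    (h : IsCovariantDerivativeOn E cov U)
    (hs : ∀ x ∈ U, ∀ v : E, ∀ Z : ∀ x : M, TangentSpace 𝓘(ℝ, E) x, SmoothAt Z x →
      SmoothAt (fun y ↦ cov (constField x v) y (Z y)) x) : IsSmoothConnectionOn cov U := by
  refine ⟨h, fun x hxU Y Z hY hZ ↦ ?_⟩
  have hx := mem_frameSet E x
  have h1 : SmoothAt (fun y ↦ flatConnection x Y y (Z y) + ∑ i, (Module.finBasis ℝ E).coord i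
      (coord x y (Y y)) • cov (constField x (Module.finBasis ℝ E i)) y (Z y)) x := by
    refine ContMDiffAt.add_section
      ((isSmoothConnectionOn_flatConnection x).smoothAt x hx Y Z hY hZ)
      (ContMDiffAt.sum_section fun i _ ↦ ContMDiffAt.smul_section ?_ (hs x hxU _ Z hZ))
    exact (((Module.finBasis ℝ E).coord i).toContinuousLinearMap).contMDiff.contMDiffAt.comp x
      ((smoothAt_iff_coord hx).1 hY)
  refine h1.congr ?_
  filter_upwards [hU.mem_nhds hxU, eventually_mem_frameSet hx, hY.eventually_mdifferentiableAt]
    with y hyU hy hY'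
  rw [h.eq_flatConnection_add hy hyU hY', h.constField_eq_sum hy hyU]
  simp

lemma isSmoothConnectionOn_univ [T2Space M]
    (cov : CovariantDerivative 𝓘(ℝ, E) E (TangentSpace 𝓘(ℝ, E) : M → Type _))
    (h : cov.ContMDiffCovariantDerivative ∞) : IsSmoothConnectionOn cov.toFun Set.univ := by
  refine isSmoothConnectionOn_of_constField isOpen_univ cov.isCovariantDerivativeOnUniv
    fun x _ v Z hZ ↦ ?_
  obtain ⟨Y, hY, hYv⟩ := exists_contMDiff_eventuallyEq
    (trivializationAt E (TangentSpace 𝓘(ℝ, E)) x).open_baseSet (mem_frameSet E x)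
    fun y hy ↦ smoothAt_constField hy v
  have h1 := h.contMDiff.contMDiff (σ := Y) hY.contMDiffOn x trivial
  have h2 := SmoothAt.affinor (contMDiffWithinAt_univ.1 h1) hZ
  refine h2.congr ?_
  filter_upwards [hYv.eventually_nhds, eventually_mem_frameSet (mem_frameSet E x)] with y hy hy'
  rw [cov.isCovariantDerivativeOnUniv.congr_of_eventuallyEq (s := Set.univ) _ _ Filter.univ_mem hy]
  · exact (hY y).mdifferentiableAt (by simp)
  · exact (smoothAt_constField hy' v).mdifferentiableAt

lemma IsSmoothConnectionOn.contMDiffCovariantDerivative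
    (cov : CovariantDerivative 𝓘(ℝ, E) E (TangentSpace 𝓘(ℝ, E) : M → Type _))
    (h : IsSmoothConnectionOn cov.toFun Set.univ) : cov.ContMDiffCovariantDerivative ∞ where
  contMDiff := ⟨fun {Y} hY x _ ↦ (contMDiffAt_affinor fun Z hZ ↦ h.smoothAt x trivial Y Z
    (contMDiffWithinAt_univ.1 (hY x trivial)) hZ).contMDiffWithinAt⟩

end Smooth

/-! ### Weyl connections over open sets, and how to glue them -/

section Weyl

variable {E : Type*} [NormedAddCommGroup E] [NormedSpace ℝ E]
  {M : Type*} [TopologicalSpace M] [ChartedSpace E M] [IsManifold 𝓘(ℝ, E) ∞ M]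

/-- The connection `cov` is compatible with `Q` at the point `x`. -/
def Structure.CompatibleAt (Q : Structure E M) (cov : Operator E M) (x : M) : Prop :=
  ∀ F : ∀ y : M, TangentSpace 𝓘(ℝ, E) y →L[ℝ] TangentSpace 𝓘(ℝ, E) y,
    ContMDiffAt 𝓘(ℝ, E) (𝓘(ℝ, E).prod 𝓘(ℝ, E →L[ℝ] E)) ∞ (affinorSection F) x →
    (∀ᶠ y in 𝓝 x, F y ∈ Q.fibre y) →
    ∀ v : TangentSpace 𝓘(ℝ, E) x, ∃ G ∈ Q.fibre x, ∀ Y : ∀ y : M, TangentSpace 𝓘(ℝ, E) y,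
      SmoothAt Y x → cov (fun y ↦ F y (Y y)) x v - F x (cov Y x v) = G (Y x)

/-- The bilinear map `T` is the torsion of `cov` at the point `x`. -/
def IsTorsionAt (cov : Operator E M) (x : M)
    (T : TangentSpace 𝓘(ℝ, E) x →ₗ[ℝ] TangentSpace 𝓘(ℝ, E) x →ₗ[ℝ] TangentSpace 𝓘(ℝ, E) x) :
    Prop :=
  ∀ X Y : ∀ y : M, TangentSpace 𝓘(ℝ, E) y, MDiffAt (T% X) x → MDiffAt (T% Y) x →
    T (X x) (Y x) = cov Y x (X x) - cov X x (Y x) - VectorField.mlieBracket 𝓘(ℝ, E) X Y x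

/-- The torsion of `cov` at `x` is normalized with respect to `Q`. -/
def Structure.NormalizedAt (Q : Structure E M) (cov : Operator E M) (x : M) : Prop :=
  ∃ T, IsTorsionAt cov x T ∧ ∀ A B C : TangentSpace 𝓘(ℝ, E) x →L[ℝ] TangentSpace 𝓘(ℝ, E) x,
    A ∈ Q.fibre x → B ∈ Q.fibre x → C ∈ Q.fibre x → IsHypercomplex A B C →
    ∀ X, IsNormal (A : TangentSpace 𝓘(ℝ, E) x →ₗ[ℝ] TangentSpace 𝓘(ℝ, E) x)
      (B : TangentSpace 𝓘(ℝ, E) x →ₗ[ℝ] TangentSpace 𝓘(ℝ, E) x)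
      (C : TangentSpace 𝓘(ℝ, E) x →ₗ[ℝ] TangentSpace 𝓘(ℝ, E) x) (T.flip X)

/-- `cov` is a Weyl connection of `Q` over the set `U`. -/
structure Structure.IsWeylOn (Q : Structure E M) (cov : Operator E M) (U : Set M) : Prop where
  connection : IsSmoothConnectionOn cov U
  compatible : ∀ x ∈ U, Q.CompatibleAt cov x
  normalized : ∀ x ∈ U, Q.NormalizedAt cov x

lemma IsTorsionAt.unique {cov : Operator E M} {x : M}
    {T T' : TangentSpace 𝓘(ℝ, E) x →ₗ[ℝ] TangentSpace 𝓘(ℝ, E) x →ₗ[ℝ] TangentSpace 𝓘(ℝ, E) x}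
    (h : IsTorsionAt cov x T) (h' : IsTorsionAt cov x T') : T = T' := by
  ext v w
  obtain ⟨X, hX, rfl⟩ := exists_smoothAt x v
  obtain ⟨Y, hY, rfl⟩ := exists_smoothAt x w
  rw [h X Y hX.mdifferentiableAt hY.mdifferentiableAt,
    h' X Y hX.mdifferentiableAt hY.mdifferentiableAt]

lemma IsTorsionAt.flip_eq_neg {cov : Operator E M} {x : M}
    {T : TangentSpace 𝓘(ℝ, E) x →ₗ[ℝ] TangentSpace 𝓘(ℝ, E) x →ₗ[ℝ] TangentSpace 𝓘(ℝ, E) x}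
    (h : IsTorsionAt cov x T) : T.flip = -T := by
  ext v w
  obtain ⟨X, hX, rfl⟩ := exists_smoothAt x v
  obtain ⟨Y, hY, rfl⟩ := exists_smoothAt x w
  rw [LinearMap.flip_apply, LinearMap.neg_apply, LinearMap.neg_apply,
    h X Y hX.mdifferentiableAt hY.mdifferentiableAt,
    h Y X hY.mdifferentiableAt hX.mdifferentiableAt, VectorField.mlieBracket_swap_apply]
  module

variable [FiniteDimensional ℝ E] [CompleteSpace E]

lemma _root_.IsCovariantDerivativeOn.exists_isTorsionAt {cov : Operator E M} {U : Set M} {x : M}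
    (h : IsCovariantDerivativeOn E cov U) (hx : x ∈ U) : ∃ T, IsTorsionAt cov x T := by
  let Φ : (∀ y : M, TangentSpace 𝓘(ℝ, E) y) → (∀ y : M, TangentSpace 𝓘(ℝ, E) y) →
    TangentSpace 𝓘(ℝ, E) x := fun X Y ↦
      cov Y x (X x) - cov X x (Y x) - VectorField.mlieBracket 𝓘(ℝ, E) X Y x
  have h1 : ∀ Y : ∀ y : M, TangentSpace 𝓘(ℝ, E) y, MDiffAt (T% Y) x →
      TensorialAt 𝓘(ℝ, E) E (fun X ↦ Φ X Y) x := fun Y hY ↦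
    { smul := fun hf hX ↦ by
        simp [Φ, h.leibniz hX hf hx, VectorField.mlieBracket_smul_left hf hX]
        module
      add := fun hX hX' ↦ by
        simp [Φ, h.add hX hX' hx, VectorField.mlieBracket_add_left hX hX']
        module }
  have h2 : ∀ X : ∀ y : M, TangentSpace 𝓘(ℝ, E) y, MDiffAt (T% X) x →
      TensorialAt 𝓘(ℝ, E) E (Φ X) x := fun Y hY ↦
    { smul := fun hf hX ↦ by
        simp [Φ, h.leibniz hX hf hx, VectorField.mlieBracket_smul_right hf hX]
        module
      add := fun hX hX' ↦ by
        simp [Φ, h.add hX hX' hx, VectorField.mlieBracket_add_right hX hX']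
        module }
  exact ⟨toLinearMap₂ (TensorialAt.mkHom₂ Φ x h1 h2),
    fun X Y hX hY ↦ TensorialAt.mkHom₂_apply h1 h2 hX hY⟩

lemma Structure.isWeyl_iff [T2Space M] (Q : Structure E M)
    (cov : CovariantDerivative 𝓘(ℝ, E) E (TangentSpace 𝓘(ℝ, E) : M → Type _)) :
    Q.IsWeyl cov ↔ Q.IsWeylOn cov.toFun Set.univ := by
  have hT : ∀ x, IsTorsionAt cov.toFun x (toLinearMap₂ (cov.torsion x)) :=
    fun x X Y hX hY ↦ cov.torsion_apply hX hY
  constructor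
  · intro h
    exact ⟨isSmoothConnectionOn_univ cov h.smooth, fun x _ ↦ h.compatible x, fun x _ ↦
      ⟨_, hT x, fun A B C hA hB hC hABC X ↦ (hABC.codifferential_eq_zero_iff _ X).1
        (h.normalized x A B C hA hB hC hABC X)⟩⟩
  · intro h
    refine ⟨h.connection.contMDiffCovariantDerivative, fun x ↦ h.compatible x trivial,
      fun x A B C hA hB hC hABC X ↦ (hABC.codifferential_eq_zero_iff _ X).2 ?_⟩
    obtain ⟨T, hT', h'⟩ := h.normalized x trivial
    rw [(hT x).unique hT']
    exact h' A B C hA hB hC hABC X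

lemma IsNormal.sum {V : Type*} [AddCommGroup V] [Module ℝ V] {a b c : V →ₗ[ℝ] V} {ι : Type*}
    (s : Finset ι) {L : ι → V →ₗ[ℝ] V} (r : ι → ℝ) (h : ∀ i ∈ s, IsNormal a b c (L i)) :
    IsNormal a b c (∑ i ∈ s, r i • L i) := by
  have key : ∀ d : V →ₗ[ℝ] V, (∀ i ∈ s, LinearMap.trace ℝ V (d ∘ₗ L i) = 0) →
      LinearMap.trace ℝ V (d ∘ₗ ∑ i ∈ s, r i • L i) = 0 := by
    intro d hd
    have h1 : d ∘ₗ ∑ i ∈ s, r i • L i = ∑ i ∈ s, r i • (d ∘ₗ L i) := by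
      ext v
      simp [LinearMap.sum_apply]
    rw [h1, map_sum]
    exact Finset.sum_eq_zero fun i hi ↦ by rw [map_smul, hd i hi, smul_zero]
  refine ⟨?_, key a fun i hi ↦ (h i hi).trace_left, key b fun i hi ↦ (h i hi).trace_middle,
    key c fun i hi ↦ (h i hi).trace_right⟩
  ext v
  have h1 : ∀ i ∈ s, r i • (L i v - a (L i (a v)) - b (L i (b v)) - c (L i (c v))) = 0 := by
    intro i hi
    rw [← linearPart_apply, (h i hi).linearPart_eq, LinearMap.zero_apply, smul_zero]
  have h2 := Finset.sum_eq_zero h1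
  simp only [smul_sub, Finset.sum_sub_distrib] at h2
  simpa [linearPart_apply, LinearMap.sum_apply] using h2

omit [CompleteSpace E] in
/-- Weyl connections exist globally as soon as they exist locally: being a Weyl connection is an
affine condition, so that local ones may be glued with a partition of unity. -/
theorem Structure.exists_isWeylOn_univ [T2Space M] [SigmaCompactSpace M] (Q : Structure E M)
    (h : ∀ x : M, ∃ U, IsOpen U ∧ x ∈ U ∧ ∃ cov : Operator E M, Q.IsWeylOn cov U) :
    ∃ cov : Operator E M, Q.IsWeylOn cov Set.univ := by
  choose U hU hxU cov hcov using h
  obtain ⟨ρ, hρ⟩ := SmoothPartitionOfUnity.exists_isSubordinate 𝓘(ℝ, E) isClosed_univ U hU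
    (fun x _ ↦ Set.mem_iUnion_of_mem x (hxU x))
  have hmem : ∀ {x i}, i ∈ ρ.finsupport x → x ∈ U i := fun {x i} hi ↦
    hρ i (subset_closure ((ρ.mem_finsupport x).1 hi))
  have hone : ∀ x, ∑ i ∈ ρ.finsupport x, ρ i x = 1 := fun x ↦ ρ.sum_finsupport x trivial
  let D : Operator E M := fun Y x ↦ ∑ i ∈ ρ.finsupport x, ρ i x • cov i Y x
  have hD : ∀ Y x v, D Y x v = ∑ i ∈ ρ.finsupport x, ρ i x • cov i Y x v := by
    intro Y x v
    simp [D]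
  refine ⟨D, ⟨⟨⟨?_, ?_⟩, ?_⟩, ?_, ?_⟩⟩
  · intro Y Y' x hY hY' _
    simp only [D]
    rw [← Finset.sum_add_distrib]
    refine Finset.sum_congr rfl fun i hi ↦ ?_
    rw [(hcov i).connection.isCov.add hY hY' (hmem hi), smul_add]
  · intro Y g x hY hg _
    have h1 : ∀ i ∈ ρ.finsupport x, ρ i x • cov i (g • Y) x = g x • ρ i x • cov i Y x
        + ρ i x • (mvfderiv 𝓘(ℝ, E) g x).smulRight (Y x) := by
      intro i hi
      rw [(hcov i).connection.isCov.leibniz hY hg (hmem hi), smul_add, smul_comm]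
    simp only [D]
    rw [Finset.sum_congr rfl h1, Finset.sum_add_distrib, ← Finset.smul_sum, ← Finset.sum_smul,
      hone, one_smul]
  · intro x _ Y Z hY hZ
    have h1 : (fun y ↦ D Y y (Z y)) = fun y ↦ ∑ᶠ i, ρ i y • cov i Y y (Z y) := by
      ext y
      rw [hD, ← ρ.sum_finsupport_smul_eq_finsum y (A := TangentSpace 𝓘(ℝ, E) y)
        (fun i _ ↦ cov i Y y (Z y))]
    rw [h1]
    refine ContMDiffAt.finsum_section_of_locallyFinite ?_ fun i ↦ ?_
    · exact ρ.locallyFinite.subset fun i y hy ↦ left_ne_zero_of_smul hy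
    · by_cases hx : x ∈ tsupport (ρ i)
      · exact SmoothAt.smul ((ρ i).contMDiff x)
          ((hcov i).connection.smoothAt x (hρ i hx) Y Z hY hZ)
      · refine SmoothAt.congr (contMDiffAt_zeroSection ..) ?_
        filter_upwards [(isClosed_tsupport (ρ i)).isOpen_compl.mem_nhds hx] with y hy
        simp [image_eq_zero_of_notMem_tsupport hy]
  · intro x _ F hF hFQ v
    have h1 : ∀ i, ∃ G ∈ Q.fibre x, i ∈ ρ.finsupport x → ∀ Y : ∀ y : M, TangentSpace 𝓘(ℝ, E) y,
        SmoothAt Y x → cov i (fun y ↦ F y (Y y)) x v - F x (cov i Y x v) = G (Y x) := by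
      intro i
      by_cases hi : i ∈ ρ.finsupport x
      · obtain ⟨G, hG, hG'⟩ := (hcov i).compatible x (hmem hi) F hF hFQ v
        exact ⟨G, hG, fun _ ↦ hG'⟩
      · exact ⟨0, Submodule.zero_mem _, fun h ↦ absurd h hi⟩
    choose G hG hG' using h1
    refine ⟨∑ i ∈ ρ.finsupport x, ρ i x • G i, Submodule.sum_mem _ fun i _ ↦
      Submodule.smul_mem _ _ (hG i), fun Y hY ↦ ?_⟩
    rw [hD, hD, map_sum, ← Finset.sum_sub_distrib, sum_apply]
    refine Finset.sum_congr rfl fun i hi ↦ ?_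
    rw [map_smul, ← smul_sub, hG' i hi Y hY]
    rfl
  · intro x _
    have h1 : ∀ i, ∃ T, i ∈ ρ.finsupport x → (IsTorsionAt (cov i) x T ∧
      ∀ A B C : TangentSpace 𝓘(ℝ, E) x →L[ℝ] TangentSpace 𝓘(ℝ, E) x,
        A ∈ Q.fibre x → B ∈ Q.fibre x → C ∈ Q.fibre x → IsHypercomplex A B C →
        ∀ X, IsNormal (A : TangentSpace 𝓘(ℝ, E) x →ₗ[ℝ] TangentSpace 𝓘(ℝ, E) x)
          (B : TangentSpace 𝓘(ℝ, E) x →ₗ[ℝ] TangentSpace 𝓘(ℝ, E) x)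
          (C : TangentSpace 𝓘(ℝ, E) x →ₗ[ℝ] TangentSpace 𝓘(ℝ, E) x) (T.flip X)) := by
      intro i
      by_cases hi : i ∈ ρ.finsupport x
      · obtain ⟨T, hT⟩ := (hcov i).normalized x (hmem hi)
        exact ⟨T, fun _ ↦ hT⟩
      · exact ⟨0, fun h ↦ absurd h hi⟩
    choose T hT using h1
    refine ⟨∑ i ∈ ρ.finsupport x, ρ i x • T i, fun X Y hX hY ↦ ?_, fun A B C hA hB hC h X ↦ ?_⟩
    · have h2 : ∀ i ∈ ρ.finsupport x, ρ i x • T i (X x) (Y x) = ρ i x • cov i Y x (X x)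
          - ρ i x • cov i X x (Y x) - ρ i x • VectorField.mlieBracket 𝓘(ℝ, E) X Y x := by
        intro i hi
        rw [(hT i hi).1 X Y hX hY, smul_sub, smul_sub]
      simp only [LinearMap.sum_apply, LinearMap.smul_apply]
      rw [Finset.sum_congr rfl h2, Finset.sum_sub_distrib, Finset.sum_sub_distrib,
        ← Finset.sum_smul, hone, one_smul, hD, hD]
    · have h2 := IsNormal.sum (ρ.finsupport x) (fun i ↦ ρ i x) (L := fun i ↦ (T i).flip X)
        fun i hi ↦ (hT i hi).2 A B C hA hB hC h X
      convert h2
      ext v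
      simp [LinearMap.sum_apply]

end Weyl

/-! ### Adding a one-form to a connection -/

section AddForm

variable {E : Type*} [NormedAddCommGroup E] [NormedSpace ℝ E]
  {M : Type*} [TopologicalSpace M] [ChartedSpace E M] [IsManifold 𝓘(ℝ, E) ∞ M]

/-- A field of bilinear maps on the tangent spaces. -/
abbrev BilinearField (E M : Type*) [NormedAddCommGroup E] [NormedSpace ℝ E]
    [TopologicalSpace M] [ChartedSpace E M] :=
  ∀ x : M, TangentSpace 𝓘(ℝ, E) x →ₗ[ℝ] TangentSpace 𝓘(ℝ, E) x →ₗ[ℝ] TangentSpace 𝓘(ℝ, E) x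

/-- The field of bilinear maps `G` maps pairs of vector fields smooth at `x` to vector fields
smooth at `x`. -/
def BilinearField.SmoothAt (G : BilinearField E M) (x : M) : Prop :=
  ∀ X Y : ∀ y : M, TangentSpace 𝓘(ℝ, E) y, AlmostQuaternionic.SmoothAt X x →
    AlmostQuaternionic.SmoothAt Y x → AlmostQuaternionic.SmoothAt (fun y ↦ G y (X y) (Y y)) x

instance (x : M) : T2Space (TangentSpace 𝓘(ℝ, E) x) := inferInstanceAs (T2Space E)

variable [FiniteDimensional ℝ E]

/-- The connection `∇_v Y + G(v, Y)`. -/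
def addForm (cov : Operator E M) (G : BilinearField E M) : Operator E M := fun Y x ↦
  cov Y x + ((G x).flip (Y x)).toContinuousLinearMap

omit [IsManifold 𝓘(ℝ, E) ∞ M] in
lemma addForm_apply (cov : Operator E M) (G : BilinearField E M)
    (Y : ∀ y : M, TangentSpace 𝓘(ℝ, E) y) (x : M) (v : TangentSpace 𝓘(ℝ, E) x) :
    addForm cov G Y x v = cov Y x v + G x v (Y x) := rfl

lemma _root_.IsCovariantDerivativeOn.addForm {cov : Operator E M} {G : BilinearField E M}
    {U : Set M} (h : IsCovariantDerivativeOn E cov U) :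
    IsCovariantDerivativeOn E (addForm cov G) U where
  add := by
    intro Y Y' x hY hY' hx
    ext v
    simp only [addForm_apply, h.add hY hY' hx, add_apply, Pi.add_apply, map_add]
    module
  leibniz := by
    intro Y g x hY hg hx
    ext v
    simp only [addForm_apply, h.leibniz hY hg hx, add_apply,
      smul_apply, Pi.smul_apply', map_smul]
    module

lemma IsSmoothConnectionOn.addForm {cov : Operator E M} {G : BilinearField E M}
    {U : Set M} (h : IsSmoothConnectionOn cov U) (hG : ∀ x ∈ U, G.SmoothAt x) :
    IsSmoothConnectionOn (addForm cov G) U :=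
  ⟨h.isCov.addForm, fun x hx Y Z hY hZ ↦
    ContMDiffAt.add_section (h.smoothAt x hx Y Z hY hZ) (hG x hx Z Y hZ hY)⟩

lemma Structure.CompatibleAt.addForm {Q : Structure E M} {cov : Operator E M}
    {G : BilinearField E M} {x : M} (h : Q.CompatibleAt cov x)
    (hG : ∀ v, ∀ F ∈ Q.fibre x, ∃ F' ∈ Q.fibre x, ∀ w, G x v (F w) - F (G x v w) = F' w) :
    Q.CompatibleAt (addForm cov G) x := by
  intro F hF hFQ v
  obtain ⟨F₁, h₁, h₁'⟩ := h F hF hFQ v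
  obtain ⟨F₂, h₂, h₂'⟩ := hG v (F x) hFQ.self_of_nhds
  refine ⟨F₁ + F₂, Submodule.add_mem _ h₁ h₂, fun Y hY ↦ ?_⟩
  rw [add_apply, ← h₁' Y hY, ← h₂', addForm_apply, addForm_apply, map_add]
  module

lemma IsTorsionAt.addForm {cov : Operator E M} {G : BilinearField E M} {x : M}
    {T : TangentSpace 𝓘(ℝ, E) x →ₗ[ℝ] TangentSpace 𝓘(ℝ, E) x →ₗ[ℝ] TangentSpace 𝓘(ℝ, E) x}
    (h : IsTorsionAt cov x T) : IsTorsionAt (addForm cov G) x (T + G x - (G x).flip) := by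
  intro X Y hX hY
  simp only [LinearMap.sub_apply, LinearMap.add_apply, LinearMap.flip_apply, addForm_apply,
    h X Y hX hY]
  module

lemma BilinearField.SmoothAt.trace_comp {G : BilinearField E M} {x : M} (hG : G.SmoothAt x)
    {A : ∀ x : M, TangentSpace 𝓘(ℝ, E) x →L[ℝ] TangentSpace 𝓘(ℝ, E) x}
    (hA : ContMDiffAt 𝓘(ℝ, E) (𝓘(ℝ, E).prod 𝓘(ℝ, E →L[ℝ] E)) ∞ (affinorSection A) x)
    {X : ∀ y : M, TangentSpace 𝓘(ℝ, E) y} (hX : AlmostQuaternionic.SmoothAt X x) :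
    ContMDiffAt 𝓘(ℝ, E) 𝓘(ℝ, ℝ) ∞ (fun y ↦ LinearMap.trace ℝ _
      ((A y : TangentSpace 𝓘(ℝ, E) y →ₗ[ℝ] TangentSpace 𝓘(ℝ, E) y) ∘ₗ (G y).flip (X y))) x :=
  contMDiffAt_trace fun Y hY ↦ SmoothAt.affinor hA (hG Y X hY hX)

end AddForm

/-! ### Hypercomplex frames -/

section Local

variable {E : Type*} [NormedAddCommGroup E] [NormedSpace ℝ E]
  {M : Type*} [TopologicalSpace M] [ChartedSpace E M] [IsManifold 𝓘(ℝ, E) ∞ M]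

/-- `(A, B, C)` is a smooth hypercomplex frame of `Q` over the set `U`. -/
structure Structure.IsFrameOn (Q : Structure E M)
    (A B C : ∀ x : M, TangentSpace 𝓘(ℝ, E) x →L[ℝ] TangentSpace 𝓘(ℝ, E) x) (U : Set M) :
    Prop where
  isOpen : IsOpen U
  smoothA : ∀ x ∈ U,
    ContMDiffAt 𝓘(ℝ, E) (𝓘(ℝ, E).prod 𝓘(ℝ, E →L[ℝ] E)) ∞ (affinorSection A) x
  smoothB : ∀ x ∈ U,
    ContMDiffAt 𝓘(ℝ, E) (𝓘(ℝ, E).prod 𝓘(ℝ, E →L[ℝ] E)) ∞ (affinorSection B) x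
  smoothC : ∀ x ∈ U,
    ContMDiffAt 𝓘(ℝ, E) (𝓘(ℝ, E).prod 𝓘(ℝ, E →L[ℝ] E)) ∞ (affinorSection C) x
  isHypercomplex : ∀ x ∈ U, IsHypercomplex (A x) (B x) (C x)
  fibre_eq : ∀ x ∈ U, Q.fibre x = Submodule.span ℝ
    {ContinuousLinearMap.id ℝ (TangentSpace 𝓘(ℝ, E) x), A x, B x, C x}

lemma Structure.exists_isFrameOn (Q : Structure E M) (x : M) :
    ∃ U, x ∈ U ∧ ∃ A B C, Q.IsFrameOn A B C U := by
  obtain ⟨U, hU, hx, A, B, C, hA, hB, hC, h⟩ := Q.locally_generated x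
  exact ⟨U, hx, A, B, C, hU, fun y hy ↦ (hA y hy).contMDiffAt (hU.mem_nhds hy),
    fun y hy ↦ (hB y hy).contMDiffAt (hU.mem_nhds hy),
    fun y hy ↦ (hC y hy).contMDiffAt (hU.mem_nhds hy), fun y hy ↦ (h y hy).1,
    fun y hy ↦ (h y hy).2⟩

namespace Structure.IsFrameOn

variable {Q : Structure E M} {U : Set M}
  {A B C : ∀ x : M, TangentSpace 𝓘(ℝ, E) x →L[ℝ] TangentSpace 𝓘(ℝ, E) x}

lemma mono (h : Q.IsFrameOn A B C U) {U' : Set M} (hU' : IsOpen U') (hs : U' ⊆ U) :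
    Q.IsFrameOn A B C U' :=
  ⟨hU', fun x hx ↦ h.smoothA x (hs hx), fun x hx ↦ h.smoothB x (hs hx),
    fun x hx ↦ h.smoothC x (hs hx), fun x hx ↦ h.isHypercomplex x (hs hx),
    fun x hx ↦ h.fibre_eq x (hs hx)⟩

lemma mem_fibre_iff (h : Q.IsFrameOn A B C U) {x : M} (hx : x ∈ U)
    {F : TangentSpace 𝓘(ℝ, E) x →L[ℝ] TangentSpace 𝓘(ℝ, E) x} : F ∈ Q.fibre x ↔
      IsQuaternion (A x : TangentSpace 𝓘(ℝ, E) x →ₗ[ℝ] TangentSpace 𝓘(ℝ, E) x)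
        (B x : TangentSpace 𝓘(ℝ, E) x →ₗ[ℝ] TangentSpace 𝓘(ℝ, E) x)
        (C x : TangentSpace 𝓘(ℝ, E) x →ₗ[ℝ] TangentSpace 𝓘(ℝ, E) x) F := by
  rw [h.fibre_eq x hx, mem_span_iff_isQuaternion]

lemma memA (h : Q.IsFrameOn A B C U) {x : M} (hx : x ∈ U) : A x ∈ Q.fibre x := by
  rw [h.fibre_eq x hx]
  exact Submodule.subset_span (by simp)

lemma memB (h : Q.IsFrameOn A B C U) {x : M} (hx : x ∈ U) : B x ∈ Q.fibre x := by
  rw [h.fibre_eq x hx]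
  exact Submodule.subset_span (by simp)

lemma memC (h : Q.IsFrameOn A B C U) {x : M} (hx : x ∈ U) : C x ∈ Q.fibre x := by
  rw [h.fibre_eq x hx]
  exact Submodule.subset_span (by simp)

/-- Normality with respect to the frame implies normality with respect to all hypercomplex
triples in `Q`. -/
lemma isNormal [FiniteDimensional ℝ E] (h : Q.IsFrameOn A B C U) {x : M} (hx : x ∈ U)
    {L : TangentSpace 𝓘(ℝ, E) x →ₗ[ℝ] TangentSpace 𝓘(ℝ, E) x}
    (hL : IsNormal (A x : TangentSpace 𝓘(ℝ, E) x →ₗ[ℝ] TangentSpace 𝓘(ℝ, E) x)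
      (B x : TangentSpace 𝓘(ℝ, E) x →ₗ[ℝ] TangentSpace 𝓘(ℝ, E) x)
      (C x : TangentSpace 𝓘(ℝ, E) x →ₗ[ℝ] TangentSpace 𝓘(ℝ, E) x) L)
    {A' B' C' : TangentSpace 𝓘(ℝ, E) x →L[ℝ] TangentSpace 𝓘(ℝ, E) x}
    (hA : A' ∈ Q.fibre x) (hB : B' ∈ Q.fibre x) (hC : C' ∈ Q.fibre x)
    (h' : IsHypercomplex A' B' C') :
    IsNormal (A' : TangentSpace 𝓘(ℝ, E) x →ₗ[ℝ] TangentSpace 𝓘(ℝ, E) x)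
      (B' : TangentSpace 𝓘(ℝ, E) x →ₗ[ℝ] TangentSpace 𝓘(ℝ, E) x)
      (C' : TangentSpace 𝓘(ℝ, E) x →ₗ[ℝ] TangentSpace 𝓘(ℝ, E) x) L := by
  have hle : Submodule.span ℝ {ContinuousLinearMap.id ℝ (TangentSpace 𝓘(ℝ, E) x), A', B', C'} ≤
      Submodule.span ℝ {ContinuousLinearMap.id ℝ (TangentSpace 𝓘(ℝ, E) x), A x, B x, C x} := by
    rw [Submodule.span_le, ← h.fibre_eq x hx]
    rintro F (rfl | rfl | rfl | rfl)
    · rw [h.fibre_eq x hx]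
      exact Submodule.subset_span (by simp)
    · exact hA
    · exact hB
    · exact hC
  have heq := h'.span_eq_of_le (h.isHypercomplex x hx) hle
  refine (h.isHypercomplex x hx).rel.isNormal_of_span h'.rel
    ((h.mem_fibre_iff hx).1 hA) ((h.mem_fibre_iff hx).1 hB) ((h.mem_fibre_iff hx).1 hC)
    ?_ ?_ ?_ hL
  · refine mem_span_iff_isQuaternion.1 ?_
    rw [heq, ← h.fibre_eq x hx]
    exact h.memA hx
  · refine mem_span_iff_isQuaternion.1 ?_
    rw [heq, ← h.fibre_eq x hx]
    exact h.memB hx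
  · refine mem_span_iff_isQuaternion.1 ?_
    rw [heq, ← h.fibre_eq x hx]
    exact h.memC hx

/-- A smooth section of `Q` is a combination of the frame with smooth coefficients. -/
lemma exists_coefficients [FiniteDimensional ℝ E] (h : Q.IsFrameOn A B C U)
    (hd : 0 < Module.finrank ℝ E) {x : M} (hx : x ∈ U)
    {F : ∀ y : M, TangentSpace 𝓘(ℝ, E) y →L[ℝ] TangentSpace 𝓘(ℝ, E) y}
    (hF : ContMDiffAt 𝓘(ℝ, E) (𝓘(ℝ, E).prod 𝓘(ℝ, E →L[ℝ] E)) ∞ (affinorSection F) x)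
    (hFQ : ∀ᶠ y in 𝓝 x, F y ∈ Q.fibre y) :
    ∃ p q r s : M → ℝ, ContMDiffAt 𝓘(ℝ, E) 𝓘(ℝ, ℝ) ∞ p x ∧ ContMDiffAt 𝓘(ℝ, E) 𝓘(ℝ, ℝ) ∞ q x ∧
      ContMDiffAt 𝓘(ℝ, E) 𝓘(ℝ, ℝ) ∞ r x ∧ ContMDiffAt 𝓘(ℝ, E) 𝓘(ℝ, ℝ) ∞ s x ∧
      ∀ᶠ y in 𝓝 x, ∀ v, F y v = p y • v + q y • A y v + r y • B y v + s y • C y v := by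
  -- the coefficients are `trace F / d`, `-trace (A F) / d`, `-trace (B F) / d`, `-trace (C F) / d`
  have key : ∀ D : ∀ y : M, TangentSpace 𝓘(ℝ, E) y →L[ℝ] TangentSpace 𝓘(ℝ, E) y,
      ContMDiffAt 𝓘(ℝ, E) (𝓘(ℝ, E).prod 𝓘(ℝ, E →L[ℝ] E)) ∞ (affinorSection D) x → ∀ k : ℝ,
      ContMDiffAt 𝓘(ℝ, E) 𝓘(ℝ, ℝ) ∞ (fun y ↦ k * LinearMap.trace ℝ _
        ((D y : TangentSpace 𝓘(ℝ, E) y →ₗ[ℝ] TangentSpace 𝓘(ℝ, E) y) ∘ₗ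
        (F y : TangentSpace 𝓘(ℝ, E) y →ₗ[ℝ] TangentSpace 𝓘(ℝ, E) y))) x := fun D hD k ↦
    contMDiffAt_const.mul (contMDiffAt_trace fun Y hY ↦
      SmoothAt.affinor hD (SmoothAt.affinor hF hY))
  have hid : ContMDiffAt 𝓘(ℝ, E) (𝓘(ℝ, E).prod 𝓘(ℝ, E →L[ℝ] E)) ∞ (affinorSection
      fun y : M ↦ ContinuousLinearMap.id ℝ (TangentSpace 𝓘(ℝ, E) y)) x :=
    contMDiffAt_affinor fun Y hY ↦ hY
  set d : ℝ := (Module.finrank ℝ E : ℝ) with hdef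
  have hd' : d ≠ 0 := by positivity
  refine ⟨_, _, _, _, key _ hid d⁻¹, key A (h.smoothA x hx) (-d⁻¹),
    key B (h.smoothB x hx) (-d⁻¹), key C (h.smoothC x hx) (-d⁻¹), ?_⟩
  filter_upwards [hFQ, h.isOpen.mem_nhds hx] with y hy hyU v
  obtain ⟨p, q, r, s, hF'⟩ := (h.mem_fibre_iff hyU).1 hy
  have hr := (h.isHypercomplex y hyU).rel
  set a : TangentSpace 𝓘(ℝ, E) y →ₗ[ℝ] TangentSpace 𝓘(ℝ, E) y :=
    (A y : TangentSpace 𝓘(ℝ, E) y →ₗ[ℝ] TangentSpace 𝓘(ℝ, E) y)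
  set b : TangentSpace 𝓘(ℝ, E) y →ₗ[ℝ] TangentSpace 𝓘(ℝ, E) y :=
    (B y : TangentSpace 𝓘(ℝ, E) y →ₗ[ℝ] TangentSpace 𝓘(ℝ, E) y)
  set c : TangentSpace 𝓘(ℝ, E) y →ₗ[ℝ] TangentSpace 𝓘(ℝ, E) y :=
    (C y : TangentSpace 𝓘(ℝ, E) y →ₗ[ℝ] TangentSpace 𝓘(ℝ, E) y)
  set f : TangentSpace 𝓘(ℝ, E) y →ₗ[ℝ] TangentSpace 𝓘(ℝ, E) y :=
    (F y : TangentSpace 𝓘(ℝ, E) y →ₗ[ℝ] TangentSpace 𝓘(ℝ, E) y) with hf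
  have hFv : ∀ w, f w = p • w + q • a w + r • b w + s • c w := hF'
  obtain ⟨ta, tb, tc⟩ := hr.trace_eq_zero
  have tid : LinearMap.trace ℝ (TangentSpace 𝓘(ℝ, E) y) LinearMap.id = d :=
    LinearMap.trace_id ℝ (TangentSpace 𝓘(ℝ, E) y)
  have e1 : (ContinuousLinearMap.id ℝ (TangentSpace 𝓘(ℝ, E) y) :
      TangentSpace 𝓘(ℝ, E) y →ₗ[ℝ] TangentSpace 𝓘(ℝ, E) y) ∘ₗ f =
      p • LinearMap.id + q • a + r • b + s • c := by
    ext w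
    exact hFv w
  have e2 : a ∘ₗ f = (-q) • LinearMap.id + p • a + (-s) • b + r • c := by
    ext w
    simp only [LinearMap.comp_apply, hFv, map_add, map_smul, hr.aa, hr.ab, hr.ac,
      LinearMap.add_apply, LinearMap.smul_apply, LinearMap.id_apply]
    module
  have e3 : b ∘ₗ f = (-r) • LinearMap.id + s • a + p • b + (-q) • c := by
    ext w
    simp only [LinearMap.comp_apply, hFv, map_add, map_smul, hr.bb, hr.ba, hr.bc,
      LinearMap.add_apply, LinearMap.smul_apply, LinearMap.id_apply]
    module
  have e4 : c ∘ₗ f = (-s) • LinearMap.id + (-r) • a + q • b + p • c := by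
    ext w
    simp only [LinearMap.comp_apply, hFv, map_add, map_smul, hr.cc, hr.cb, hr.ca,
      LinearMap.add_apply, LinearMap.smul_apply, LinearMap.id_apply]
    module
  rw [e1, e2, e3, e4]
  simp only [map_add, map_smul, ta, tb, tc, tid, smul_eq_mul, mul_zero, add_zero]
  have hx1 : ∀ t : ℝ, d⁻¹ * (t * d) = t := fun t ↦ by field_simp
  have hx2 : ∀ t : ℝ, -d⁻¹ * (-t * d) = t := fun t ↦ by field_simp
  rw [hx1, hx2, hx2, hx2]
  exact hFv v

end Structure.IsFrameOn

end Local

/-! ### Connections with parallel hypercomplex frame -/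

section LocalWeyl

variable {E : Type*} [NormedAddCommGroup E] [NormedSpace ℝ E]
  {M : Type*} [TopologicalSpace M] [ChartedSpace E M] [IsManifold 𝓘(ℝ, E) ∞ M]

/-- The average of the connection `cov` over the conjugates by `1, A, B, C`. If `(A, B, C)` is
hypercomplex, then `A`, `B`, `C` are parallel for this connection. -/
def averagedConnection (A B C : ∀ x : M, TangentSpace 𝓘(ℝ, E) x →L[ℝ] TangentSpace 𝓘(ℝ, E) x)
    (cov : Operator E M) : Operator E M := fun Y x ↦
  (1 / 4 : ℝ) • (cov Y x - A x ∘L cov (fun y ↦ A y (Y y)) x - B x ∘L cov (fun y ↦ B y (Y y)) x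
    - C x ∘L cov (fun y ↦ C y (Y y)) x)

variable {Q : Structure E M} {U : Set M} {cov : Operator E M}
  {A B C : ∀ x : M, TangentSpace 𝓘(ℝ, E) x →L[ℝ] TangentSpace 𝓘(ℝ, E) x}

omit [IsManifold 𝓘(ℝ, E) ∞ M] in
lemma averagedConnection_apply (Y : ∀ x : M, TangentSpace 𝓘(ℝ, E) x) (x : M)
    (v : TangentSpace 𝓘(ℝ, E) x) : averagedConnection A B C cov Y x v =
      (1 / 4 : ℝ) • (cov Y x v - A x (cov (fun y ↦ A y (Y y)) x v)
        - B x (cov (fun y ↦ B y (Y y)) x v) - C x (cov (fun y ↦ C y (Y y)) x v)) := rfl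

lemma mdifferentiableAt_affinor {x : M}
    (hA : ContMDiffAt 𝓘(ℝ, E) (𝓘(ℝ, E).prod 𝓘(ℝ, E →L[ℝ] E)) ∞ (affinorSection A) x)
    {Y : ∀ x : M, TangentSpace 𝓘(ℝ, E) x} (hY : MDiffAt (T% Y) x) :
    MDiffAt (T% fun y ↦ A y (Y y)) x :=
  MDifferentiableAt.clm_bundle_apply (b := id) (hA.mdifferentiableAt (by simp)) hY

lemma _root_.IsCovariantDerivativeOn.neg_section (h : IsCovariantDerivativeOn E cov U) {x : M}
    (hx : x ∈ U) {Y : ∀ x : M, TangentSpace 𝓘(ℝ, E) x} (hY : MDiffAt (T% Y) x) :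
    cov (fun y ↦ -Y y) x = -cov Y x := by
  have h1 := h.smul_const (-1) hY hx
  rw [neg_one_smul, neg_one_smul] at h1
  exact h1

namespace Structure.IsFrameOn

lemma averaged_isCov (h : Q.IsFrameOn A B C U) (hcov : IsCovariantDerivativeOn E cov U) :
    IsCovariantDerivativeOn E (averagedConnection A B C cov) U where
  add := by
    intro Y Y' x hY hY' hx
    have key : ∀ D : ∀ x : M, TangentSpace 𝓘(ℝ, E) x →L[ℝ] TangentSpace 𝓘(ℝ, E) x,
        ContMDiffAt 𝓘(ℝ, E) (𝓘(ℝ, E).prod 𝓘(ℝ, E →L[ℝ] E)) ∞ (affinorSection D) x →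
        cov (fun y ↦ D y ((Y + Y') y)) x =
          cov (fun y ↦ D y (Y y)) x + cov (fun y ↦ D y (Y' y)) x := by
      intro D hD
      rw [← hcov.add (mdifferentiableAt_affinor hD hY) (mdifferentiableAt_affinor hD hY') hx]
      congr
      ext y
      simp
    ext v
    simp only [averagedConnection_apply, key A (h.smoothA x hx), key B (h.smoothB x hx),
      key C (h.smoothC x hx), hcov.add hY hY' hx, add_apply, map_add]
    module
  leibniz := by
    intro Y g x hY hg hx
    have key : ∀ D : ∀ x : M, TangentSpace 𝓘(ℝ, E) x →L[ℝ] TangentSpace 𝓘(ℝ, E) x,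
        ContMDiffAt 𝓘(ℝ, E) (𝓘(ℝ, E).prod 𝓘(ℝ, E →L[ℝ] E)) ∞ (affinorSection D) x →
        cov (fun y ↦ D y ((g • Y) y)) x = g x • cov (fun y ↦ D y (Y y)) x
          + (mvfderiv 𝓘(ℝ, E) g x).smulRight (D x (Y x)) := by
      intro D hD
      rw [← hcov.leibniz (mdifferentiableAt_affinor hD hY) hg hx]
      congr
      ext y
      simp
    have hr := (h.isHypercomplex x hx).rel
    have haa : A x (A x (Y x)) = - Y x := hr.aa _
    have hbb : B x (B x (Y x)) = - Y x := hr.bb _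
    have hcc : C x (C x (Y x)) = - Y x := hr.cc _
    ext v
    simp only [averagedConnection_apply, key A (h.smoothA x hx), key B (h.smoothB x hx),
      key C (h.smoothC x hx), hcov.leibniz hY hg hx, add_apply, map_add, smul_apply, map_smul,
      ContinuousLinearMap.smulRight_apply, haa, hbb, hcc]
    module

lemma averaged_isSmooth (h : Q.IsFrameOn A B C U) (hcov : IsSmoothConnectionOn cov U) :
    IsSmoothConnectionOn (averagedConnection A B C cov) U := by
  refine ⟨h.averaged_isCov hcov.isCov, fun x hx Y Z hY hZ ↦ ?_⟩
  have key : ∀ D : ∀ x : M, TangentSpace 𝓘(ℝ, E) x →L[ℝ] TangentSpace 𝓘(ℝ, E) x,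
      ContMDiffAt 𝓘(ℝ, E) (𝓘(ℝ, E).prod 𝓘(ℝ, E →L[ℝ] E)) ∞ (affinorSection D) x →
      SmoothAt (fun y ↦ D y (cov (fun y ↦ D y (Y y)) y (Z y))) x := fun D hD ↦
    SmoothAt.affinor hD (hcov.smoothAt x hx _ _ (SmoothAt.affinor hD hY) hZ)
  exact ContMDiffAt.const_smul_section (ContMDiffAt.sub_section (ContMDiffAt.sub_section
    (ContMDiffAt.sub_section (hcov.smoothAt x hx Y Z hY hZ) (key A (h.smoothA x hx)))
    (key B (h.smoothB x hx))) (key C (h.smoothC x hx)))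

/-- The frame is parallel for the averaged connection. -/
lemma averaged_parallel (h : Q.IsFrameOn A B C U) (hcov : IsCovariantDerivativeOn E cov U)
    {x : M} (hx : x ∈ U) {Y : ∀ x : M, TangentSpace 𝓘(ℝ, E) x} (hY : MDiffAt (T% Y) x)
    (v : TangentSpace 𝓘(ℝ, E) x) :
    averagedConnection A B C cov (fun y ↦ A y (Y y)) x v =
      A x (averagedConnection A B C cov Y x v) ∧
    averagedConnection A B C cov (fun y ↦ B y (Y y)) x v =
      B x (averagedConnection A B C cov Y x v) ∧
    averagedConnection A B C cov (fun y ↦ C y (Y y)) x v =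
      C x (averagedConnection A B C cov Y x v) := by
  have hA := mdifferentiableAt_affinor (h.smoothA x hx) hY
  have hB := mdifferentiableAt_affinor (h.smoothB x hx) hY
  have hC := mdifferentiableAt_affinor (h.smoothC x hx) hY
  have hU := h.isOpen.mem_nhds hx
  -- composing two of the structures is, up to sign, applying the third one
  have hpos : ∀ D₁ D₂ D₃ : ∀ x : M, TangentSpace 𝓘(ℝ, E) x →L[ℝ] TangentSpace 𝓘(ℝ, E) x,
      MDiffAt (T% fun y ↦ D₃ y (Y y)) x → (∀ y ∈ U, D₁ y (D₂ y (Y y)) = D₃ y (Y y)) →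
      cov (fun y ↦ D₁ y (D₂ y (Y y))) x v = cov (fun y ↦ D₃ y (Y y)) x v := by
    intro D₁ D₂ D₃ h₃ heq
    have hev : ∀ᶠ y in 𝓝 x, D₁ y (D₂ y (Y y)) = D₃ y (Y y) := Filter.eventually_of_mem hU heq
    rw [hcov.congr_of_eventuallyEq (h₃.congr_of_eventuallyEq
      (hev.mono fun y hy ↦ by simp [hy])) h₃ hU hev]
  have hneg : ∀ D₁ D₂ D₃ : ∀ x : M, TangentSpace 𝓘(ℝ, E) x →L[ℝ] TangentSpace 𝓘(ℝ, E) x,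
      MDiffAt (T% fun y ↦ D₃ y (Y y)) x → (∀ y ∈ U, D₁ y (D₂ y (Y y)) = -D₃ y (Y y)) →
      cov (fun y ↦ D₁ y (D₂ y (Y y))) x v = -cov (fun y ↦ D₃ y (Y y)) x v := by
    intro D₁ D₂ D₃ h₃ heq
    have hev : ∀ᶠ y in 𝓝 x, D₁ y (D₂ y (Y y)) = -D₃ y (Y y) := Filter.eventually_of_mem hU heq
    have h₃' : MDiffAt (T% fun y ↦ -D₃ y (Y y)) x := mdifferentiableAt_neg_section h₃
    rw [hcov.congr_of_eventuallyEq (h₃'.congr_of_eventuallyEq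
      (hev.mono fun y hy ↦ by simp [hy])) h₃' hU hev, hcov.neg_section hx h₃]
    rfl
  have hrel := fun y hy ↦ (h.isHypercomplex y hy).rel
  have haa := hneg A A (fun y ↦ ContinuousLinearMap.id ℝ _) hY fun y hy ↦ (hrel y hy).aa _
  have hbb := hneg B B (fun y ↦ ContinuousLinearMap.id ℝ _) hY fun y hy ↦ (hrel y hy).bb _
  have hcc := hneg C C (fun y ↦ ContinuousLinearMap.id ℝ _) hY fun y hy ↦ (hrel y hy).cc _
  have hab := hpos A B C hC fun y hy ↦ (hrel y hy).ab _
  have hba := hneg B A C hC fun y hy ↦ (hrel y hy).ba _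
  have hbc := hpos B C A hA fun y hy ↦ (hrel y hy).bc _
  have hcb := hneg C B A hA fun y hy ↦ (hrel y hy).cb _
  have hca := hpos C A B hB fun y hy ↦ (hrel y hy).ca _
  have hac := hneg A C B hB fun y hy ↦ (hrel y hy).ac _
  simp only [ContinuousLinearMap.id_apply] at haa hbb hcc
  have haa' : ∀ w, A x (A x w) = -w := (hrel x hx).aa
  have hbb' : ∀ w, B x (B x w) = -w := (hrel x hx).bb
  have hcc' : ∀ w, C x (C x w) = -w := (hrel x hx).cc
  have hab' : ∀ w, A x (B x w) = C x w := (hrel x hx).ab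
  have hba' : ∀ w, B x (A x w) = -C x w := (hrel x hx).ba
  have hbc' : ∀ w, B x (C x w) = A x w := (hrel x hx).bc
  have hcb' : ∀ w, C x (B x w) = -A x w := (hrel x hx).cb
  have hca' : ∀ w, C x (A x w) = B x w := (hrel x hx).ca
  have hac' : ∀ w, A x (C x w) = -B x w := (hrel x hx).ac
  simp only [averagedConnection_apply, haa, hbb, hcc, hab, hba, hbc, hcb, hca, hac, map_smul,
    map_sub, map_neg, haa', hbb', hcc', hab', hba', hbc', hcb', hca', hac']
  refine ⟨?_, ?_, ?_⟩ <;> module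

/-- A connection for which the frame is parallel preserves `Q`. -/
lemma compatibleAt [FiniteDimensional ℝ E] (h : Q.IsFrameOn A B C U)
    (hd : 0 < Module.finrank ℝ E) (hcov : IsCovariantDerivativeOn E cov U) {x : M} (hx : x ∈ U)
    (hpar : ∀ Y : ∀ x : M, TangentSpace 𝓘(ℝ, E) x, MDiffAt (T% Y) x → ∀ v,
      cov (fun y ↦ A y (Y y)) x v = A x (cov Y x v) ∧
      cov (fun y ↦ B y (Y y)) x v = B x (cov Y x v) ∧
      cov (fun y ↦ C y (Y y)) x v = C x (cov Y x v)) : Q.CompatibleAt cov x := by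
  intro F hF hFQ v
  obtain ⟨p, q, r, s, hp, hq, hr, hs, hev⟩ := h.exists_coefficients hd hx hF hFQ
  have hp' := hp.mdifferentiableAt (by simp)
  have hq' := hq.mdifferentiableAt (by simp)
  have hr' := hr.mdifferentiableAt (by simp)
  have hs' := hs.mdifferentiableAt (by simp)
  refine ⟨mvfderiv 𝓘(ℝ, E) p x v • ContinuousLinearMap.id ℝ _ + mvfderiv 𝓘(ℝ, E) q x v • A x
    + mvfderiv 𝓘(ℝ, E) r x v • B x + mvfderiv 𝓘(ℝ, E) s x v • C x, ?_, fun Y hY ↦ ?_⟩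
  · rw [h.mem_fibre_iff hx]
    exact ⟨_, _, _, _, fun w ↦ rfl⟩
  have hY' := hY.mdifferentiableAt
  have hA := mdifferentiableAt_affinor (h.smoothA x hx) hY'
  have hB := mdifferentiableAt_affinor (h.smoothB x hx) hY'
  have hC := mdifferentiableAt_affinor (h.smoothC x hx) hY'
  have h0 := hp'.smul_section hY'
  have h1 := hq'.smul_section hA
  have h2 := hr'.smul_section hB
  have h3 := hs'.smul_section hC
  have h01 := mdifferentiableAt_add_section h0 h1
  have h012 := mdifferentiableAt_add_section h01 h2
  have h0123 := mdifferentiableAt_add_section h012 h3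
  have e1 : cov (fun y ↦ F y (Y y)) x = cov (p • Y + q • (fun y ↦ A y (Y y)) +
      r • (fun y ↦ B y (Y y)) + s • fun y ↦ C y (Y y)) x := by
    refine hcov.congr_of_eventuallyEq (SmoothAt.affinor hF hY).mdifferentiableAt h0123
      (h.isOpen.mem_nhds hx) ?_
    filter_upwards [hev] with y hy using hy _
  obtain ⟨pA, pB, pC⟩ := hpar Y hY' v
  rw [e1, hcov.add h012 h3 hx, hcov.add h01 h2 hx, hcov.add h0 h1 hx, hcov.leibniz hY' hp' hx,
    hcov.leibniz hA hq' hx, hcov.leibniz hB hr' hx, hcov.leibniz hC hs' hx, hev.self_of_nhds]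
  simp only [add_apply, smul_apply, ContinuousLinearMap.smulRight_apply, pA, pB, pC,
    ContinuousLinearMap.id_apply]
  module

end Structure.IsFrameOn

end LocalWeyl

/-! ### The bracket as a one-form, and the existence of Weyl connections -/

section Bracket

variable {V : Type*} [AddCommGroup V] [Module ℝ V] [TopologicalSpace V]
  [IsTopologicalAddGroup V] [ContinuousSMul ℝ V]

/-- The algebraic bracket with a fixed covector, as a bilinear map. -/
def bracketForm (A B C : V →L[ℝ] V) (η : Module.Dual ℝ V) : V →ₗ[ℝ] V →ₗ[ℝ] V :=
  LinearMap.mk₂ ℝ (fun X W ↦ bracket A B C X η W)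
    (by intros; simp only [bracket, map_add]; module)
    (by intros; simp only [bracket, map_smul, smul_eq_mul]; module)
    (by intros; simp only [bracket, map_add]; module)
    (by intros; simp only [bracket, map_smul, smul_eq_mul]; module)

omit [IsTopologicalAddGroup V] [ContinuousSMul ℝ V] in
lemma bracketForm_apply (A B C : V →L[ℝ] V) (η : Module.Dual ℝ V) (X W : V) :
    bracketForm A B C η X W = bracket A B C X η W := rfl

omit [IsTopologicalAddGroup V] [ContinuousSMul ℝ V] in
lemma bracketForm_flip (A B C : V →L[ℝ] V) (η : Module.Dual ℝ V) :
    (bracketForm A B C η).flip = bracketForm A B C η := by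
  ext X W
  simp only [LinearMap.flip_apply, bracketForm_apply, bracket]
  module

omit [ContinuousSMul ℝ V] in
/-- The bracket `{X, η}` is the sum of a quaternion and of a quaternionic linear map; hence it
normalizes the quaternions. -/
lemma IsHypercomplex.isQuaternion_bracket_commutator {A B C : V →L[ℝ] V}
    (h : IsHypercomplex A B C) (η : Module.Dual ℝ V) (X : V) {F : V →L[ℝ] V}
    (hF : IsQuaternion (A : V →ₗ[ℝ] V) (B : V →ₗ[ℝ] V) (C : V →ₗ[ℝ] V) F) :
    IsQuaternion (A : V →ₗ[ℝ] V) (B : V →ₗ[ℝ] V) (C : V →ₗ[ℝ] V)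
      (fun W ↦ bracket A B C X η (F W) - F (bracket A B C X η W)) := by
  set a : V →ₗ[ℝ] V := (A : V →ₗ[ℝ] V) with ha
  set b : V →ₗ[ℝ] V := (B : V →ₗ[ℝ] V) with hb
  set c : V →ₗ[ℝ] V := (C : V →ₗ[ℝ] V) with hc
  set N : V → V := fun W ↦ η X • W + (-η (A X)) • a W + (-η (B X)) • b W + (-η (C X)) • c W
    with hN
  have hNq : IsQuaternion a b c N := ⟨_, _, _, _, fun W ↦ rfl⟩
  set L : V →ₗ[ℝ] V := linearPart a b c (η.smulRight X) with hL
  have hLF : ∀ W, L (F W) = F (L W) := by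
    obtain ⟨p, q, r, s, hF'⟩ := hF
    intro W
    obtain ⟨h1, h2, h3⟩ := h.rel.linearPart_comm (η.smulRight X) W
    rw [← hL] at h1 h2 h3
    simp only [hF', map_add, map_smul]
    exact congrArg₂ _ (congrArg₂ _ (congrArg₂ _ rfl (congrArg _ h1)) (congrArg _ h2))
      (congrArg _ h3)
  have hbr : ∀ W, bracket A B C X η W = N W + L W := by
    intro W
    simp only [hN, hL, linearPart_apply, LinearMap.smulRight_apply, map_smul, bracket, ha, hb, hc,
      ContinuousLinearMap.coe_coe]
    module
  have h1 := (hNq.comp h.rel hF).sub (hF.comp h.rel hNq)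
  have h2 : (fun W ↦ bracket A B C X η (F W) - F (bracket A B C X η W)) =
      fun W ↦ N (F W) - F (N W) := by
    funext W
    simp only [hbr, hLF, map_add]
    module
  rw [h2]
  exact h1

end Bracket

section Existence

lemma isQuaternion_smul_add {V : Type*} [AddCommGroup V] [Module ℝ V] (a b c : V →ₗ[ℝ] V)
    (k p q r : ℝ) : IsQuaternion a b c ⇑(k • (p • a + q • b + r • c)) :=
  ⟨0, k * p, k * q, k * r, fun w ↦ by
    simp only [LinearMap.smul_apply, LinearMap.add_apply]
    module⟩

variable {E : Type*} [NormedAddCommGroup E] [NormedSpace ℝ E]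
  {M : Type*} [TopologicalSpace M] [ChartedSpace E M] [IsManifold 𝓘(ℝ, E) ∞ M]
  {Q : Structure E M} {U : Set M} {cov : Operator E M}
  {A B C : ∀ x : M, TangentSpace 𝓘(ℝ, E) x →L[ℝ] TangentSpace 𝓘(ℝ, E) x}

lemma IsSmoothConnectionOn.torsion_smoothAt [CompleteSpace E] (h : IsSmoothConnectionOn cov U)
    (hU : IsOpen U) {T : BilinearField E M} (hT : ∀ x ∈ U, IsTorsionAt cov x (T x)) {x : M}
    (hx : x ∈ U) : T.SmoothAt x := by
  intro X Y hX hY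
  have : IsManifold 𝓘(ℝ, E) (minSmoothness ℝ 2) M := by
    rw [minSmoothness_of_isRCLikeNormedField]
    infer_instance
  have : IsManifold 𝓘(ℝ, E) (((⊤ : ℕ∞) : WithTop ℕ∞) + 1) M :=
    inferInstanceAs (IsManifold 𝓘(ℝ, E) ∞ M)
  have h1 : SmoothAt (fun y ↦ cov Y y (X y) - cov X y (Y y)
      - VectorField.mlieBracket 𝓘(ℝ, E) X Y y) x :=
    ContMDiffAt.sub_section (ContMDiffAt.sub_section (h.smoothAt x hx Y X hY hX)
      (h.smoothAt x hx X Y hX hY)) (ContMDiffAt.mlieBracket_vectorField (m := ⊤) (n := ⊤) hX hY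
        (by simp))
  refine h1.congr ?_
  filter_upwards [hU.mem_nhds hx, hX.eventually_mdifferentiableAt,
    hY.eventually_mdifferentiableAt] with y hy hXy hyY using hT y hy X Y hXy hyY

namespace Structure.IsFrameOn

lemma exists_mem_fibre (h : Q.IsFrameOn A B C U) {x : M} (hx : x ∈ U)
    {f : TangentSpace 𝓘(ℝ, E) x → TangentSpace 𝓘(ℝ, E) x}
    (hf : IsQuaternion (A x : TangentSpace 𝓘(ℝ, E) x →ₗ[ℝ] TangentSpace 𝓘(ℝ, E) x)
        (B x : TangentSpace 𝓘(ℝ, E) x →ₗ[ℝ] TangentSpace 𝓘(ℝ, E) x)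
        (C x : TangentSpace 𝓘(ℝ, E) x →ₗ[ℝ] TangentSpace 𝓘(ℝ, E) x) f) :
    ∃ F ∈ Q.fibre x, ∀ w, f w = F w := by
  obtain ⟨p, q, r, s, hf⟩ := hf
  exact ⟨p • ContinuousLinearMap.id ℝ _ + q • A x + r • B x + s • C x,
    (h.mem_fibre_iff hx).2 ⟨p, q, r, s, fun w ↦ rfl⟩, hf⟩

lemma smoothAt_torsionLinearPart (h : Q.IsFrameOn A B C U) {x : M} (hx : x ∈ U)
    {T : BilinearField E M} (hT : T.SmoothAt x) :
    BilinearField.SmoothAt (fun y ↦ torsionLinearPart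
      (A y : TangentSpace 𝓘(ℝ, E) y →ₗ[ℝ] TangentSpace 𝓘(ℝ, E) y)
      (B y : TangentSpace 𝓘(ℝ, E) y →ₗ[ℝ] TangentSpace 𝓘(ℝ, E) y)
      (C y : TangentSpace 𝓘(ℝ, E) y →ₗ[ℝ] TangentSpace 𝓘(ℝ, E) y) (T y)) x := by
  intro X W hX hW
  have key : ∀ D : ∀ x : M, TangentSpace 𝓘(ℝ, E) x →L[ℝ] TangentSpace 𝓘(ℝ, E) x,
      ContMDiffAt 𝓘(ℝ, E) (𝓘(ℝ, E).prod 𝓘(ℝ, E →L[ℝ] E)) ∞ (affinorSection D) x →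
      SmoothAt (fun y ↦ D y (T y (D y (W y)) (X y))) x := fun D hD ↦
    SmoothAt.affinor hD (hT _ _ (SmoothAt.affinor hD hW) hX)
  simp only [torsionLinearPart_apply]
  exact ContMDiffAt.sub_section (ContMDiffAt.sub_section (ContMDiffAt.sub_section (hT W X hW hX)
    (key A (h.smoothA x hx))) (key B (h.smoothB x hx))) (key C (h.smoothC x hx))

lemma smoothAt_linearCorrection (h : Q.IsFrameOn A B C U) {x : M} (hx : x ∈ U)
    {T : BilinearField E M} (hT : T.SmoothAt x) :
    BilinearField.SmoothAt (fun y ↦ linearCorrection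
      (A y : TangentSpace 𝓘(ℝ, E) y →ₗ[ℝ] TangentSpace 𝓘(ℝ, E) y)
      (B y : TangentSpace 𝓘(ℝ, E) y →ₗ[ℝ] TangentSpace 𝓘(ℝ, E) y)
      (C y : TangentSpace 𝓘(ℝ, E) y →ₗ[ℝ] TangentSpace 𝓘(ℝ, E) y) (T y)) x := by
  have h1 := h.smoothAt_torsionLinearPart hx hT
  have h2 := h.smoothAt_torsionLinearPart hx h1
  intro X W hX hW
  exact ContMDiffAt.const_smul_section (ContMDiffAt.add_section (h2 X W hX hW)
    (ContMDiffAt.const_smul_section (h1 X W hX hW)))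

lemma smoothAt_traceCorrection [FiniteDimensional ℝ E] (h : Q.IsFrameOn A B C U) {x : M}
    (hx : x ∈ U) {T : BilinearField E M} (hT : T.SmoothAt x) :
    BilinearField.SmoothAt (fun y ↦ traceCorrection
      (A y : TangentSpace 𝓘(ℝ, E) y →ₗ[ℝ] TangentSpace 𝓘(ℝ, E) y)
      (B y : TangentSpace 𝓘(ℝ, E) y →ₗ[ℝ] TangentSpace 𝓘(ℝ, E) y)
      (C y : TangentSpace 𝓘(ℝ, E) y →ₗ[ℝ] TangentSpace 𝓘(ℝ, E) y) (T y)) x := by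
  intro X W hX hW
  have key : ∀ D : ∀ x : M, TangentSpace 𝓘(ℝ, E) x →L[ℝ] TangentSpace 𝓘(ℝ, E) x,
      ContMDiffAt 𝓘(ℝ, E) (𝓘(ℝ, E).prod 𝓘(ℝ, E →L[ℝ] E)) ∞ (affinorSection D) x →
      SmoothAt (fun y ↦ LinearMap.trace ℝ _
        ((D y : TangentSpace 𝓘(ℝ, E) y →ₗ[ℝ] TangentSpace 𝓘(ℝ, E) y) ∘ₗ (T y).flip (X y))
          • D y (W y)) x := fun D hD ↦
    ContMDiffAt.smul_section (hT.trace_comp hD hX) (SmoothAt.affinor hD hW)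
  simp only [traceCorrection_apply]
  exact SmoothAt.congr (ContMDiffAt.const_smul_section (a := -((Module.finrank ℝ E : ℝ) - 2)⁻¹)
    (ContMDiffAt.add_section (ContMDiffAt.add_section (key A (h.smoothA x hx))
      (key B (h.smoothB x hx))) (key C (h.smoothC x hx)))) (.of_forall fun y ↦ rfl)

end Structure.IsFrameOn

variable [FiniteDimensional ℝ E] [CompleteSpace E]

lemma _root_.IsCovariantDerivativeOn.exists_torsion (h : IsCovariantDerivativeOn E cov U) :
    ∃ T : BilinearField E M, ∀ x ∈ U, IsTorsionAt cov x (T x) := by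
  have h1 : ∀ x, ∃ T, x ∈ U → IsTorsionAt cov x T := by
    intro x
    by_cases hx : x ∈ U
    · obtain ⟨T, hT⟩ := h.exists_isTorsionAt hx
      exact ⟨T, fun _ ↦ hT⟩
    · exact ⟨0, fun h ↦ absurd h hx⟩
  choose T hT using h1
  exact ⟨T, hT⟩

/-- Weyl connections exist locally: average a flat connection over a hypercomplex frame, then
correct the torsion first by a quaternionic linear form and then by a form with values in the
imaginary quaternions. -/
theorem Structure.exists_isWeylOn_local (Q : Structure E M) (hd : 2 < Module.finrank ℝ E) (x₀ : M) :
    ∃ U, IsOpen U ∧ x₀ ∈ U ∧ ∃ cov : Operator E M, Q.IsWeylOn cov U := by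
  obtain ⟨U₀, hx₀, A, B, C, h₀⟩ := Q.exists_isFrameOn x₀
  set U := U₀ ∩ frameSet E x₀ with hUdef
  have hU : IsOpen U := h₀.isOpen.inter
    (trivializationAt E (TangentSpace 𝓘(ℝ, E)) x₀).open_baseSet
  have h := h₀.mono hU Set.inter_subset_left
  have hflat := isSmoothConnectionOn_flatConnection (E := E) x₀
  have hflat' : IsSmoothConnectionOn (flatConnection (E := E) x₀) U :=
    ⟨hflat.isCov.mono Set.inter_subset_right, fun x hx ↦ hflat.smoothAt x hx.2⟩
  have h1 := h.averaged_isSmooth hflat'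
  set cov₁ := averagedConnection A B C (flatConnection (E := E) x₀)
  obtain ⟨T₁, hT₁⟩ := h1.isCov.exists_torsion
  set G₂ : BilinearField E M := fun y ↦ linearCorrection
      (A y : TangentSpace 𝓘(ℝ, E) y →ₗ[ℝ] TangentSpace 𝓘(ℝ, E) y)
      (B y : TangentSpace 𝓘(ℝ, E) y →ₗ[ℝ] TangentSpace 𝓘(ℝ, E) y)
      (C y : TangentSpace 𝓘(ℝ, E) y →ₗ[ℝ] TangentSpace 𝓘(ℝ, E) y) (T₁ y) with hG₂
  have h2 : IsSmoothConnectionOn (addForm cov₁ G₂) U := h1.addForm fun x hx ↦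
    h.smoothAt_linearCorrection hx (h1.torsion_smoothAt hU hT₁ hx)
  set T₂ : BilinearField E M := fun x ↦ T₁ x + G₂ x - (G₂ x).flip with hT₂def
  have hT₂ : ∀ x ∈ U, IsTorsionAt (addForm cov₁ G₂) x (T₂ x) := fun x hx ↦ (hT₁ x hx).addForm
  set G₃ : BilinearField E M := fun y ↦ traceCorrection
      (A y : TangentSpace 𝓘(ℝ, E) y →ₗ[ℝ] TangentSpace 𝓘(ℝ, E) y)
      (B y : TangentSpace 𝓘(ℝ, E) y →ₗ[ℝ] TangentSpace 𝓘(ℝ, E) y)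
      (C y : TangentSpace 𝓘(ℝ, E) y →ₗ[ℝ] TangentSpace 𝓘(ℝ, E) y) (T₂ y) with hG₃
  have h3 : IsSmoothConnectionOn (addForm (addForm cov₁ G₂) G₃) U := h2.addForm fun x hx ↦
    h.smoothAt_traceCorrection hx (h2.torsion_smoothAt hU hT₂ hx)
  refine ⟨U, hU, ⟨hx₀, mem_frameSet E x₀⟩, _, h3, fun x hx ↦ ?_, fun x hx ↦
    ⟨_, (hT₂ x hx).addForm, fun A' B' C' hA hB hC h' X ↦ ?_⟩⟩
  · have hc1 : Q.CompatibleAt cov₁ x := h.compatibleAt (by lia) h1.isCov hx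
      fun Y hY v ↦ h.averaged_parallel hflat'.isCov hx hY v
    have hc2 : Q.CompatibleAt (addForm cov₁ G₂) x := by
      refine hc1.addForm fun v F hF ↦ ⟨0, Submodule.zero_mem _, fun w ↦ ?_⟩
      obtain ⟨p, q, r, s, hF'⟩ := (h.mem_fibre_iff hx).1 hF
      obtain ⟨k1, k2, k3⟩ := linearCorrection_comm (h.isHypercomplex x hx).rel (T₁ x) v w
      rw [hF' w, hF']
      simp only [hG₂, map_add, map_smul, k1, k2, k3]
      simp
    refine hc2.addForm fun v F hF ↦ ?_
    have hFq := (h.mem_fibre_iff hx).1 hF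
    have hr := (h.isHypercomplex x hx).rel
    have hG : IsQuaternion (A x : TangentSpace 𝓘(ℝ, E) x →ₗ[ℝ] TangentSpace 𝓘(ℝ, E) x)
        (B x : TangentSpace 𝓘(ℝ, E) x →ₗ[ℝ] TangentSpace 𝓘(ℝ, E) x)
        (C x : TangentSpace 𝓘(ℝ, E) x →ₗ[ℝ] TangentSpace 𝓘(ℝ, E) x) (G₃ x v) := by
      rw [hG₃, traceCorrection_apply]
      exact isQuaternion_smul_add ..
    exact h.exists_mem_fibre hx ((hG.comp hr hFq).sub (hFq.comp hr hG))
  · refine h.isNormal hx ?_ hA hB hC h'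
    exact isNormal_traceCorrection (h.isHypercomplex x hx).rel hd (T₂ x) (hT₂ x hx).flip_eq_neg
      (torsionLinearPart_linearCorrection (h.isHypercomplex x hx).rel (T₁ x)) X

omit [CompleteSpace E] in
/-- Weyl connections may be modified by the bracket with a covector which is prescribed at a
point. -/
theorem Structure.IsWeylOn.exists_bracket [T2Space M] (hcov : Q.IsWeylOn cov Set.univ)
    (h : Q.IsFrameOn A B C U) {x : M} (hx : x ∈ U) (η : Module.Dual ℝ (TangentSpace 𝓘(ℝ, E) x)) :
    ∃ cov' : Operator E M, Q.IsWeylOn cov' Set.univ ∧ ∀ Y v, cov' Y x v =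
      cov Y x v + bracket (A x) (B x) (C x) v η (Y x) := by
  have hU' : U ∩ frameSet E x ∈ 𝓝 x :=
    Filter.inter_mem (h.isOpen.mem_nhds hx) (eventually_mem_frameSet (mem_frameSet E x))
  obtain ⟨χ, hχ, hs, h1⟩ := exists_bump (E := E) hU'
  let l : E →L[ℝ] ℝ := (η ∘ₗ ((trivializationAt E (TangentSpace 𝓘(ℝ, E)) x).symmL ℝ x :
    E →ₗ[ℝ] TangentSpace 𝓘(ℝ, E) x)).toContinuousLinearMap
  let Υ : ∀ y : M, Module.Dual ℝ (TangentSpace 𝓘(ℝ, E) y) := fun y ↦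
    χ y • ((l ∘L coord x y : TangentSpace 𝓘(ℝ, E) y →L[ℝ] ℝ) : TangentSpace 𝓘(ℝ, E) y →ₗ[ℝ] ℝ)
  have hΥx : Υ x = η := by
    ext v
    have := constField_coord (mem_frameSet E x) v
    simp only [constField] at this
    simp [Υ, l, h1.self_of_nhds, this]
  let G : BilinearField E M := fun y ↦ bracketForm (A y) (B y) (C y) (Υ y)
  have hG0 : ∀ y, y ∉ U → G y = 0 := by
    intro y hy
    have : χ y = 0 := image_eq_zero_of_notMem_tsupport fun h ↦ hy (hs h).1
    ext v w
    simp [G, Υ, bracketForm_apply, bracket, this]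
  have hGs : ∀ y, G.SmoothAt y := by
    intro y X W hX hW
    by_cases hy : y ∈ tsupport χ
    · obtain ⟨hyU, hyf⟩ := hs hy
      have hA := h.smoothA y hyU
      have hB := h.smoothB y hyU
      have hC := h.smoothC y hyU
      have key : ∀ Z : ∀ y : M, TangentSpace 𝓘(ℝ, E) y, SmoothAt Z y →
          ContMDiffAt 𝓘(ℝ, E) 𝓘(ℝ, ℝ) ∞ (fun z ↦ Υ z (Z z)) y := fun Z hZ ↦
        (hχ y).mul (l.contMDiff.contMDiffAt.comp y ((smoothAt_iff_coord hyf).1 hZ))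
      have key2 : ∀ Z Z' : ∀ y : M, TangentSpace 𝓘(ℝ, E) y, SmoothAt Z y → SmoothAt Z' y →
          SmoothAt (fun z ↦ Υ z (Z z) • Z' z) y := fun Z Z' hZ hZ' ↦
        ContMDiffAt.smul_section (key Z hZ) hZ'
      have key3 : ∀ D : ∀ x : M, TangentSpace 𝓘(ℝ, E) x →L[ℝ] TangentSpace 𝓘(ℝ, E) x,
          ContMDiffAt 𝓘(ℝ, E) (𝓘(ℝ, E).prod 𝓘(ℝ, E →L[ℝ] E)) ∞ (affinorSection D) y →
          SmoothAt (fun z ↦ Υ z (D z (X z)) • D z (W z) + Υ z (D z (W z)) • D z (X z)) y :=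
        fun D hD ↦ ContMDiffAt.add_section
          (key2 _ _ (SmoothAt.affinor hD hX) (SmoothAt.affinor hD hW))
          (key2 _ _ (SmoothAt.affinor hD hW) (SmoothAt.affinor hD hX))
      exact ContMDiffAt.sub_section (ContMDiffAt.sub_section (ContMDiffAt.sub_section
        (ContMDiffAt.add_section (key2 _ _ hX hW) (key2 _ _ hW hX)) (key3 A hA)) (key3 B hB))
        (key3 C hC)
    · refine SmoothAt.congr (contMDiffAt_zeroSection ..) ?_
      filter_upwards [(isClosed_tsupport χ).isOpen_compl.mem_nhds hy] with z hz
      simp [G, Υ, bracketForm_apply, bracket, image_eq_zero_of_notMem_tsupport hz]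
  refine ⟨addForm cov G, ⟨hcov.connection.addForm fun y _ ↦ hGs y, fun y _ ↦ ?_, fun y _ ↦ ?_⟩,
    fun Y v ↦ ?_⟩
  · refine (hcov.compatible y trivial).addForm fun v F hF ↦ ?_
    by_cases hy : y ∈ U
    · exact h.exists_mem_fibre hy ((h.isHypercomplex y hy).isQuaternion_bracket_commutator
        (Υ y) v ((h.mem_fibre_iff hy).1 hF))
    · exact ⟨0, Submodule.zero_mem _, fun w ↦ by simp [hG0 y hy]⟩
  · obtain ⟨T, hT, hT'⟩ := hcov.normalized y trivial
    refine ⟨T, ?_, hT'⟩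
    have h2 := hT.addForm (G := G)
    rwa [show (G y).flip = G y from bracketForm_flip .., add_sub_cancel_right] at h2
  · rw [addForm_apply]
    simp only [G, bracketForm_apply, hΥx]

/-- Weyl connections exist. -/
theorem Structure.exists_isWeyl [T2Space M] [SigmaCompactSpace M] (Q : Structure E M)
    (hd : 2 < Module.finrank ℝ E) : ∃ cov : Operator E M, Q.IsWeylOn cov Set.univ :=
  Q.exists_isWeylOn_univ (Q.exists_isWeylOn_local hd)

end Existence

/-! ### Geodesics -/

section ODE

/-- A smooth autonomous ordinary differential equation on an open set has smooth local solutions. -/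
lemma exists_contDiffOn_solution {W : Type*} [NormedAddCommGroup W] [NormedSpace ℝ W]
    [CompleteSpace W] {F : W → W} {s : Set W} (hs : IsOpen s) (hF : ContDiffOn ℝ ∞ F s) {w₀ : W}
    (h₀ : w₀ ∈ s) : ∃ α : ℝ → W, ∃ ε > 0, α 0 = w₀ ∧
      (∀ t ∈ Set.Ioo (-ε) ε, α t ∈ s ∧ HasDerivAt α (F (α t)) t) ∧
      ContDiffOn ℝ ∞ α (Set.Ioo (-ε) ε) := by
  obtain ⟨α, hα0, ε, hε, hα⟩ :=
    ContDiffAt.exists_forall_mem_closedBall_exists_eq_forall_mem_Ioo_hasDerivAt₀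
      ((hF.contDiffAt (hs.mem_nhds h₀)).of_le (by exact_mod_cast le_top)) 0
  simp only [zero_sub, zero_add] at hα
  have hc : ∀ᶠ t in 𝓝 (0 : ℝ), α t ∈ s :=
    (hα 0 ⟨by linarith, hε⟩).continuousAt.eventually_mem (hs.mem_nhds (hα0 ▸ h₀))
  obtain ⟨δ, hδ, hδs⟩ := Metric.eventually_nhds_iff.1 hc
  have key : ∀ t ∈ Set.Ioo (-min ε δ) (min ε δ), α t ∈ s ∧ HasDerivAt α (F (α t)) t := by
    rintro t ⟨h1, h2⟩
    have := min_le_left ε δ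
    have := min_le_right ε δ
    exact ⟨hδs (by rw [Real.dist_0_eq_abs, abs_lt]; constructor <;> linarith),
      hα t ⟨by linarith, by linarith⟩⟩
  refine ⟨α, min ε δ, lt_min hε hδ, hα0, key, contDiffOn_infty.2 fun n ↦ ?_⟩
  induction n with
  | zero =>
    exact contDiffOn_zero.2 fun t ht ↦ (key t ht).2.continuousAt.continuousWithinAt
  | succ n ih =>
    push_cast
    refine (contDiffOn_succ_iff_deriv_of_isOpen isOpen_Ioo).2
      ⟨fun t ht ↦ (key t ht).2.differentiableAt.differentiableWithinAt, by simp, ?_⟩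
    refine ((hF.of_le (by exact_mod_cast le_top)).comp ih fun t ht ↦ (key t ht).1).congr
      fun t ht ↦ (key t ht).2.deriv

/-- A smooth function with nonzero derivative at `t` has a smooth inverse near `t`. -/
lemma exists_contDiffOn_leftInverse {h : ℝ → ℝ} {s : Set ℝ} (hs : IsOpen s)
    (hh : ContDiffOn ℝ ∞ h s) {t : ℝ} (ht : t ∈ s) (h0 : deriv h t ≠ 0) :
    ∃ (g : ℝ → ℝ) (V : Set ℝ), IsOpen V ∧ h t ∈ V ∧ ContDiffOn ℝ ∞ g V ∧ Set.MapsTo g V s ∧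
      ∀ᶠ r in 𝓝 t, g (h r) = r := by
  have hst : HasStrictDerivAt h (deriv h t) t :=
    (hh.contDiffAt (hs.mem_nhds ht)).hasStrictDerivAt (by simp)
  let e := (hst.hasStrictFDerivAt_equiv h0).toOpenPartialHomeomorph h
  have he : ⇑e = h := HasStrictFDerivAt.toOpenPartialHomeomorph_coe _
  have hte : t ∈ e.source := HasStrictFDerivAt.mem_toOpenPartialHomeomorph_source _
  have hd : ContinuousOn (deriv h) s := hh.continuousOn_deriv_of_isOpen hs (by simp)
  have hs' : IsOpen (s ∩ deriv h ⁻¹' {0}ᶜ) := hd.isOpen_inter_preimage hs isOpen_compl_singleton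
  refine ⟨e.symm, e.target ∩ e.symm ⁻¹' (s ∩ deriv h ⁻¹' {0}ᶜ),
    e.isOpen_inter_preimage_symm hs', ⟨?_, ?_⟩, ?_, fun y hy ↦ hy.2.1, ?_⟩
  · rw [← he]; exact e.map_source hte
  · rw [Set.mem_preimage, ← he, e.left_inv hte, he]
    exact ⟨ht, h0⟩
  · rintro y ⟨hy1, hy2, hy3⟩
    have hy := hh.contDiffAt (hs.mem_nhds hy2)
    refine (e.contDiffAt_symm_deriv hy3 hy1 ?_ ?_).contDiffWithinAt
    · rw [he]; exact (hy.differentiableAt (by simp)).hasDerivAt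
    · rw [he]; exact hy
  · filter_upwards [e.open_source.mem_nhds hte] with r hr
    rw [← he, e.left_inv hr]

end ODE

section Curves

variable {E : Type*} [NormedAddCommGroup E] [NormedSpace ℝ E]
  {M : Type*} [TopologicalSpace M] [ChartedSpace E M] [IsManifold 𝓘(ℝ, E) ∞ M]

omit [IsManifold 𝓘(ℝ, E) ∞ M] in
lemma mvfderiv_velocity {W : Type*} [NormedAddCommGroup W] [NormedSpace ℝ W] {g : M → W}
    {c : ℝ → M} {t : ℝ} (hg : MDifferentiableAt 𝓘(ℝ, E) 𝓘(ℝ, W) g (c t))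
    (hc : MDifferentiableAt 𝓘(ℝ, ℝ) 𝓘(ℝ, E) c t) :
    mvfderiv 𝓘(ℝ, E) g (c t) (velocity c t) = deriv (g ∘ c) t := by
  have h := mfderiv_comp t hg hc
  rw [mfderiv_eq_fderiv] at h
  rw [← fderiv_apply_one_eq_deriv, h]
  rfl

lemma mem_frameSet_iff {x₀ x : M} : x ∈ frameSet E x₀ ↔ x ∈ (extChartAt 𝓘(ℝ, E) x₀).source := by
  rw [extChartAt_source]
  exact Iff.rfl

/-- The coordinates of the velocity are the derivative of the curve in the chart. -/
lemma coord_velocity {x₀ : M} {c : ℝ → M} {t : ℝ} (h : c t ∈ frameSet E x₀)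
    (hc : MDifferentiableAt 𝓘(ℝ, ℝ) 𝓘(ℝ, E) c t) :
    coord x₀ (c t) (velocity c t) = deriv (extChartAt 𝓘(ℝ, E) x₀ ∘ c) t := by
  have h' : c t ∈ (chartAt E x₀).source := h
  rw [← mvfderiv_velocity (mdifferentiableAt_extChartAt h') hc, coord,
    TangentBundle.continuousLinearMapAt_trivializationAt h']
  rfl

/-- The acceleration of a curve in a chart. -/
lemma coord_cov_velocity [FiniteDimensional ℝ E] {cov : Operator E M}
    (h : IsCovariantDerivativeOn E cov Set.univ) {x₀ : M} {c : ℝ → M} {t : ℝ}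
    (ht : c t ∈ frameSet E x₀) (hc : ContMDiff 𝓘(ℝ, ℝ) 𝓘(ℝ, E) ∞ c)
    {X : ∀ x : M, TangentSpace 𝓘(ℝ, E) x} (hX : MDiffAt (T% X) (c t))
    (hXc : ∀ᶠ s in 𝓝 t, X (c s) = velocity c s) :
    coord x₀ (c t) (cov X (c t) (velocity c t)) =
      deriv (deriv (extChartAt 𝓘(ℝ, E) x₀ ∘ c)) t +
        coord x₀ (c t) (cov (constField x₀ (deriv (extChartAt 𝓘(ℝ, E) x₀ ∘ c) t)) (c t)
          (velocity c t)) := by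
  have hc' : MDifferentiable 𝓘(ℝ, ℝ) 𝓘(ℝ, E) c := hc.mdifferentiable (by simp)
  rw [h.eq_flatConnection_add ht trivial hX, add_apply, map_add, flatConnection_apply,
    coord_constField ht, mvfderiv_velocity (mdifferentiableAt_coord ht hX) (hc' t),
    hXc.self_of_nhds, coord_velocity ht (hc' t)]
  congr 1
  refine Filter.EventuallyEq.deriv_eq ?_
  filter_upwards [hXc, hc.continuous.continuousAt.eventually (eventually_mem_frameSet ht)]
    with s hs hs'
  rw [Function.comp_apply, hs, coord_velocity hs' (hc' s)]

/-- The acceleration of a curve does not depend on the extension of the velocity. -/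
lemma cov_velocity_congr [FiniteDimensional ℝ E] {cov : Operator E M}
    (h : IsCovariantDerivativeOn E cov Set.univ) {c : ℝ → M} {t : ℝ}
    (hc : ContMDiff 𝓘(ℝ, ℝ) 𝓘(ℝ, E) ∞ c)
    {X Y : ∀ x : M, TangentSpace 𝓘(ℝ, E) x} (hX : MDiffAt (T% X) (c t))
    (hY : MDiffAt (T% Y) (c t))
    (hXc : ∀ᶠ s in 𝓝 t, X (c s) = velocity c s) (hYc : ∀ᶠ s in 𝓝 t, Y (c s) = velocity c s) :
    cov X (c t) (velocity c t) = cov Y (c t) (velocity c t) := by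
  have ht := mem_frameSet E (c t)
  rw [← constField_coord ht (cov X (c t) (velocity c t)), coord_cov_velocity h ht hc hX hXc,
    ← coord_cov_velocity h ht hc hY hYc, constField_coord ht]

/-- The velocity of a regular curve extends locally to a smooth vector field. -/
lemma exists_contMDiff_eq_velocity [FiniteDimensional ℝ E] [T2Space M] {c : ℝ → M} {t : ℝ}
    (hc : ContMDiff 𝓘(ℝ, ℝ) 𝓘(ℝ, E) ∞ c) (h0 : velocity (E := E) c t ≠ 0) :
    ∃ X : ∀ x : M, TangentSpace 𝓘(ℝ, E) x,
      ContMDiff 𝓘(ℝ, E) (𝓘(ℝ, E).prod 𝓘(ℝ, E)) ∞ (fieldSection X) ∧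
      ∀ᶠ s in 𝓝 t, X (c s) = velocity c s := by
  have hc' : MDifferentiable 𝓘(ℝ, ℝ) 𝓘(ℝ, E) c := hc.mdifferentiable (by simp)
  set x₀ := c t with hx₀
  have ht := mem_frameSet E x₀
  set φ := extChartAt 𝓘(ℝ, E) x₀ with hφ
  have hopen : IsOpen (frameSet E x₀) :=
    (trivializationAt E (TangentSpace 𝓘(ℝ, E)) x₀).open_baseSet
  have hφs : ContMDiffOn 𝓘(ℝ, E) 𝓘(ℝ, E) ∞ φ (frameSet E x₀) := contMDiffOn_extChartAt
  have hs : IsOpen (c ⁻¹' frameSet E x₀) := hopen.preimage hc.continuous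
  have hφc : ContDiffOn ℝ ∞ (φ ∘ c) (c ⁻¹' frameSet E x₀) :=
    contMDiffOn_iff_contDiffOn.1 (hφs.comp hc.contMDiffOn fun r hr ↦ hr)
  have hd : ContDiffOn ℝ ∞ (deriv (φ ∘ c)) (c ⁻¹' frameSet E x₀) :=
    hφc.deriv_of_isOpen hs (by simp)
  have hd0 : deriv (φ ∘ c) t ≠ 0 := by
    rw [← coord_velocity ht (hc' t)]
    intro h
    exact h0 (by rw [← constField_coord ht (velocity c t), h]; simp [constField])
  obtain ⟨l, hl⟩ := SeparatingDual.exists_eq_one (R := ℝ) hd0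
  have hlc : ContDiffOn ℝ ∞ (l ∘ φ ∘ c) (c ⁻¹' frameSet E x₀) := l.contDiff.comp_contDiffOn hφc
  have hld : deriv (l ∘ φ ∘ c) t ≠ 0 := by
    have := l.hasFDerivAt.comp_hasDerivAt t
      ((hφc.contDiffAt (hs.mem_nhds ht)).differentiableAt (by simp)).hasDerivAt
    rw [this.deriv, hl]
    exact one_ne_zero
  obtain ⟨g, V, hV, htV, hg, hgV, hgl⟩ := exists_contDiffOn_leftInverse hs hlc ht hld
  have hlφ : ContMDiffOn 𝓘(ℝ, E) 𝓘(ℝ, ℝ) ∞ (l ∘ φ) (frameSet E x₀) :=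
    l.contDiff.contMDiff.comp_contMDiffOn hφs
  have hU : IsOpen (frameSet E x₀ ∩ (l ∘ φ) ⁻¹' V) :=
    hlφ.continuousOn.isOpen_inter_preimage hopen hV
  have hu : ContMDiffOn 𝓘(ℝ, E) 𝓘(ℝ, E) ∞ (fun y ↦ deriv (φ ∘ c) (g (l (φ y))))
      (frameSet E x₀ ∩ (l ∘ φ) ⁻¹' V) :=
    (hd.comp hg hgV).contMDiffOn.comp (hlφ.mono Set.inter_subset_left) fun y hy ↦ hy.2
  obtain ⟨X, hX, hXY⟩ := exists_contMDiff_eventuallyEq hU (x := x₀)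
    (Y := fun y ↦ constField x₀ (deriv (φ ∘ c) (g (l (φ y)))) y) ⟨ht, htV⟩ (by
      intro y hy
      rw [smoothAt_iff_coord hy.1]
      refine (hu.contMDiffAt (hU.mem_nhds hy)).congr_of_eventuallyEq ?_
      filter_upwards [hU.mem_nhds hy] with z hz using coord_constField hz.1 _)
  refine ⟨X, hX, ?_⟩
  filter_upwards [hc.continuous.continuousAt.eventually hXY, hgl, hs.mem_nhds ht] with s h1 h2 h3
  rw [h1]
  change constField x₀ (deriv (φ ∘ c) (g ((l ∘ φ ∘ c) s))) (c s) = _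
  rw [h2, ← coord_velocity h3 (hc' s), constField_coord h3]

/-- The quadratic Christoffel term of the geodesic equation in the chart at `x₀`. -/
def geodesicTerm (cov : Operator E M) (x₀ : M) (z u : E) : E :=
  coord x₀ ((extChartAt 𝓘(ℝ, E) x₀).symm z)
    (cov (constField x₀ u) ((extChartAt 𝓘(ℝ, E) x₀).symm z)
      (constField x₀ u ((extChartAt 𝓘(ℝ, E) x₀).symm z)))

lemma symm_mem_frameSet {x₀ : M} {z : E} (hz : z ∈ (extChartAt 𝓘(ℝ, E) x₀).target) :
    (extChartAt 𝓘(ℝ, E) x₀).symm z ∈ frameSet E x₀ :=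
  mem_frameSet_iff.2 ((extChartAt 𝓘(ℝ, E) x₀).map_target hz)

lemma geodesicTerm_smul {cov : Operator E M} (h : IsCovariantDerivativeOn E cov Set.univ)
    {x₀ : M} {z : E} (hz : z ∈ (extChartAt 𝓘(ℝ, E) x₀).target) (r : ℝ) (u : E) :
    geodesicTerm cov x₀ z (r • u) = (r * r) • geodesicTerm cov x₀ z u := by
  have h1 : ∀ y : M, constField x₀ (r • u) y = r • constField x₀ u y := by simp [constField]
  rw [geodesicTerm, geodesicTerm, h.constField_smul (symm_mem_frameSet hz) trivial, h1]
  generalize (extChartAt 𝓘(ℝ, E) x₀).symm z = y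
  rw [smul_apply, map_smul, map_smul, map_smul, smul_smul]

lemma contDiffOn_geodesicTerm [FiniteDimensional ℝ E] {cov : Operator E M}
    (h : IsSmoothConnectionOn cov Set.univ) (x₀ : M) :
    ContDiffOn ℝ ∞ (fun p : E × E ↦ geodesicTerm cov x₀ p.1 p.2)
      ((extChartAt 𝓘(ℝ, E) x₀).target ×ˢ Set.univ) := by
  set φ := extChartAt 𝓘(ℝ, E) x₀
  let b := Module.finBasis ℝ E
  have h1 : ∀ i j, ContDiffOn ℝ ∞ (fun z ↦ coord x₀ (φ.symm z)
      (cov (constField x₀ (b i)) (φ.symm z) (constField x₀ (b j) (φ.symm z)))) φ.target := by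
    intro i j
    rw [← contMDiffOn_iff_contDiffOn]
    have h2 : ContMDiffOn 𝓘(ℝ, E) 𝓘(ℝ, E) ∞ (fun y ↦ coord x₀ y
        (cov (constField x₀ (b i)) y (constField x₀ (b j) y))) (frameSet E x₀) := fun y hy ↦
      ((smoothAt_iff_coord hy).1 (h.smoothAt y trivial _ _ (smoothAt_constField hy _)
        (smoothAt_constField hy _))).contMDiffWithinAt
    exact h2.comp (contMDiffOn_extChartAt_symm x₀) fun z hz ↦ symm_mem_frameSet hz
  have h3 : ∀ i, ContDiff ℝ ∞ fun p : E × E ↦ b.coord i p.2 := fun i ↦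
    ((b.coord i).toContinuousLinearMap.contDiff).comp contDiff_snd
  have h4 : ContDiffOn ℝ ∞ (fun p : E × E ↦ ∑ i, ∑ j, b.coord i p.2 • b.coord j p.2 •
      coord x₀ (φ.symm p.1) (cov (constField x₀ (b j)) (φ.symm p.1)
        (constField x₀ (b i) (φ.symm p.1)))) (φ.target ×ˢ Set.univ) :=
    ContDiffOn.sum fun i _ ↦ ContDiffOn.sum fun j _ ↦ (h3 i).contDiffOn.smul
      ((h3 j).contDiffOn.smul ((h1 j i).comp contDiffOn_fst fun p hp ↦ hp.1))
  refine h4.congr fun p hp ↦ ?_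
  have hp' := symm_mem_frameSet hp.1
  have h5 : constField x₀ p.2 (φ.symm p.1) =
      ∑ j, b.coord j p.2 • constField x₀ (b j) (φ.symm p.1) := by
    simp only [constField, ← map_smul, ← map_sum]
    exact congrArg _ (b.sum_repr p.2).symm
  simp only [geodesicTerm]
  rw [h.isCov.constField_eq_sum hp' trivial, h5]
  generalize φ.symm p.1 = y
  simp only [sum_apply, smul_apply, map_sum, map_smul, Finset.smul_sum, b]

/-- A smooth connection has a geodesic, defined for all times as an unparameterized curve, in every
direction. The solution of the geodesic equation on an interval is reparameterized by a multiple
of the arctangent. -/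
lemma exists_isUnparameterizedGeodesic [FiniteDimensional ℝ E] [T2Space M]
    (cov : CovariantDerivative 𝓘(ℝ, E) E (TangentSpace 𝓘(ℝ, E) : M → Type _))
    (h : IsSmoothConnectionOn cov.toFun Set.univ) (x : M) {v : TangentSpace 𝓘(ℝ, E) x}
    (hv : v ≠ 0) : ∃ c : ℝ → M, IsUnparameterizedGeodesic cov c ∧ c 0 = x ∧
      coord x (c 0) (velocity c 0) = coord x x v := by
  have : CompleteSpace E := FiniteDimensional.complete ℝ E
  have hx := mem_frameSet E x
  set φ := extChartAt 𝓘(ℝ, E) x with hφ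
  have hcv : coord x x v ≠ 0 := fun h0 ↦ hv (by
    rw [← constField_coord hx v, h0]; simp [constField])
  have hs : IsOpen (φ.target ×ˢ ({0}ᶜ : Set E)) :=
    (isOpen_extChartAt_target x).prod isOpen_compl_singleton
  obtain ⟨α, ε, hε, hα0, hα, hαs⟩ := exists_contDiffOn_solution hs
    (F := fun p : E × E ↦ (p.2, -geodesicTerm cov.toFun x p.1 p.2))
    (contDiffOn_snd.prodMk ((contDiffOn_geodesicTerm h x).neg.mono
      (Set.prod_mono subset_rfl (Set.subset_univ _))))
    (w₀ := (φ x, coord x x v)) ⟨mem_extChartAt_target x, hcv⟩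
  -- `|arctan| < π / 2 < 2`, so `τ` takes values in the interval of existence.
  set τ : ℝ → ℝ := fun s ↦ ε / 2 * Real.arctan (s / (ε / 2)) with hτdef
  have hτ : ∀ s, τ s ∈ Set.Ioo (-ε) ε := by
    intro s
    have h1 := Real.arctan_lt_pi_div_two (s / (ε / 2))
    have h2 := Real.neg_pi_div_two_lt_arctan (s / (ε / 2))
    have h3 := Real.pi_lt_four
    constructor <;> simp only [hτdef] <;> nlinarith
  have hτs : ContDiff ℝ ∞ τ :=
    contDiff_const.mul (Real.contDiff_arctan.comp (contDiff_id.div_const _))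
  set τ' : ℝ → ℝ := fun s ↦ 1 / (1 + (s / (ε / 2)) ^ 2) with hτ'def
  have hτ' : ∀ s, HasDerivAt τ (τ' s) s := by
    intro s
    have := (((hasDerivAt_id s).div_const (ε / 2)).arctan).const_mul (ε / 2)
    refine HasDerivAt.congr_deriv this ?_
    have hε' : ε / 2 ≠ 0 := by positivity
    change ε / 2 * (1 / (1 + (s / (ε / 2)) ^ 2) * (1 / (ε / 2))) = 1 / (1 + (s / (ε / 2)) ^ 2)
    field_simp
  have hτ0 : ∀ s, τ' s ≠ 0 := fun s ↦ by positivity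
  have hτ's : ContDiff ℝ ∞ τ' := by
    have : τ' = deriv τ := funext fun s ↦ (hτ' s).deriv.symm
    rw [this]
    exact (contDiff_infty_iff_deriv.1 hτs).2
  have hατ : ContDiff ℝ ∞ (α ∘ τ) :=
    contDiffOn_univ.1 (hαs.comp hτs.contDiffOn fun s _ ↦ hτ s)
  have hd : ∀ s, HasDerivAt (α ∘ τ) (τ' s • ((α (τ s)).2,
      -geodesicTerm cov.toFun x (α (τ s)).1 (α (τ s)).2)) s := fun s ↦
    (hα (τ s) (hτ s)).2.scomp s (hτ' s)
  have hd1 : ∀ s, HasDerivAt (fun s ↦ (α (τ s)).1) (τ' s • (α (τ s)).2) s := fun s ↦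
    (ContinuousLinearMap.fst ℝ E E).hasFDerivAt.comp_hasDerivAt s (hd s)
  have hd2 : ∀ s, HasDerivAt (fun s ↦ (α (τ s)).2)
      (τ' s • -geodesicTerm cov.toFun x (α (τ s)).1 (α (τ s)).2) s := fun s ↦
    (ContinuousLinearMap.snd ℝ E E).hasFDerivAt.comp_hasDerivAt s (hd s)
  have hmem : ∀ s, (α (τ s)).1 ∈ φ.target := fun s ↦ (hα _ (hτ s)).1.1
  set c : ℝ → M := fun s ↦ φ.symm (α (τ s)).1 with hc
  have hφc : φ ∘ c = fun s ↦ (α (τ s)).1 := funext fun s ↦ φ.right_inv (hmem s)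
  have hcs : ContMDiff 𝓘(ℝ, ℝ) 𝓘(ℝ, E) ∞ c :=
    contMDiffOn_univ.1 ((contMDiffOn_extChartAt_symm x).comp
      (contDiff_fst.comp hατ).contMDiff.contMDiffOn fun s _ ↦ hmem s)
  have hcd : MDifferentiable 𝓘(ℝ, ℝ) 𝓘(ℝ, E) c := hcs.mdifferentiable (by simp)
  have hcx : ∀ s, c s ∈ frameSet E x := fun s ↦ symm_mem_frameSet (hmem s)
  have hder : deriv (φ ∘ c) = fun s ↦ τ' s • (α (τ s)).2 := by
    rw [hφc]
    exact funext fun s ↦ (hd1 s).deriv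
  have hvel : ∀ s, coord x (c s) (velocity c s) = τ' s • (α (τ s)).2 := fun s ↦ by
    rw [coord_velocity (hcx s) (hcd s), ← hφ, hder]
  have hreg : ∀ s, velocity (E := E) c s ≠ 0 := fun s h0 ↦ by
    have := hvel s
    rw [h0, map_zero] at this
    exact smul_ne_zero (hτ0 s) (hα _ (hτ s)).1.2 this.symm
  have hτ00 : τ 0 = 0 := by simp [hτdef]
  refine ⟨c, ⟨hcs, hreg, fun s ↦ ?_⟩, ?_, ?_⟩
  · obtain ⟨X, hX, hXc⟩ := exists_contMDiff_eq_velocity hcs (hreg s)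
    refine ⟨X, hX, hXc, deriv τ' s / τ' s, ?_⟩
    have hacc := coord_cov_velocity cov.isCovariantDerivativeOnUniv (hcx s) hcs
      ((hX (c s)).mdifferentiableAt (by simp)) hXc
    have hdd : deriv (deriv (φ ∘ c)) s = τ' s • τ' s •
        -geodesicTerm cov.toFun x (α (τ s)).1 (α (τ s)).2 + deriv τ' s • (α (τ s)).2 := by
      rw [hder]
      exact ((hτ's.differentiable (by simp) s).hasDerivAt.smul (hd2 s)).deriv
    have hquad : coord x (c s) (cov.toFun (constField x (deriv (φ ∘ c) s)) (c s)
        (velocity c s)) = (τ' s * τ' s) • geodesicTerm cov.toFun x (α (τ s)).1 (α (τ s)).2 := by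
      rw [← geodesicTerm_smul cov.isCovariantDerivativeOnUniv (hmem s), geodesicTerm, hder,
        ← constField_coord (hcx s) (velocity c s), hvel s]
    have hcoord : coord x (c s) (cov.toFun X (c s) (velocity c s)) =
        coord x (c s) ((deriv τ' s / τ' s) • velocity c s) := by
      rw [hacc, hdd, hquad, map_smul, hvel, smul_smul, smul_smul, smul_neg,
        div_mul_cancel₀ _ (hτ0 s)]
      abel
    have := congrArg (fun w ↦ constField x w (c s)) hcoord
    simpa only [constField_coord (hcx s)] using this
  · simp only [hc, hτ00, hα0]
    exact extChartAt_to_inv x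
  · rw [hvel, hτ00, hα0]
    simp [hτ'def]

end Curves

/-! ### Transport of vector fields and connections by diffeomorphisms -/

section Transport

variable {E : Type*} [NormedAddCommGroup E] [NormedSpace ℝ E]
  {M : Type*} [TopologicalSpace M] [ChartedSpace E M] [IsManifold 𝓘(ℝ, E) ∞ M]
  {M' : Type*} [TopologicalSpace M'] [ChartedSpace E M'] [IsManifold 𝓘(ℝ, E) ∞ M']
  (f : M ≃ₘ⟮𝓘(ℝ, E), 𝓘(ℝ, E)⟯ M')

/-- The tangent map of a diffeomorphism at a point. -/
def tangentEquiv (x : M) : TangentSpace 𝓘(ℝ, E) x ≃L[ℝ] TangentSpace 𝓘(ℝ, E) (f x) :=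
  f.mfderivToContinuousLinearEquiv (by simp) x

omit [IsManifold 𝓘(ℝ, E) ∞ M] [IsManifold 𝓘(ℝ, E) ∞ M'] in
lemma coe_tangentEquiv (x : M) : (tangentEquiv f x : TangentSpace 𝓘(ℝ, E) x →L[ℝ]
    TangentSpace 𝓘(ℝ, E) (f x)) = mfderiv 𝓘(ℝ, E) 𝓘(ℝ, E) f x :=
  f.mfderivToContinuousLinearEquiv_coe (by simp)

lemma two_le_infty : (2 : ℕ∞ω) ≤ ∞ := by decide

/-- The image of a vector field under a diffeomorphism. -/
def pushforward (Y : ∀ x : M, TangentSpace 𝓘(ℝ, E) x) : ∀ y : M', TangentSpace 𝓘(ℝ, E) y :=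
  VectorField.mpullback 𝓘(ℝ, E) 𝓘(ℝ, E) f.symm Y

omit [IsManifold 𝓘(ℝ, E) ∞ M] [IsManifold 𝓘(ℝ, E) ∞ M'] in
lemma isInvertible_mfderiv_symm (y : M') :
    (mfderiv 𝓘(ℝ, E) 𝓘(ℝ, E) f.symm y).IsInvertible :=
  ⟨tangentEquiv f.symm y, coe_tangentEquiv f.symm y⟩

omit [IsManifold 𝓘(ℝ, E) ∞ M] [IsManifold 𝓘(ℝ, E) ∞ M'] in
lemma pushforward_apply (Y : ∀ x : M, TangentSpace 𝓘(ℝ, E) x) (x : M) :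
    pushforward f Y (f x) = tangentEquiv f x (Y x) := by
  have hY : ∀ z, z = x → (Y z : E) = (Y x : E) := by rintro _ rfl; rfl
  have h1 : (tangentEquiv f.symm (f x) : E → E) (tangentEquiv f x (Y x)) = Y x := by
    have h2 := mfderiv_comp x (f.symm.mdifferentiable (by simp) (f x))
      (f.mdifferentiable (by simp) x)
    have h3 : f.symm ∘ f = id := funext f.symm_apply_apply
    rw [h3, mfderiv_id, ← coe_tangentEquiv, ← coe_tangentEquiv] at h2
    exact (DFunLike.congr_fun h2 (Y x)).symm
  have h4 : (tangentEquiv f.symm (f x) : E → E) (tangentEquiv f x (Y x)) =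
      Y (f.symm (f x)) := h1.trans (hY _ (f.symm_apply_apply x)).symm
  rw [pushforward, VectorField.mpullback_apply, ← coe_tangentEquiv,
    ContinuousLinearMap.inverse_equiv]
  exact ((tangentEquiv f.symm (f x)).symm_apply_eq).2 h4.symm

omit [IsManifold 𝓘(ℝ, E) ∞ M] [IsManifold 𝓘(ℝ, E) ∞ M'] in
/-- A vector field on the target is determined by its values at the images of points. -/
lemma field_ext {Y Z : ∀ y : M', TangentSpace 𝓘(ℝ, E) y} (h : ∀ x, Y (f x) = Z (f x)) : Y = Z := by
  funext y
  obtain ⟨x, rfl⟩ := f.surjective y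
  exact h x

lemma SmoothAt.pushforward [CompleteSpace E] {Y : ∀ x : M, TangentSpace 𝓘(ℝ, E) x} {x : M}
    (hY : SmoothAt Y x) : SmoothAt (pushforward f Y) (f x) := by
  have : IsManifold 𝓘(ℝ, E) 1 M := IsManifold.of_le (n := ∞) (by simp)
  refine ContMDiffAt.mpullback_vectorField_preimage (n := ∞) ?_ f.symm.contMDiff.contMDiffAt
    (isInvertible_mfderiv_symm f _) (by simp)
  rw [f.symm_apply_apply]
  exact hY

omit [IsManifold 𝓘(ℝ, E) ∞ M] [IsManifold 𝓘(ℝ, E) ∞ M'] in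
lemma pushforward_symm_apply (Y : ∀ y : M', TangentSpace 𝓘(ℝ, E) y) (x : M) :
    pushforward f.symm Y x = (tangentEquiv f x).symm (Y (f x)) := by
  change (mfderiv 𝓘(ℝ, E) 𝓘(ℝ, E) f x).inverse (Y (f x)) = _
  rw [← coe_tangentEquiv, ContinuousLinearMap.inverse_equiv]
  rfl

omit [IsManifold 𝓘(ℝ, E) ∞ M] [IsManifold 𝓘(ℝ, E) ∞ M'] in
lemma pushforward_symm_pushforward (Y : ∀ x : M, TangentSpace 𝓘(ℝ, E) x) :
    pushforward f.symm (pushforward f Y) = Y := by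
  funext x
  rw [pushforward_symm_apply, pushforward_apply, ContinuousLinearEquiv.symm_apply_apply]

omit [IsManifold 𝓘(ℝ, E) ∞ M] [IsManifold 𝓘(ℝ, E) ∞ M'] in
lemma pushforward_pushforward_symm (Y : ∀ y : M', TangentSpace 𝓘(ℝ, E) y) :
    pushforward f (pushforward f.symm Y) = Y :=
  pushforward_symm_pushforward f.symm Y

lemma smoothAt_pushforward_iff [CompleteSpace E] {Y : ∀ x : M, TangentSpace 𝓘(ℝ, E) x} {x : M} :
    SmoothAt (pushforward f Y) (f x) ↔ SmoothAt Y x := by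
  refine ⟨fun h ↦ ?_, fun h ↦ h.pushforward f⟩
  have := h.pushforward f.symm
  rwa [pushforward_symm_pushforward, f.symm_apply_apply] at this

lemma mdifferentiableAt_pushforward [CompleteSpace E] {Y : ∀ x : M, TangentSpace 𝓘(ℝ, E) x}
    {x : M} (hY : MDiffAt (T% Y) x) : MDiffAt (T% (pushforward f Y)) (f x) := by
  refine MDifferentiableAt.mpullback_vectorField (n := ∞) ?_ f.symm.contMDiff.contMDiffAt
    (isInvertible_mfderiv_symm f _) two_le_infty
  rw [f.symm_apply_apply]
  exact hY

lemma tangentEquiv_mlieBracket [CompleteSpace E] {X Y : ∀ x : M, TangentSpace 𝓘(ℝ, E) x} {x : M}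
    (hX : MDiffAt (T% X) x) (hY : MDiffAt (T% Y) x) :
    tangentEquiv f x (VectorField.mlieBracket 𝓘(ℝ, E) X Y x) =
      VectorField.mlieBracket 𝓘(ℝ, E) (pushforward f X) (pushforward f Y) (f x) := by
  have : IsManifold 𝓘(ℝ, E) (minSmoothness ℝ 2) M :=
    IsManifold.of_le (n := ∞) (by simpa using two_le_infty)
  have : IsManifold 𝓘(ℝ, E) (minSmoothness ℝ 2) M' :=
    IsManifold.of_le (n := ∞) (by simpa using two_le_infty)
  rw [← pushforward_apply f (VectorField.mlieBracket 𝓘(ℝ, E) X Y)]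
  refine VectorField.mpullback_mlieBracket (n := ∞) ?_ ?_ f.symm.contMDiff.contMDiffAt
    (by simpa using two_le_infty) <;>
  rwa [f.symm_apply_apply]

/-- The pullback of a connection by a diffeomorphism. -/
def pullbackConnection (cov : Operator E M') : Operator E M := fun Y x ↦
  (tangentEquiv f x).symm.toContinuousLinearMap ∘L cov (pushforward f Y) (f x) ∘L
    (tangentEquiv f x).toContinuousLinearMap

omit [IsManifold 𝓘(ℝ, E) ∞ M] [IsManifold 𝓘(ℝ, E) ∞ M'] in
lemma tangentEquiv_pullbackConnection (cov : Operator E M') (Y : ∀ x : M, TangentSpace 𝓘(ℝ, E) x)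
    (x : M) (v : TangentSpace 𝓘(ℝ, E) x) :
    tangentEquiv f x (pullbackConnection f cov Y x v) =
      cov (pushforward f Y) (f x) (tangentEquiv f x v) := by
  simp [pullbackConnection]

variable [FiniteDimensional ℝ E]

lemma isSmoothConnectionOn_pullbackConnection {cov : Operator E M'}
    (h : IsSmoothConnectionOn cov Set.univ) :
    IsSmoothConnectionOn (pullbackConnection f cov) Set.univ := by
  have : CompleteSpace E := FiniteDimensional.complete ℝ E
  refine ⟨⟨?_, ?_⟩, ?_⟩
  · intro X Y x hX hY _
    ext v
    apply (tangentEquiv f x).injective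
    have h1 : pushforward f (X + Y) = pushforward f X + pushforward f Y := by
      refine field_ext f fun x ↦ ?_
      simp [pushforward_apply]
    rw [add_apply, map_add]
    simp only [tangentEquiv_pullbackConnection]
    rw [h1, h.isCov.add (mdifferentiableAt_pushforward f hX) (mdifferentiableAt_pushforward f hY)
      trivial, add_apply]
  · intro Y g x hY hg _
    ext v
    apply (tangentEquiv f x).injective
    have h1 : pushforward f (g • Y) = (g ∘ f.symm) • pushforward f Y := by
      refine field_ext f fun x ↦ ?_
      simp [pushforward_apply]
    have hg' : MDifferentiableAt 𝓘(ℝ, E) 𝓘(ℝ, ℝ) (g ∘ f.symm) (f x) := by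
      refine MDifferentiableAt.comp (f x) ?_ (f.symm.mdifferentiable (by simp) (f x))
      rwa [f.symm_apply_apply]
    have hd : mvfderiv 𝓘(ℝ, E) g x v = mvfderiv 𝓘(ℝ, E) (g ∘ f.symm) (f x)
        (tangentEquiv f x v) := by
      have h2 : (g ∘ f.symm) ∘ f = g := by ext; simp
      conv_lhs => rw [← h2]
      rw [mvfderiv, mfderiv_comp x hg' (f.mdifferentiable (by simp) x), ← coe_tangentEquiv]
      rfl
    have h3 := h.isCov.leibniz (mdifferentiableAt_pushforward f hY) hg' (x := f x) trivial
    rw [← h1] at h3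
    rw [tangentEquiv_pullbackConnection, h3]
    simp [tangentEquiv_pullbackConnection, hd, pushforward_apply]
  · intro x _ Y Z hY hZ
    rw [← smoothAt_pushforward_iff f]
    refine (h.smoothAt (f x) trivial _ _ (hY.pushforward f) (hZ.pushforward f)).congr
      (Filter.Eventually.of_forall (congrFun (field_ext f fun x ↦ ?_)))
    rw [pushforward_apply, tangentEquiv_pullbackConnection, pushforward_apply]

/-- The image of a field of endomorphisms under a diffeomorphism. -/
def pushforwardAffinor (F : ∀ x : M, TangentSpace 𝓘(ℝ, E) x →L[ℝ] TangentSpace 𝓘(ℝ, E) x)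
    (y : M') : TangentSpace 𝓘(ℝ, E) y →L[ℝ] TangentSpace 𝓘(ℝ, E) y :=
  (tangentEquiv f.symm y).symm.toContinuousLinearMap ∘L F (f.symm y) ∘L
    (tangentEquiv f.symm y).toContinuousLinearMap

omit [IsManifold 𝓘(ℝ, E) ∞ M] [IsManifold 𝓘(ℝ, E) ∞ M'] [FiniteDimensional ℝ E] in
lemma pushforwardAffinor_field
    (F : ∀ x : M, TangentSpace 𝓘(ℝ, E) x →L[ℝ] TangentSpace 𝓘(ℝ, E) x)
    (Y : ∀ y : M', TangentSpace 𝓘(ℝ, E) y) :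
    (fun y ↦ pushforwardAffinor f F y (Y y)) =
      pushforward f (fun x ↦ F x (pushforward f.symm Y x)) := by
  funext y
  have h := pushforward_symm_apply f.symm (fun x ↦ F x (pushforward f.symm Y x)) y
  change pushforward f (fun x ↦ F x (pushforward f.symm Y x)) y = _ at h
  rw [h, pushforward_apply f.symm]
  rfl

omit [IsManifold 𝓘(ℝ, E) ∞ M] [FiniteDimensional ℝ E] in
lemma pushforwardAffinor_apply
    (F : ∀ x : M, TangentSpace 𝓘(ℝ, E) x →L[ℝ] TangentSpace 𝓘(ℝ, E) x) (x : M)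
    (w : TangentSpace 𝓘(ℝ, E) (f x)) :
    pushforwardAffinor f F (f x) w = tangentEquiv f x (F x ((tangentEquiv f x).symm w)) := by
  obtain ⟨Y, -, rfl⟩ := exists_smoothAt (f x) w
  have h := congrFun (pushforwardAffinor_field f F Y) (f x)
  rw [pushforward_apply, pushforward_symm_apply] at h
  exact h

omit [FiniteDimensional ℝ E] in
/-- Under a morphism, membership in the structures is preserved by endomorphisms that are conjugate
by the tangent map. -/
lemma IsMorphism.mem_fibre_iff {Q : Structure E M} {Q' : Structure E M'} (h : IsMorphism Q Q' f)
    {x : M} {F : TangentSpace 𝓘(ℝ, E) x →L[ℝ] TangentSpace 𝓘(ℝ, E) x}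
    {G : TangentSpace 𝓘(ℝ, E) (f x) →L[ℝ] TangentSpace 𝓘(ℝ, E) (f x)}
    (hFG : ∀ v, tangentEquiv f x (F v) = G (tangentEquiv f x v)) :
    F ∈ Q.fibre x ↔ G ∈ Q'.fibre (f x) := by
  rw [h x F]
  constructor
  · rintro ⟨G', hG', h'⟩
    convert hG'
    ext w
    obtain ⟨v, rfl⟩ := (tangentEquiv f x).surjective w
    rw [← hFG]
    rw [← coe_tangentEquiv] at h'
    exact DFunLike.congr_fun h' v
  · intro hG
    refine ⟨G, hG, ?_⟩
    rw [← coe_tangentEquiv]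
    ext v
    exact hFG v

/-- Normality is invariant under isomorphisms. -/
lemma IsNormal.of_conj {V W : Type*} [AddCommGroup V] [Module ℝ V] [AddCommGroup W] [Module ℝ W]
    (e : V ≃ₗ[ℝ] W) {a b c L : V →ₗ[ℝ] V} {a' b' c' L' : W →ₗ[ℝ] W} (h : IsNormal a' b' c' L')
    (ha : ∀ v, e (a v) = a' (e v)) (hb : ∀ v, e (b v) = b' (e v)) (hc : ∀ v, e (c v) = c' (e v))
    (hL : ∀ v, e (L v) = L' (e v)) : IsNormal a b c L := by
  have key : ∀ {d d' : _}, (∀ v, e (d v) = d' (e v)) → LinearMap.trace ℝ W (d' ∘ₗ L') = 0 →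
      LinearMap.trace ℝ V (d ∘ₗ L) = 0 := by
    intro d d' hd h0
    rw [← LinearMap.trace_conj' (d ∘ₗ L) e, ← h0]
    congr 1
    ext w
    obtain ⟨v, rfl⟩ := e.surjective w
    simp [LinearEquiv.conj_apply, hd, hL]
  refine ⟨?_, key ha h.trace_left, key hb h.trace_middle, key hc h.trace_right⟩
  ext v
  apply e.injective
  have := LinearMap.congr_fun h.linearPart_eq (e v)
  simpa [linearPart_apply, ha, hb, hc, hL] using this

/-- The pullback of a Weyl connection by a morphism is a Weyl connection. -/
lemma Structure.IsWeylOn.pullbackConnection [CompleteSpace E] {Q : Structure E M}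
    {Q' : Structure E M'}
    (hf : IsMorphism Q Q' f) {cov : Operator E M'} (h : Q'.IsWeylOn cov Set.univ) :
    Q.IsWeylOn (pullbackConnection f cov) Set.univ := by
  refine ⟨isSmoothConnectionOn_pullbackConnection f h.connection, fun x _ F hF hFQ v ↦ ?_,
    fun x _ ↦ ?_⟩
  · have hF' : ContMDiffAt 𝓘(ℝ, E) (𝓘(ℝ, E).prod 𝓘(ℝ, E →L[ℝ] E)) ∞
        (affinorSection (pushforwardAffinor f F)) (f x) := by
      refine contMDiffAt_affinor fun Y hY ↦ ?_
      rw [pushforwardAffinor_field]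
      refine SmoothAt.pushforward f (SmoothAt.affinor hF ?_)
      have := hY.pushforward f.symm
      rwa [f.symm_apply_apply] at this
    have hFQ' : ∀ᶠ y in 𝓝 (f x), pushforwardAffinor f F y ∈ Q'.fibre y := by
      have hc : Filter.Tendsto f.symm (𝓝 (f x)) (𝓝 x) := by
        have := f.symm.continuous.continuousAt (x := f x)
        rwa [ContinuousAt, f.symm_apply_apply] at this
      filter_upwards [hc.eventually hFQ] with y hy
      obtain ⟨z, rfl⟩ := f.surjective y
      change F (f.symm (f z)) ∈ Q.fibre (f.symm (f z)) at hy
      rw [f.symm_apply_apply] at hy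
      exact (hf.mem_fibre_iff f fun v ↦ by simp [pushforwardAffinor_apply]).1 hy
    obtain ⟨G, hG, hG'⟩ := h.compatible (f x) trivial _ hF' hFQ' (tangentEquiv f x v)
    refine ⟨(tangentEquiv f x).symm.toContinuousLinearMap ∘L G ∘L
      (tangentEquiv f x).toContinuousLinearMap, (hf.mem_fibre_iff f fun v ↦ by simp).2 hG,
      fun Y hY ↦ ?_⟩
    have h1 := hG' (pushforward f Y) (hY.pushforward f)
    rw [pushforwardAffinor_field, pushforward_symm_pushforward, pushforwardAffinor_apply,
      pushforward_apply] at h1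
    apply (tangentEquiv f x).injective
    rw [map_sub, tangentEquiv_pullbackConnection]
    simpa [AlmostQuaternionic.pullbackConnection] using h1
  · obtain ⟨T, hT, hn⟩ := h.normalized (f x) trivial
    let e : TangentSpace 𝓘(ℝ, E) x ≃ₗ[ℝ] TangentSpace 𝓘(ℝ, E) (f x) :=
      (tangentEquiv f x).toLinearEquiv
    refine ⟨(T.compl₁₂ e.toLinearMap e.toLinearMap).compr₂ e.symm.toLinearMap,
      fun X Y hX hY ↦ ?_, fun A B C hA hB hC hABC X ↦ ?_⟩
    · have h1 := hT _ _ (mdifferentiableAt_pushforward f hX) (mdifferentiableAt_pushforward f hY)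
      rw [pushforward_apply, pushforward_apply, ← tangentEquiv_mlieBracket f hX hY] at h1
      apply e.injective
      change e (e.symm (T (e (X x)) (e (Y x)))) = tangentEquiv f x _
      rw [e.apply_symm_apply, map_sub, map_sub, tangentEquiv_pullbackConnection,
        tangentEquiv_pullbackConnection]
      exact h1
    · let k : (TangentSpace 𝓘(ℝ, E) x →L[ℝ] TangentSpace 𝓘(ℝ, E) x) →
          (TangentSpace 𝓘(ℝ, E) (f x) →L[ℝ] TangentSpace 𝓘(ℝ, E) (f x)) := fun F ↦
        (tangentEquiv f x).toContinuousLinearMap ∘L F ∘L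
          (tangentEquiv f x).symm.toContinuousLinearMap
      have hk : ∀ F v, tangentEquiv f x (F v) = k F (tangentEquiv f x v) := fun F v ↦ by simp [k]
      have hkm : ∀ {F}, F ∈ Q.fibre x → k F ∈ Q'.fibre (f x) := fun {F} hF ↦
        (hf.mem_fibre_iff f (hk F)).1 hF
      exact (hn (k A) (k B) (k C) (hkm hA) (hkm hB) (hkm hC)
        (hABC.conj (tangentEquiv f x)) (e X)).of_conj e (hk A) (hk B) (hk C) fun v ↦
          e.apply_symm_apply _

omit [IsManifold 𝓘(ℝ, E) ∞ M] [IsManifold 𝓘(ℝ, E) ∞ M'] [FiniteDimensional ℝ E] in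
lemma velocity_comp {c : ℝ → M} (hc : ContMDiff 𝓘(ℝ, ℝ) 𝓘(ℝ, E) ∞ c) (t : ℝ) :
    velocity (E := E) (f ∘ c) t = tangentEquiv f (c t) (velocity c t) := by
  rw [velocity, mfderiv_comp t (f.mdifferentiable (by simp) (c t))
    (hc.mdifferentiable (by simp) t), ← coe_tangentEquiv]
  rfl

/-- Geodesics of the pulled back connection, in terms of their images. -/
lemma IsUnparameterizedGeodesic.pullback
    {cov : CovariantDerivative 𝓘(ℝ, E) E (TangentSpace 𝓘(ℝ, E) : M' → Type _)} {c : ℝ → M}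
    (h : IsUnparameterizedGeodesic cov (f ∘ c))
    {cov' : CovariantDerivative 𝓘(ℝ, E) E (TangentSpace 𝓘(ℝ, E) : M → Type _)}
    (hcov' : cov'.toFun = pullbackConnection f cov.toFun) : IsUnparameterizedGeodesic cov' c := by
  have : CompleteSpace E := FiniteDimensional.complete ℝ E
  have hc : ContMDiff 𝓘(ℝ, ℝ) 𝓘(ℝ, E) ∞ c := by
    have := f.symm.contMDiff.comp h.smooth
    convert this
    ext t
    simp
  refine ⟨hc, fun t h0 ↦ h.regular t ?_, fun t ↦ ?_⟩
  · rw [velocity_comp f hc, h0, map_zero]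
  · obtain ⟨X, hX, hXc, a, ha⟩ := h.acceleration t
    refine ⟨pushforward f.symm X, fun x ↦ ?_, ?_, a, ?_⟩
    · have := SmoothAt.pushforward f.symm (hX (f x))
      rwa [f.symm_apply_apply] at this
    · filter_upwards [hXc] with s hs
      rw [pushforward_symm_apply]
      exact (ContinuousLinearEquiv.symm_apply_eq _).2 (hs.trans (velocity_comp f hc s))
    · apply (tangentEquiv f (c t)).injective
      rw [hcov', tangentEquiv_pullbackConnection, pushforward_pushforward_symm, map_smul,
        ← velocity_comp f hc]
      exact ha

end Transport

/-! ### Recovering the structure from the geodesics -/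

section LinearAlgebra

/-- A covector may be prescribed on a quaternionic frame of a quaternionic line. -/
lemma HypercomplexRel.exists_dual {V : Type*} [AddCommGroup V] [Module ℝ V] {a b c : V →ₗ[ℝ] V}
    (h : HypercomplexRel a b c) {X : V} (hX : X ≠ 0) (p q r s : ℝ) :
    ∃ η : Module.Dual ℝ V, η X = p ∧ η (a X) = q ∧ η (b X) = r ∧ η (c X) = s := by
  have hli : LinearIndependent ℝ ![X, a X, b X, c X] := by
    rw [Fintype.linearIndependent_iff]
    intro g hg
    simp only [Fin.sum_univ_four, Matrix.cons_val_zero, Matrix.cons_val_one, Matrix.cons_val] at hg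
    obtain ⟨h0, h1, h2, h3⟩ := h.coeff_eq_zero hX hg
    intro i; fin_cases i <;> assumption
  obtain ⟨g, hg⟩ := LinearMap.exists_leftInverse_of_injective
    (Fintype.linearCombination ℝ ![X, a X, b X, c X])
    (LinearMap.ker_eq_bot.2 (hli.fintypeLinearCombination_injective))
  have hgi : ∀ i, g (![X, a X, b X, c X] i) = Pi.single i 1 := fun i ↦ by
    have := LinearMap.congr_fun hg (Pi.single i 1)
    simpa using this
  have h0 : g X = Pi.single 0 1 := hgi 0
  have h1 : g (a X) = Pi.single 1 1 := hgi 1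
  have h2 : g (b X) = Pi.single 2 1 := hgi 2
  have h3 : g (c X) = Pi.single 3 1 := hgi 3
  exact ⟨Fintype.linearCombination ℝ ![p, q, r, s] ∘ₗ g, by simp [h0], by simp [h1],
    by simp [h2], by simp [h3]⟩

variable {V : Type*} [AddCommGroup V] [Module ℝ V] [TopologicalSpace V]
  [IsTopologicalAddGroup V] [ContinuousSMul ℝ V]

omit [ContinuousSMul ℝ V] in
/-- Each of `A X`, `B X`, `C X` is the value at `X` of some endomorphism `{X, η}`. -/
lemma IsHypercomplex.exists_bracket_eq {A B C : V →L[ℝ] V} (h : IsHypercomplex A B C) {X : V}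
    (hX : X ≠ 0) : (∃ η, bracket A B C X η X = A X) ∧ (∃ η, bracket A B C X η X = B X) ∧
      ∃ η, bracket A B C X η X = C X := by
  -- `{X, η} X = 2 (η(X) X - η(A X) A X - η(B X) B X - η(C X) C X)`, whence the factor `-1 / 2`
  obtain ⟨η₁, h₁⟩ := h.rel.exists_dual hX 0 (-1 / 2) 0 0
  obtain ⟨η₂, h₂⟩ := h.rel.exists_dual hX 0 0 (-1 / 2) 0
  obtain ⟨η₃, h₃⟩ := h.rel.exists_dual hX 0 0 0 (-1 / 2)
  simp only [ContinuousLinearMap.coe_coe] at h₁ h₂ h₃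
  refine ⟨⟨η₁, ?_⟩, ⟨η₂, ?_⟩, ⟨η₃, ?_⟩⟩
  · simp only [bracket, h₁]; module
  · simp only [bracket, h₂]; module
  · simp only [bracket, h₃]; module

end LinearAlgebra

section Weyl

variable {E : Type*} [NormedAddCommGroup E] [NormedSpace ℝ E] [FiniteDimensional ℝ E]
  [CompleteSpace E]
  {M : Type*} [TopologicalSpace M] [ChartedSpace E M] [IsManifold 𝓘(ℝ, E) ∞ M]
  {M' : Type*} [TopologicalSpace M'] [ChartedSpace E M'] [IsManifold 𝓘(ℝ, E) ∞ M']

omit [CompleteSpace E] in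
/-- Two Weyl connections differ along `v` in the direction of `v` by a quaternionic multiple
of `v`. -/
lemma Structure.IsWeylOn.exists_sub_eq {Q : Structure E M} {cov cov' : Operator E M}
    (h : Q.IsWeylOn cov Set.univ) (h' : Q.IsWeylOn cov' Set.univ) (x : M)
    (v : TangentSpace 𝓘(ℝ, E) x) : ∃ F ∈ Q.fibre x, ∀ Y : ∀ y : M, TangentSpace 𝓘(ℝ, E) y,
      MDiffAt (T% Y) x → Y x = v → cov' Y x v - cov Y x v = F v := by
  obtain ⟨U, hx, A, B, C, hQ⟩ := Q.exists_isFrameOn x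
  have hr := (hQ.isHypercomplex x hx).rel
  let S : TangentSpace 𝓘(ℝ, E) x →ₗ[ℝ] TangentSpace 𝓘(ℝ, E) x →ₗ[ℝ] TangentSpace 𝓘(ℝ, E) x :=
    (toLinearMap₂ (h'.connection.isCov.difference h.connection.isCov x)).flip
  have hS : ∀ Y : ∀ y : M, TangentSpace 𝓘(ℝ, E) y, MDiffAt (T% Y) x → ∀ v,
      S v (Y x) = cov' Y x v - cov Y x v := fun Y hY v ↦
    DFunLike.congr_fun (h'.connection.isCov.difference_apply h.connection.isCov trivial hY) v
  have hcomm : ∀ D : ∀ y : M, TangentSpace 𝓘(ℝ, E) y →L[ℝ] TangentSpace 𝓘(ℝ, E) y,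
      ContMDiffAt 𝓘(ℝ, E) (𝓘(ℝ, E).prod 𝓘(ℝ, E →L[ℝ] E)) ∞ (affinorSection D) x →
      (∀ᶠ y in 𝓝 x, D y ∈ Q.fibre y) → ∀ v,
      IsQuaternion (A x : TangentSpace 𝓘(ℝ, E) x →ₗ[ℝ] TangentSpace 𝓘(ℝ, E) x)
        (B x : TangentSpace 𝓘(ℝ, E) x →ₗ[ℝ] TangentSpace 𝓘(ℝ, E) x)
        (C x : TangentSpace 𝓘(ℝ, E) x →ₗ[ℝ] TangentSpace 𝓘(ℝ, E) x)
        (fun w ↦ S v (D x w) - D x (S v w)) := by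
    intro D hD hDQ v
    obtain ⟨G, hG, hG'⟩ := h.compatible x trivial D hD hDQ v
    obtain ⟨G₂, hG₂, hG₂'⟩ := h'.compatible x trivial D hD hDQ v
    have h1 := ((hQ.mem_fibre_iff hx).1 hG₂).sub ((hQ.mem_fibre_iff hx).1 hG)
    convert h1 using 2 with w
    obtain ⟨Y, hY, rfl⟩ := exists_smoothAt x w
    rw [hS (fun y ↦ D y (Y y)) (SmoothAt.affinor hD hY).mdifferentiableAt,
      hS Y hY.mdifferentiableAt, ← hG' Y hY, ← hG₂' Y hY, map_sub]
    abel
  obtain ⟨T, hT, hn⟩ := h.normalized x trivial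
  obtain ⟨T', hT', hn'⟩ := h'.normalized x trivial
  have hTS : ∀ X, S.flip X - S X = T'.flip X - T.flip X := by
    intro X
    ext w
    obtain ⟨X, hX, rfl⟩ := exists_smoothAt x X
    obtain ⟨Y, hY, rfl⟩ := exists_smoothAt x w
    simp only [LinearMap.sub_apply, LinearMap.flip_apply]
    rw [hT Y X hY.mdifferentiableAt hX.mdifferentiableAt,
      hT' Y X hY.mdifferentiableAt hX.mdifferentiableAt, hS X hX.mdifferentiableAt,
      hS Y hY.mdifferentiableAt]
    abel
  have hU := hQ.isOpen.mem_nhds hx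
  have hA := hQ.memA hx
  have hB := hQ.memB hx
  have hC := hQ.memC hx
  obtain ⟨F, hF, hFv⟩ := quaternion_of_torsion hr S
    (hcomm A (hQ.smoothA x hx) (Filter.mem_of_superset hU fun y hy ↦ hQ.memA hy))
    (hcomm B (hQ.smoothB x hx) (Filter.mem_of_superset hU fun y hy ↦ hQ.memB hy))
    (hcomm C (hQ.smoothC x hx) (Filter.mem_of_superset hU fun y hy ↦ hQ.memC hy))
    (fun X ↦ by
      rw [hTS, linearPart_sub, (hn' _ _ _ hA hB hC (hQ.isHypercomplex x hx) X).linearPart_eq,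
        (hn _ _ _ hA hB hC (hQ.isHypercomplex x hx) X).linearPart_eq, sub_zero]) v
  obtain ⟨F', hF', hFF'⟩ := hQ.exists_mem_fibre hx hF
  refine ⟨F', hF', fun Y hY hYv ↦ ?_⟩
  rw [← hFF', ← hFv, ← hS Y hY v, hYv]

variable {Q : Structure E M} {Q' : Structure E M'} (f : M ≃ₘ⟮𝓘(ℝ, E), 𝓘(ℝ, E)⟯ M')

omit [CompleteSpace E] in
/-- If two connections share an unparameterized geodesic, then they differ along its velocity
in the direction of the velocity by a multiple of the velocity. -/
lemma IsUnparameterizedGeodesic.exists_sub_eq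
    {cov cov' : CovariantDerivative 𝓘(ℝ, E) E (TangentSpace 𝓘(ℝ, E) : M → Type _)} {c : ℝ → M}
    (h : IsUnparameterizedGeodesic cov c) (h' : IsUnparameterizedGeodesic cov' c) (t : ℝ) :
    ∃ a : ℝ, ∀ Y : ∀ y : M, TangentSpace 𝓘(ℝ, E) y, MDiffAt (T% Y) (c t) →
      Y (c t) = velocity c t → cov' Y (c t) (velocity c t) - cov Y (c t) (velocity c t) =
        a • velocity (E := E) c t := by
  obtain ⟨X, hX, hXc, a, ha⟩ := h.acceleration t
  obtain ⟨X', hX', hXc', a', ha'⟩ := h'.acceleration t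
  have hXd : MDiffAt (T% X) (c t) := SmoothAt.mdifferentiableAt (hX (c t))
  have h1 : cov' X (c t) (velocity c t) = cov' X' (c t) (velocity c t) :=
    cov_velocity_congr cov'.isCovariantDerivativeOnUniv h.smooth hXd
      (SmoothAt.mdifferentiableAt (hX' (c t))) hXc hXc'
  have hd := cov'.isCovariantDerivativeOnUniv.difference_apply cov.isCovariantDerivativeOnUniv
    (x := c t) trivial hXd
  refine ⟨a' - a, fun Y hY hYv ↦ ?_⟩
  have hd' := cov'.isCovariantDerivativeOnUniv.difference_apply cov.isCovariantDerivativeOnUniv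
    (x := c t) trivial hY
  rw [hYv, ← hXc.self_of_nhds, hd] at hd'
  have h2 := DFunLike.congr_fun hd' (velocity c t)
  change cov' X (c t) (velocity c t) - cov X (c t) (velocity c t) =
    cov' Y (c t) (velocity c t) - cov Y (c t) (velocity c t) at h2
  rw [← h2, h1, ha, ha', sub_smul]

variable [T2Space M] [T2Space M']

/-- If `f` maps Weyl geodesics to Weyl geodesics, then in each direction some pulled back Weyl
connection has the same acceleration as a given one, up to reparameterization. -/
lemma exists_pullbackConnection_sub_eq
    (H : ∀ c : ℝ → M, Q.IsWeylGeodesic c → Q'.IsWeylGeodesic (f ∘ c)) {cov : Operator E M}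
    (h : Q.IsWeylOn cov Set.univ) (x : M) {v : TangentSpace 𝓘(ℝ, E) x} (hv : v ≠ 0) :
    ∃ cov' : Operator E M', Q'.IsWeylOn cov' Set.univ ∧ ∃ a : ℝ,
      ∀ Y : ∀ y : M, TangentSpace 𝓘(ℝ, E) y, MDiffAt (T% Y) x → Y x = v →
        pullbackConnection f cov' Y x v - cov Y x v = a • v := by
  let D : CovariantDerivative 𝓘(ℝ, E) E (TangentSpace 𝓘(ℝ, E) : M → Type _) :=
    ⟨cov, h.connection.isCov⟩
  obtain ⟨c, hc, rfl, hcv⟩ := exists_isUnparameterizedGeodesic D h.connection x hv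
  have hv' : velocity c 0 = v := by
    have := congrArg (fun u ↦ constField (c 0) u (c 0)) hcv
    simpa only [constField_coord (mem_frameSet E (c 0))] using this
  subst hv'
  obtain ⟨cov', hcov', hfc⟩ := H c ⟨D, (Q.isWeyl_iff D).2 h, hc⟩
  have hW := (Q'.isWeyl_iff cov').1 hcov'
  let D' : CovariantDerivative 𝓘(ℝ, E) E (TangentSpace 𝓘(ℝ, E) : M → Type _) :=
    ⟨pullbackConnection f cov'.toFun,
      (isSmoothConnectionOn_pullbackConnection f hW.connection).isCov⟩
  exact ⟨cov'.toFun, hW, hc.exists_sub_eq (cov' := D') (hfc.pullback f rfl) 0⟩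

/-- If `f` maps Weyl geodesics to Weyl geodesics, then its tangent map sends `{v, η} v` to a
quaternionic multiple of the image of `v`: compare a Weyl connection and its modification by `η`
with the pullbacks of Weyl connections that have the corresponding geodesics. -/
lemma exists_mem_fibre_tangentEquiv_bracket [SigmaCompactSpace M] (hd : 2 < Module.finrank ℝ E)
    (H : ∀ c : ℝ → M, Q.IsWeylGeodesic c → Q'.IsWeylGeodesic (f ∘ c))
    {A B C : ∀ x : M, TangentSpace 𝓘(ℝ, E) x →L[ℝ] TangentSpace 𝓘(ℝ, E) x} {U : Set M}
    (hQ : Q.IsFrameOn A B C U) {x : M} (hx : x ∈ U) {v : TangentSpace 𝓘(ℝ, E) x} (hv : v ≠ 0)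
    (η : Module.Dual ℝ (TangentSpace 𝓘(ℝ, E) x)) : ∃ F ∈ Q'.fibre (f x),
      tangentEquiv f x (bracket (A x) (B x) (C x) v η v) = F (tangentEquiv f x v) := by
  obtain ⟨cov₁, h₁⟩ := Q.exists_isWeyl hd
  obtain ⟨cov₂, h₂, h₁₂⟩ := h₁.exists_bracket hQ hx η
  obtain ⟨cov₁', h₁', a₁, ha₁⟩ := exists_pullbackConnection_sub_eq f H h₁ x hv
  obtain ⟨cov₂', h₂', a₂, ha₂⟩ := exists_pullbackConnection_sub_eq f H h₂ x hv
  obtain ⟨F, hF, hF'⟩ := h₁'.exists_sub_eq h₂' (f x) (tangentEquiv f x v)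
  obtain ⟨Y, hY, hYv⟩ := exists_smoothAt x v
  obtain ⟨U', hx', A', B', C', hQ'⟩ := Q'.exists_isFrameOn (f x)
  have hid : ContinuousLinearMap.id ℝ _ ∈ Q'.fibre (f x) :=
    (hQ'.mem_fibre_iff hx').2 IsQuaternion.id
  have h3 := hF' _ (mdifferentiableAt_pushforward f hY.mdifferentiableAt)
    (by rw [pushforward_apply, hYv])
  rw [← tangentEquiv_pullbackConnection, ← tangentEquiv_pullbackConnection, ← map_sub] at h3
  have h4 : bracket (A x) (B x) (C x) v η v =
      pullbackConnection f cov₂' Y x v - pullbackConnection f cov₁' Y x v + (a₁ - a₂) • v := by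
    have h5 := h₁₂ Y v
    rw [hYv] at h5
    rw [sub_smul, ← ha₁ Y hY.mdifferentiableAt hYv, ← ha₂ Y hY.mdifferentiableAt hYv, h5]
    abel
  refine ⟨F + (a₁ - a₂) • ContinuousLinearMap.id ℝ _,
    Submodule.add_mem _ hF (Submodule.smul_mem _ _ hid), ?_⟩
  rw [h4, map_add, h3, map_smul]
  rfl

/-- Diffeomorphisms that map Weyl geodesics to Weyl geodesics are morphisms. -/
theorem isMorphism_of_isWeylGeodesic [SigmaCompactSpace M] (hd : 4 < Module.finrank ℝ E)
    (H : ∀ c : ℝ → M, Q.IsWeylGeodesic c → Q'.IsWeylGeodesic (f ∘ c)) : IsMorphism Q Q' f := by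
  intro x
  obtain ⟨U, hx, A, B, C, hQ⟩ := Q.exists_isFrameOn x
  obtain ⟨U', hx', A', B', C', hQ'⟩ := Q'.exists_isFrameOn (f x)
  have hABC := hQ.isHypercomplex x hx
  have hABC' := hQ'.isHypercomplex (f x) hx'
  set e := tangentEquiv f x with he
  let k : (TangentSpace 𝓘(ℝ, E) x →L[ℝ] TangentSpace 𝓘(ℝ, E) x) →
      (TangentSpace 𝓘(ℝ, E) (f x) →L[ℝ] TangentSpace 𝓘(ℝ, E) (f x)) := fun F ↦
    e.toContinuousLinearMap ∘L F ∘L e.symm.toContinuousLinearMap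
  have hk : ∀ F v, k F (e v) = e (F v) := fun F v ↦ by simp [k]
  have hmem : ∀ D : TangentSpace 𝓘(ℝ, E) x →L[ℝ] TangentSpace 𝓘(ℝ, E) x,
      (∀ v ≠ 0, ∃ η, bracket (A x) (B x) (C x) v η v = D v) → k D ∈ Q'.fibre (f x) := by
    intro D hD
    rw [hQ'.mem_fibre_iff hx']
    refine hABC'.rel.isQuaternion_of_forall_exists
      (exists_notMem_quaternionic_line _ _ _ hd) (k D : _ →ₗ[ℝ] _) fun w ↦ ?_
    obtain ⟨v, rfl⟩ := e.surjective w
    rcases eq_or_ne v 0 with rfl | hv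
    · exact ⟨_, IsQuaternion.id, by simp⟩
    · obtain ⟨η, hη⟩ := hD v hv
      obtain ⟨F, hF, hF'⟩ := exists_mem_fibre_tangentEquiv_bracket f (by omega) H hQ hx hv η
      refine ⟨F, (hQ'.mem_fibre_iff hx').1 hF, ?_⟩
      rw [← hF', hη]
      exact hk D v
  have hspan : Submodule.span ℝ {ContinuousLinearMap.id ℝ _, k (A x), k (B x), k (C x)} =
      Q'.fibre (f x) := by
    rw [hQ'.fibre_eq _ hx']
    refine (hABC.conj e).span_eq_of_le hABC' (Submodule.span_le.2 ?_)
    rw [← hQ'.fibre_eq _ hx']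
    rintro F (rfl | rfl | rfl | rfl)
    · exact (hQ'.mem_fibre_iff hx').2 IsQuaternion.id
    · exact hmem _ fun v hv ↦ (hABC.exists_bracket_eq hv).1
    · exact hmem _ fun v hv ↦ (hABC.exists_bracket_eq hv).2.1
    · exact hmem _ fun v hv ↦ (hABC.exists_bracket_eq hv).2.2
  intro F
  rw [← coe_tangentEquiv, ← he, hQ.mem_fibre_iff hx]
  constructor
  · rintro ⟨p, q, r, s, hF⟩
    refine ⟨k F, ?_, by ext v; exact (hk F v).symm⟩
    rw [← hspan, mem_span_iff_isQuaternion]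
    refine ⟨p, q, r, s, fun w ↦ ?_⟩
    obtain ⟨v, rfl⟩ := e.surjective w
    simp only [ContinuousLinearMap.coe_coe, hk]
    rw [hF]
    simp
  · rintro ⟨G, hG, hFG⟩
    rw [← hspan, mem_span_iff_isQuaternion] at hG
    obtain ⟨p, q, r, s, hG⟩ := hG
    refine ⟨p, q, r, s, fun v ↦ e.injective ?_⟩
    have h1 : e (F v) = G (e v) := DFunLike.congr_fun hFG v
    rw [h1, hG]
    simp only [ContinuousLinearMap.coe_coe, hk]
    simp

omit [FiniteDimensional ℝ E] [CompleteSpace E] [T2Space M] [T2Space M'] in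
lemma IsMorphism.symm {f : M ≃ₘ⟮𝓘(ℝ, E), 𝓘(ℝ, E)⟯ M'} (h : IsMorphism Q Q' f) :
    IsMorphism Q' Q f.symm := by
  intro y G
  obtain ⟨x, rfl⟩ : ∃ x, f x = y := ⟨f.symm y, f.apply_symm_apply y⟩
  obtain ⟨K, rfl⟩ : ∃ K : ∀ y : M', TangentSpace 𝓘(ℝ, E) y →L[ℝ] TangentSpace 𝓘(ℝ, E) y,
      K (f x) = G := by
    classical
    exact ⟨Function.update 0 (f x) G, Function.update_self ..⟩
  have h1 : pushforwardAffinor f.symm K x ∈ Q.fibre x ↔ K (f x) ∈ Q'.fibre (f x) :=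
    h.mem_fibre_iff f fun v ↦ (tangentEquiv f x).apply_symm_apply _
  have h2 : pushforwardAffinor f.symm K (f.symm (f x)) ∈ Q.fibre (f.symm (f x)) ↔
      pushforwardAffinor f.symm K x ∈ Q.fibre x := by rw [f.symm_apply_apply]
  rw [← h1, ← h2, ← coe_tangentEquiv]
  constructor
  · intro hK
    refine ⟨_, hK, ?_⟩
    ext w
    rw [ContinuousLinearMap.comp_apply, ContinuousLinearMap.comp_apply, pushforwardAffinor_apply]
    simp
  · rintro ⟨F, hF, hKF⟩
    convert hF
    ext w
    rw [pushforwardAffinor_apply]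
    have := DFunLike.congr_fun hKF ((tangentEquiv f.symm (f x)).symm w)
    simpa using this

/-- Morphisms pull Weyl geodesics back to Weyl geodesics. -/
theorem IsMorphism.isWeylGeodesic {f : M ≃ₘ⟮𝓘(ℝ, E), 𝓘(ℝ, E)⟯ M'} (h : IsMorphism Q Q' f)
    {c : ℝ → M} (hc : Q'.IsWeylGeodesic (f ∘ c)) : Q.IsWeylGeodesic c := by
  obtain ⟨cov, hcov, hgeo⟩ := hc
  have hW := ((Q'.isWeyl_iff cov).1 hcov).pullbackConnection f h
  let D : CovariantDerivative 𝓘(ℝ, E) E (TangentSpace 𝓘(ℝ, E) : M → Type _) :=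
    ⟨pullbackConnection f cov.toFun, hW.connection.isCov⟩
  exact ⟨D, (Q.isWeyl_iff D).2 hW, hgeo.pullback f rfl⟩

end Weyl

end AlmostQuaternionic

end

theorem theorem3p1 {n : ℕ} (hn : 2 ≤ n)
    {M : Type*} [TopologicalSpace M] [T2Space M] [SecondCountableTopology M]
    [ChartedSpace (EuclideanSpace ℝ (Fin (4 * n))) M] [IsManifold (𝓡 (4 * n)) ∞ M]
    {M' : Type*} [TopologicalSpace M'] [T2Space M'] [SecondCountableTopology M']
    [ChartedSpace (EuclideanSpace ℝ (Fin (4 * n))) M'] [IsManifold (𝓡 (4 * n)) ∞ M']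
    (Q : AlmostQuaternionic.Structure (EuclideanSpace ℝ (Fin (4 * n))) M)
    (Q' : AlmostQuaternionic.Structure (EuclideanSpace ℝ (Fin (4 * n))) M')
    (f : M ≃ₘ⟮𝓡 (4 * n), 𝓡 (4 * n)⟯ M') :
    (AlmostQuaternionic.IsMorphism Q Q' f ↔
      ∀ c : ℝ → M, Q.IsWeylGeodesic c → Q'.IsWeylGeodesic (f ∘ c)) ∧
    (AlmostQuaternionic.IsMorphism Q Q' f ↔
      ∀ c : ℝ → M, Q.IsWeylGeodesic c ↔ Q'.IsWeylGeodesic (f ∘ c)) := by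
  have : LocallyCompactSpace M :=
    ChartedSpace.locallyCompactSpace (EuclideanSpace ℝ (Fin (4 * n))) M
  have hd : 4 < Module.finrank ℝ (EuclideanSpace ℝ (Fin (4 * n))) := by
    rw [finrank_euclideanSpace_fin]
    omega
  have maps : AlmostQuaternionic.IsMorphism Q Q' f → ∀ c : ℝ → M, Q.IsWeylGeodesic c →
      Q'.IsWeylGeodesic (f ∘ c) := fun h c hc ↦ by
    refine h.symm.isWeylGeodesic (c := f ∘ c) ?_
    rwa [← Function.comp_assoc, show f.symm ∘ f = id from funext f.symm_apply_apply,
      Function.id_comp]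
  exact ⟨⟨maps, AlmostQuaternionic.isMorphism_of_isWeylGeodesic f hd⟩,
    fun h c ↦ ⟨maps h c, h.isWeylGeodesic⟩, fun h ↦
      AlmostQuaternionic.isMorphism_of_isWeylGeodesic f hd fun c ↦ (h c).1⟩
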